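/- **Setting.** Let $\Bbbk$ be a field of characteristic $0$ and write $\otimes=\otimes_{\Bbbk}$. Let $A$ be a unital associative $\Bbbk$-algebra with a finite complete family of orthogonal idempotents $(e_s)_{s\in I}$ (so $e_se_t=\delta_{st}e_s$ and $\sum_{s}e_s=1$), and put $B=\bigoplus_{s\in I}\Bbbk e_s$. A *($B$-linear) double bracket* on $A$ is a $\Bbbk$-bilinear map $\{\!\{-,-\}\!\}:A\times A\to A\otimes A$ such that $\{\!\{a,b\}\!\}=-\{\!\{b,a\}\!\}^\circ$, where $(x\otimes y)^\circ=y\otimes x$; $\{\!\{a,bc\}\!\}=\{\!\{a,b\}\!\}(1\otimes c)+(b\otimes 1)\{\!\{a,c\}\!\}$; and $\{\!\{a,e_s\}\!\}=0$ for all $a\in A$, $s\in I$. Its triple bracket is $$\{\!\{a,b,c\}\!\}=\{\!\{a,\{\!\{b,c\}\!\}\}\!\}_L+\tau\{\!\{b,\{\!\{c,a\}\!\}\}\!\}_L+\tau^2\{\!\{c,\{\!\{a,b\}\!\}\}\!\}_L,$$ where $\{\!\{a,x\otimes y\}\!\}_L=\{\!\{a,x\}\!\}\otimes y$ and $\tau(x\otimes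 y\otimes z)=z\otimes x\otimes y$. The bracket is *quasi-Poisson*, and $A$ is a *double quasi-Poisson algebra over $B$*, if for all $a,b,c\in A$ $$\begin{aligned}\{\!\{a,b,c\}\!\}=\tfrac14\sum_{s\in I}\big(&ce_sa\otimes e_sb\otimes e_s-ce_sa\otimes e_s\otimes be_s-ce_s\otimes ae_sb\otimes e_s+ce_s\otimes ae_s\otimes be_s\\&-e_sa\otimes e_sb\otimes e_sc+e_sa\otimes e_s\otimes be_sc+e_s\otimes ae_sb\otimes e_sc-e_s\otimes ae_s\otimes be_sc\big).\end{aligned}$$ An element $\Phi_s\in e_sAe_s$ has the *multiplicative property for $e_s$* if for all $a\in A$ $$\{\!\{\Phi_s,a\}\!\}=\tfrac12\big(ae_s\otimes\Phi_s-e_s\otimes\Phi_sa+a\Phi_s\otimes e_s-\Phi_s\otimes e_sa\big).$$ A *multiplicative moment map* is an invertible $\Phi=\sum_{s}\Phi_s\in A$ in which every $\Phi_s\in e_sAe_s$ has the multiplicative property for $e_s$; a double quasi-Poisson algebra with a multiplicative moment map is called *quasi-Hamiltonian*. **Fusion.** Let $i\ne j$ in $I$. Let $\bar A$ be the algebra obtained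 from $A$ by adjoining $e_{ij},e_{ji}$ with $e_{ij}=e_ie_{ij}e_j$, $e_{ji}=e_je_{ji}e_i$, $e_{ij}e_{ji}=e_i$, $e_{ji}e_{ij}=e_j$, and let $\epsilon=1-e_j$. The *fusion of $e_j$ onto $e_i$* is the algebra $A^f=A^f_{e_j\to e_i}=\epsilon\bar A\epsilon$ with unit $\epsilon$, with the complete orthogonal idempotents $e_s^f$, $s\in I\setminus\{j\}$, where for $a\in A$ $$a^f=\epsilon a\epsilon+e_{ij}a\epsilon+\epsilon ae_{ji}+e_{ij}ae_{ji}\in A^f .$$ It carries the double bracket $\{\!\{-,-\}\!\}^f=\{\!\{-,-\}\!\}_{ind}+\{\!\{-,-\}\!\}_{fus}$. Here $\{\!\{-,-\}\!\}_{ind}$ is the unique double bracket with $\{\!\{a^f,b^f\}\!\}_{ind}=x^f\otimes y^f$ (summation understood) whenever $\{\!\{a,b\}\!\}=x\otimes y$, for $a,b\in A$. And $\{\!\{-,-\}\!\}_{fus}$ is the unique double bracket with the following values, for $t,t'\in\epsilon A\epsilon$, $u,u'\in e_jA\epsilon$, $v,v'\in\epsilon Ae_j$, $w,w'\in e_jAe_j$,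 where on the right-hand sides (and in the arguments) $t,u,v,w$ stand for $t^f,u^f,v^f,w^f$ and $e$ stands for $e_i^f$: $$\begin{aligned} \{\!\{t,t'\}\!\}_{fus}&=0, & \{\!\{w,w'\}\!\}_{fus}&=0,\\ \{\!\{t,u\}\!\}_{fus}&=\tfrac12(e\otimes tu-et\otimes u), & \{\!\{t,v\}\!\}_{fus}&=\tfrac12(vt\otimes e-v\otimes te),\\ \{\!\{u,u'\}\!\}_{fus}&=\tfrac12(e\otimes uu'-u'u\otimes e), & \{\!\{v,v'\}\!\}_{fus}&=\tfrac12(v'v\otimes e-e\otimes vv'),\\ \{\!\{u,v\}\!\}_{fus}&=\tfrac12(u\otimes ev-v\otimes ue), & \{\!\{u,w\}\!\}_{fus}&=\tfrac12(e\otimes uw-w\otimes ue),\\ \{\!\{v,w\}\!\}_{fus}&=\tfrac12(wv\otimes e-ev\otimes w), & \{\!\{t,w\}\!\}_{fus}&=\tfrac12(wt\otimes e+e\otimes tw-w\otimes te-et\otimes w) \end{aligned}$$ (the remaining values follow from $\{\!\{x,y\}\!\}=-\{\!\{y,x\}\!\}^\circ$). To an element $\Phi\in A$ with components $\Phi_s=e_s\Phi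 e_s$ one associates $\Phi^{f\!f}=\Phi_i^f\Phi_j^f+\sum_{s\ne i,j}\Phi_s^f\in A^f$. Given a partition $I=\bigsqcup_{r\in J}I_r$, a *fusion algebra respecting the partition* is an algebra $\tilde A$ obtained from $A$ by a finite chain of fusions, with the double bracket constructed step by step as above, such that for $s,t\in I$ the idempotents $e_s$ and $e_t$ are identified by the chain (i.e. end up fused into the same idempotent of $\tilde A$) if and only if $s$ and $t$ lie in the same part $I_r$. For $s\in I$ we write $\tilde e_s$ for the idempotent of $\tilde A$ into which $e_s$ is fused, and for $\Phi\in A$ we write $\tilde\Phi\in\tilde A$ for the result of applying $\Phi\mapsto\Phi^{f\!f}$ at every step. **Theorem.** Let $A$ be a double quasi-Poisson algebra over $B=\bigoplus_{s\in I}\Bbbk e_s$, and let $A_1,A_2$ be fusion algebras respecting the same partition $I=\bigsqcup_{r\in J}I_r$. Assume that for every part $I_r$ with $|I_r|>1$ and every $s\in I_r$ there is an element $\Phi_s\in e_sAe_s$, invertible in $e_sAe_s$, that has the multiplicative property for $e_s$. Then $A_1$ and $A_2$ are double quasi-Poisson algebras, and there is an isomorphism of double quasi-Poisson algebras $\psi:A_1\to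 A_2$, that is, an isomorphism of $\Bbbk$-algebras that sends the idempotent $\tilde e_s$ of $A_1$ to the idempotent $\tilde e_s$ of $A_2$ for every $s\in I$ and satisfies $$\{\!\{\psi(a),\psi(b)\}\!\}_{A_2}=(\psi\otimes\psi)\{\!\{a,b\}\!\}_{A_1}\qquad(a,b\in A_1).$$ If furthermore $A$ is quasi-Hamiltonian, with multiplicative moment map $\Phi$, then the elements $\tilde\Phi\in A_1$ and $\tilde\Phi\in A_2$ obtained from $\Phi$ are multiplicative moment maps, and $\psi$ maps the first to the second; so $\psi$ is an isomorphism of quasi-Hamiltonian algebras. -/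

import Mathlib

open scoped TensorProduct

noncomputable section

namespace DoubleBr

universe u v w

/-! ### Double brackets -/

section Bracket

variable (k : Type u) [Field k] {ι : Type v} {A : Type w} [Ring A] [Algebra k A]

/-- A `B`-linear double bracket on `A`, where `B = ⊕ k e_s`. In terms of the algebra `A ⊗ A`, the
outer bimodule structure is `a d b = (a ⊗ 1) * d * (1 ⊗ b)`. -/
structure DoubleBracket (e : ι → A) where
  toFun : A →ₗ[k] A →ₗ[k] A ⊗[k] A
  antisymm : ∀ a b, toFun a b = - Algebra.TensorProduct.comm k A A (toFun b a)
  leibniz : ∀ a b c, toFun a (b * c) = toFun a b * (1 ⊗ₜ c) + (b ⊗ₜ 1) * toFun a c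
  base : ∀ a s, toFun a (e s) = 0

variable {k} {e : ι → A}

lemma DoubleBracket.leibniz_left (β : DoubleBracket k e) (a b c : A) :
    β.toFun (a * b) c = β.toFun a c * (b ⊗ₜ 1) + (1 ⊗ₜ a) * β.toFun b c := by
  rw [β.antisymm, β.leibniz, map_add, map_mul, map_mul, β.antisymm a c, β.antisymm b c]
  simp [add_comm]

/-- `τ (a₁ ⊗ a₂ ⊗ a₃) = a₃ ⊗ a₁ ⊗ a₂`. -/
def tau : (A ⊗[k] A) ⊗[k] A →ₗ[k] (A ⊗[k] A) ⊗[k] A :=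
  (TensorProduct.assoc k A A A).symm.toLinearMap ∘ₗ
    (TensorProduct.comm k (A ⊗[k] A) A).toLinearMap

/-- `x ⊗ y ↦ {{a, x}} ⊗ y`. -/
def DoubleBracket.left (β : DoubleBracket k e) (a : A) : A ⊗[k] A →ₗ[k] (A ⊗[k] A) ⊗[k] A :=
  (β.toFun a).rTensor A

/-- The triple bracket associated with a double bracket. -/
def DoubleBracket.triple (β : DoubleBracket k e) (a b c : A) : (A ⊗[k] A) ⊗[k] A :=
  β.left a (β.toFun b c) + tau (β.left b (β.toFun c a)) + tau (tau (β.left c (β.toFun a b)))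

/-- The quasi-Poisson property of a double bracket. -/
def DoubleBracket.IsQuasiPoisson [Fintype ι] (β : DoubleBracket k e) : Prop :=
  ∀ a b c : A, β.triple a b c = (1 / 4 : k) • ∑ s,
    ((c * e s * a) ⊗ₜ[k] (e s * b) ⊗ₜ[k] e s
      - (c * e s * a) ⊗ₜ[k] e s ⊗ₜ[k] (b * e s)
      - (c * e s) ⊗ₜ[k] (a * e s * b) ⊗ₜ[k] e s
      + (c * e s) ⊗ₜ[k] (a * e s) ⊗ₜ[k] (b * e s)
      - (e s * a) ⊗ₜ[k] (e s * b) ⊗ₜ[k] (e s * c)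
      + (e s * a) ⊗ₜ[k] e s ⊗ₜ[k] (b * e s * c)
      + e s ⊗ₜ[k] (a * e s * b) ⊗ₜ[k] (e s * c)
      - e s ⊗ₜ[k] (a * e s) ⊗ₜ[k] (b * e s * c))

/-- `Φ ∈ e_s A e_s` satisfies the multiplicative property for `e_s`. -/
def DoubleBracket.IsMultiplicativeAt (β : DoubleBracket k e) (s : ι) (Φ : A) : Prop :=
  e s * Φ * e s = Φ ∧ ∀ a, β.toFun Φ a = (1 / 2 : k) •
    ((a * e s) ⊗ₜ[k] Φ - e s ⊗ₜ[k] (Φ * a) + (a * Φ) ⊗ₜ[k] e s - Φ ⊗ₜ[k] (e s * a))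

/-- `Φ = ∑ Φ_s` is a multiplicative moment map. -/
def DoubleBracket.IsMomentMap [Fintype ι] (β : DoubleBracket k e) (Φ : A) : Prop :=
  IsUnit Φ ∧ ∃ φ : ι → A, Φ = ∑ s, φ s ∧ ∀ s, β.IsMultiplicativeAt s (φ s)

/-- The sum of two double brackets. -/
def DoubleBracket.add (β γ : DoubleBracket k e) : DoubleBracket k e where
  toFun := β.toFun + γ.toFun
  antisymm a b := by
    simp only [LinearMap.add_apply, map_add, neg_add]
    rw [β.antisymm a b, γ.antisymm a b]
  leibniz a b c := by
    simp only [LinearMap.add_apply, β.leibniz, γ.leibniz, add_mul, mul_add]; abel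
  base a s := by simp [β.base, γ.base]

end Bracket

/-! ### The extended algebra `Ā` -/

section Ext

variable (k : Type u) [Field k] {A : Type w} [Ring A] [Algebra k A]

/-- Relations for adjoining to `A` two generators `e₁₂` (the letter `inr true`) and `e₂₁` (the
letter `inr false`) which, together with `p = e₁` and `q = e₂`, form a system of `2 × 2` matrix
units. -/
inductive ExtRel (p q : A) : FreeAlgebra k (A ⊕ Bool) → FreeAlgebra k (A ⊕ Bool) → Prop
  | add (a b : A) : ExtRel p q (FreeAlgebra.ι k (Sum.inl (a + b)))
      (FreeAlgebra.ι k (Sum.inl a) + FreeAlgebra.ι k (Sum.inl b))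
  | mul (a b : A) : ExtRel p q (FreeAlgebra.ι k (Sum.inl (a * b)))
      (FreeAlgebra.ι k (Sum.inl a) * FreeAlgebra.ι k (Sum.inl b))
  | scalar (r : k) : ExtRel p q (FreeAlgebra.ι k (Sum.inl (algebraMap k A r)))
      (algebraMap k _ r)
  | e12_e21 : ExtRel p q (FreeAlgebra.ι k (Sum.inr true) * FreeAlgebra.ι k (Sum.inr false))
      (FreeAlgebra.ι k (Sum.inl p))
  | e21_e12 : ExtRel p q (FreeAlgebra.ι k (Sum.inr false) * FreeAlgebra.ι k (Sum.inr true))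
      (FreeAlgebra.ι k (Sum.inl q))
  | e1_e12 : ExtRel p q (FreeAlgebra.ι k (Sum.inl p) * FreeAlgebra.ι k (Sum.inr true))
      (FreeAlgebra.ι k (Sum.inr true))
  | e12_e2 : ExtRel p q (FreeAlgebra.ι k (Sum.inr true) * FreeAlgebra.ι k (Sum.inl q))
      (FreeAlgebra.ι k (Sum.inr true))
  | e2_e21 : ExtRel p q (FreeAlgebra.ι k (Sum.inl q) * FreeAlgebra.ι k (Sum.inr false))
      (FreeAlgebra.ι k (Sum.inr false))
  | e21_e1 : ExtRel p q (FreeAlgebra.ι k (Sum.inr false) * FreeAlgebra.ι k (Sum.inl p))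
      (FreeAlgebra.ι k (Sum.inr false))

/-- The algebra `Ā = A *_{k e₁ ⊕ k e₂ ⊕ k ê} (Mat₂(k) ⊕ k ê)` for `e₁ = p`, `e₂ = q`. -/
def Ext (p q : A) := RingQuot (ExtRel k p q)

instance (p q : A) : Ring (Ext k p q) := inferInstanceAs (Ring (RingQuot (ExtRel k p q)))

instance (p q : A) : Algebra k (Ext k p q) :=
  inferInstanceAs (Algebra k (RingQuot (ExtRel k p q)))

namespace Ext

variable {k} (p q : A)

/-- The quotient map. -/
def mk : FreeAlgebra k (A ⊕ Bool) →ₐ[k] Ext k p q := RingQuot.mkAlgHom k (ExtRel k p q)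

variable {p q} in
lemma mk_rel {x y : FreeAlgebra k (A ⊕ Bool)} (h : ExtRel k p q x y) : mk p q x = mk p q y :=
  RingQuot.mkAlgHom_rel k h

/-- The canonical map `A → Ā`. -/
def inc : A →ₐ[k] Ext k p q :=
  AlgHom.ofLinearMap
    { toFun := fun a => mk p q (FreeAlgebra.ι k (Sum.inl a))
      map_add' := fun a b => by
        rw [← map_add]; exact mk_rel (ExtRel.add a b)
      map_smul' := fun r a => by
        simp only [RingHom.id_apply]
        rw [Algebra.smul_def r a, mk_rel (ExtRel.mul _ a), map_mul,
          mk_rel (ExtRel.scalar r), AlgHom.commutes, Algebra.smul_def] }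
    (by
      have := mk_rel (ExtRel.scalar (k := k) (p := p) (q := q) 1)
      simpa using this)
    (fun a b => by
      have := mk_rel (ExtRel.mul (k := k) (p := p) (q := q) a b)
      simpa using this)

/-- The matrix unit `e₁₂`. -/
def e12 : Ext k p q := mk p q (FreeAlgebra.ι k (Sum.inr true))

/-- The matrix unit `e₂₁`. -/
def e21 : Ext k p q := mk p q (FreeAlgebra.ι k (Sum.inr false))

variable {p q}

lemma e12_mul_e21 : (e12 p q : Ext k p q) * e21 p q = inc p q p := by
  have := mk_rel (ExtRel.e12_e21 (k := k) (p := p) (q := q))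
  rwa [map_mul] at this

lemma e21_mul_e12 : (e21 p q : Ext k p q) * e12 p q = inc p q q := by
  have := mk_rel (ExtRel.e21_e12 (k := k) (p := p) (q := q))
  rwa [map_mul] at this

lemma p_mul_e12 : inc p q p * (e12 p q : Ext k p q) = e12 p q := by
  have := mk_rel (ExtRel.e1_e12 (k := k) (p := p) (q := q))
  rwa [map_mul] at this

lemma e12_mul_q : (e12 p q : Ext k p q) * inc p q q = e12 p q := by
  have := mk_rel (ExtRel.e12_e2 (k := k) (p := p) (q := q))
  rwa [map_mul] at this

lemma q_mul_e21 : inc p q q * (e21 p q : Ext k p q) = e21 p q := by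
  have := mk_rel (ExtRel.e2_e21 (k := k) (p := p) (q := q))
  rwa [map_mul] at this

lemma e21_mul_p : (e21 p q : Ext k p q) * inc p q p = e21 p q := by
  have := mk_rel (ExtRel.e21_e1 (k := k) (p := p) (q := q))
  rwa [map_mul] at this

lemma induction {P : Ext k p q → Prop} (hA : ∀ a, P (inc p q a)) (h12 : P (e12 p q))
    (h21 : P (e21 p q)) (hadd : ∀ x y, P x → P y → P (x + y))
    (hmul : ∀ x y, P x → P y → P (x * y)) (x : Ext k p q) : P x := by
  obtain ⟨y, rfl⟩ : ∃ y, mk p q y = x := RingQuot.mkAlgHom_surjective k (ExtRel k p q) x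
  induction y using FreeAlgebra.induction with
  | grade0 r =>
    rw [AlgHom.commutes, ← AlgHom.commutes (inc p q)]
    exact hA _
  | grade1 x =>
    rcases x with a | b
    · exact hA a
    · cases b
      · exact h21
      · exact h12
  | mul a b ha hb => rw [map_mul]; exact hmul _ _ ha hb
  | add a b ha hb => rw [map_add]; exact hadd _ _ ha hb

lemma exists_lift {S : Type*} [Ring S] [Algebra k S] (f : A →ₗ[k] S) (f1 : f 1 = 1)
    (fm : ∀ a b, f (a * b) = f a * f b) (x y : S)
    (hxy : x * y = f p) (hyx : y * x = f q) (h1 : f p * x = x) (h2 : x * f q = x)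
    (h3 : f q * y = y) (h4 : y * f p = y) :
    ∃ g : Ext k p q →ₐ[k] S, (∀ a, g (inc p q a) = f a) ∧ g (e12 p q) = x ∧ g (e21 p q) = y := by
  let g0 : FreeAlgebra k (A ⊕ Bool) →ₐ[k] S :=
    FreeAlgebra.lift k (Sum.elim f (fun b => if b then x else y))
  have hg : ∀ ⦃a b⦄, ExtRel k p q a b → g0 a = g0 b := by
    intro a b h
    cases h <;> simp [g0, fm, hxy, hyx, h1, h2, h3, h4]
    rw [Algebra.algebraMap_eq_smul_one, map_smul, f1, Algebra.algebraMap_eq_smul_one]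
  refine ⟨RingQuot.liftAlgHom k ⟨g0, hg⟩, fun a => ?_, ?_, ?_⟩
  · change RingQuot.liftAlgHom k ⟨g0, hg⟩ (RingQuot.mkAlgHom k _ _) = _
    rw [RingQuot.liftAlgHom_mkAlgHom_apply]; simp [g0]
  · change RingQuot.liftAlgHom k ⟨g0, hg⟩ (RingQuot.mkAlgHom k _ _) = _
    rw [RingQuot.liftAlgHom_mkAlgHom_apply]; simp [g0]
  · change RingQuot.liftAlgHom k ⟨g0, hg⟩ (RingQuot.mkAlgHom k _ _) = _
    rw [RingQuot.liftAlgHom_mkAlgHom_apply]; simp [g0]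

/-- Outer double derivations on `Ā` are determined by their values on generators. -/
lemma der_ext {D D' : Ext k p q →ₗ[k] Ext k p q ⊗[k] Ext k p q}
    (hD : ∀ x y, D (x * y) = D x * (1 ⊗ₜ y) + (x ⊗ₜ 1) * D y)
    (hD' : ∀ x y, D' (x * y) = D' x * (1 ⊗ₜ y) + (x ⊗ₜ 1) * D' y)
    (hA : ∀ a, D (inc p q a) = D' (inc p q a)) (h12 : D (e12 p q) = D' (e12 p q))
    (h21 : D (e21 p q) = D' (e21 p q)) (x : Ext k p q) : D x = D' x := by
  induction x using Ext.induction with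
  | hA a => exact hA a
  | h12 => exact h12
  | h21 => exact h21
  | hadd x y hx hy => rw [map_add, map_add, hx, hy]
  | hmul x y hx hy => rw [hD, hD', hx, hy]

/-- Extension of a derivation along two algebra maps from `A` to `Ā`. -/
lemma exists_der_aux {T : Type*} [Ring T] [Algebra k T] (L R : Ext k p q →ₐ[k] T)
    (δ : A →ₗ[k] T) (hδ : ∀ a b, δ (a * b) = δ a * R (inc p q b) + L (inc p q a) * δ b)
    (hp : δ p = 0) (hq : δ q = 0) :
    ∃ D : Ext k p q →ₗ[k] T, (∀ x y, D (x * y) = D x * R y + L x * D y) ∧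
      (∀ a, D (inc p q a) = δ a) ∧ D (e12 p q) = 0 ∧ D (e21 p q) = 0 := by
  have hδ1 : δ 1 = 0 := by
    have := hδ 1 1
    simpa using this
  let f : A →ₗ[k] Matrix (Fin 2) (Fin 2) T :=
    { toFun := fun a => !![L (inc p q a), δ a; 0, R (inc p q a)]
      map_add' := fun a b => by simp
      map_smul' := fun r a => by simp }
  have fdef : ∀ a, f a = !![L (inc p q a), δ a; 0, R (inc p q a)] := fun _ => rfl
  obtain ⟨g, gA, g12, g21⟩ := exists_lift (p := p) (q := q) f
    (by simp [fdef, hδ1, Matrix.one_fin_two])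
    (fun a b => by simp [fdef, hδ, add_comm])
    !![L (e12 p q), 0; 0, R (e12 p q)] !![L (e21 p q), 0; 0, R (e21 p q)]
    (by simp [fdef, hp, ← map_mul, e12_mul_e21])
    (by simp [fdef, hq, ← map_mul, e21_mul_e12])
    (by simp [fdef, hp, ← map_mul, p_mul_e12])
    (by simp [fdef, hq, ← map_mul, e12_mul_q])
    (by simp [fdef, hq, ← map_mul, q_mul_e21])
    (by simp [fdef, hp, ← map_mul, e21_mul_p])
  have key : ∀ x, g x 0 0 = L x ∧ g x 1 0 = 0 ∧ g x 1 1 = R x := by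
    intro x
    induction x using Ext.induction with
    | hA a => rw [gA]; simp [fdef]
    | h12 => rw [g12]; simp
    | h21 => rw [g21]; simp
    | hadd x y hx hy => simp [hx, hy]
    | hmul x y hx hy => simp [Matrix.mul_apply, Fin.sum_univ_two, hx, hy]
  refine ⟨(Matrix.entryLinearMap k _ 0 1).comp g.toLinearMap, ?_, ?_, ?_, ?_⟩
  · intro x y
    simp [Matrix.mul_apply, Fin.sum_univ_two, key, add_comm]
  · intro a; simp [gA, fdef]
  · simp [g12]
  · simp [g21]

/-- Extension of a double derivation from `A` to `Ā`, by zero on `e₁₂`, `e₂₁`. -/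
lemma exists_der (δ : A →ₗ[k] Ext k p q ⊗[k] Ext k p q)
    (hδ : ∀ a b, δ (a * b) = δ a * (1 ⊗ₜ inc p q b) + (inc p q a ⊗ₜ 1) * δ b)
    (hp : δ p = 0) (hq : δ q = 0) :
    ∃ D : Ext k p q →ₗ[k] Ext k p q ⊗[k] Ext k p q,
      (∀ x y, D (x * y) = D x * (1 ⊗ₜ y) + (x ⊗ₜ 1) * D y) ∧ (∀ a, D (inc p q a) = δ a) ∧
      D (e12 p q) = 0 ∧ D (e21 p q) = 0 :=
  exists_der_aux (T := Ext k p q ⊗[k] Ext k p q) Algebra.TensorProduct.includeLeft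
    Algebra.TensorProduct.includeRight δ hδ hp hq

/-! Commutation of inner and outer multiplications on a tensor square. -/

lemma inner_outer_left {R : Type*} [Ring R] [Algebra k R] (a x : R) (d : R ⊗[k] R) :
    ((1 : R) ⊗ₜ[k] a) * ((x ⊗ₜ[k] (1 : R)) * d) = (x ⊗ₜ[k] 1) * ((1 ⊗ₜ[k] a) * d) := by
  simp [← mul_assoc]

lemma inner_outer_right {R : Type*} [Ring R] [Algebra k R] (a x : R) (d : R ⊗[k] R) :
    d * ((1 : R) ⊗ₜ[k] x) * (a ⊗ₜ[k] (1 : R)) = d * (a ⊗ₜ[k] 1) * (1 ⊗ₜ[k] x) := by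
  simp [mul_assoc]

variable {ι : Type v} {e : ι → A}

/-- The double bracket on `A` extends to `Ā`, with `e₁₂` and `e₂₁` in its kernel. -/
lemma exists_bracket (β : DoubleBracket k e) (hp : ∀ a, β.toFun a p = 0)
    (hq : ∀ a, β.toFun a q = 0) :
    ∃ Γ : Ext k p q →ₗ[k] Ext k p q →ₗ[k] Ext k p q ⊗[k] Ext k p q,
      (∀ x y, Γ x y = - Algebra.TensorProduct.comm k _ _ (Γ y x)) ∧
      (∀ x y z, Γ x (y * z) = Γ x y * (1 ⊗ₜ z) + (y ⊗ₜ 1) * Γ x z) ∧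
      (∀ a b, Γ (inc p q a) (inc p q b) =
        TensorProduct.map (inc p q).toLinearMap (inc p q).toLinearMap (β.toFun a b)) ∧
      (∀ x, Γ x (e12 p q) = 0) ∧ (∀ x, Γ x (e21 p q) = 0) := by
  let J : A ⊗[k] A →ₐ[k] Ext k p q ⊗[k] Ext k p q :=
    Algebra.TensorProduct.map (inc p q) (inc p q)
  have hJ : ∀ a b, J (a ⊗ₜ b) = inc p q a ⊗ₜ inc p q b := fun a b => by simp [J]
  have hJc : ∀ d, J (Algebra.TensorProduct.comm k A A d) =
      Algebra.TensorProduct.comm k _ _ (J d) := by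
    intro d
    induction d using TensorProduct.induction_on with
    | zero => simp
    | tmul a b => simp [hJ]
    | add x y hx hy => simp [hx, hy]
  have h1 : ∀ a : A, ∃ D : Ext k p q →ₗ[k] Ext k p q ⊗[k] Ext k p q,
      (∀ x y, D (x * y) = D x * (1 ⊗ₜ y) + (x ⊗ₜ 1) * D y) ∧
      (∀ b, D (inc p q b) = J (β.toFun a b)) ∧ D (e12 p q) = 0 ∧ D (e21 p q) = 0 := by
    intro a
    exact exists_der (J.toLinearMap ∘ₗ β.toFun a)
      (fun b c => by simp [β.leibniz, hJ]) (by simp [hp]) (by simp [hq])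
  choose D0 hD hDA hD12 hD21 using h1
  have hDadd : ∀ a b y, D0 (a + b) y = D0 a y + D0 b y := by
    intro a b y
    refine der_ext (D := D0 (a + b)) (D' := D0 a + D0 b) (hD _) (fun x y => ?_) (fun c => ?_) ?_ ?_ y
    · simp only [LinearMap.add_apply, hD, add_mul, mul_add]; abel
    · simp [hDA]
    · simp [hD12]
    · simp [hD21]
  have hDsmul : ∀ (r : k) a y, D0 (r • a) y = r • D0 a y := by
    intro r a y
    refine der_ext (D := D0 (r • a)) (D' := r • D0 a) (hD _) (fun x y => ?_) (fun c => ?_) ?_ ?_ y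
    · simp [hD]
    · simp [hDA]
    · simp [hD12]
    · simp [hD21]
  have hDmul : ∀ a b y, D0 (a * b) y =
      D0 a y * (inc p q b ⊗ₜ 1) + (1 ⊗ₜ inc p q a) * D0 b y := by
    intro a b y
    refine der_ext (D := D0 (a * b)) (D' := LinearMap.mulRight k (inc p q b ⊗ₜ 1) ∘ₗ D0 a +
      LinearMap.mulLeft k (1 ⊗ₜ inc p q a) ∘ₗ D0 b) (hD _) (fun x y => ?_) (fun c => ?_) ?_ ?_ y
    · simp only [LinearMap.add_apply, LinearMap.comp_apply, LinearMap.mulRight_apply,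
        LinearMap.mulLeft_apply, hD, add_mul, mul_add, inner_outer_left, inner_outer_right]
      simp only [mul_assoc]; abel
    · simp [hDA, β.leibniz_left, hJ]
    · simp [hD12]
    · simp [hD21]
  have h2 : ∀ y : Ext k p q, ∃ G : Ext k p q →ₗ[k] Ext k p q ⊗[k] Ext k p q,
      (∀ x z, G (x * z) = G x * (1 ⊗ₜ z) + (x ⊗ₜ 1) * G z) ∧
      (∀ a, G (inc p q a) = - Algebra.TensorProduct.comm k _ _ (D0 a y)) ∧
      G (e12 p q) = 0 ∧ G (e21 p q) = 0 := by
    intro y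
    let δ : A →ₗ[k] Ext k p q ⊗[k] Ext k p q :=
      { toFun := fun a => - Algebra.TensorProduct.comm k _ _ (D0 a y)
        map_add' := fun a b => by simp only [hDadd, map_add, neg_add]
        map_smul' := fun r a => by simp only [hDsmul, map_smul, RingHom.id_apply, smul_neg] }
    have hz : ∀ c : A, (∀ a, β.toFun a c = 0) → δ c = 0 := by
      intro c hc
      have : D0 c y = 0 := by
        refine der_ext (D := D0 c) (D' := 0) (hD _) (by simp) (fun b => ?_) ?_ ?_ y
        · rw [hDA, β.antisymm, hc]; simp
        · simp [hD12]
        · simp [hD21]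
      simp [δ, this]
    exact exists_der δ (fun a b => by
      simp only [δ, LinearMap.coe_mk, AddHom.coe_mk, hDmul, map_add, map_mul,
        Algebra.TensorProduct.comm_tmul, neg_add, neg_mul, mul_neg]) (hz p hp) (hz q hq)
  choose G0 hG hGA hG12 hG21 using h2
  have hGadd : ∀ x y z, G0 (x + y) z = G0 x z + G0 y z := by
    intro x y z
    refine der_ext (D := G0 (x + y)) (D' := G0 x + G0 y) (hG _) (fun x y => ?_) (fun c => ?_) ?_ ?_ z
    · simp only [LinearMap.add_apply, hG, add_mul, mul_add]; abel
    · simp [hGA, add_comm]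
    · simp [hG12]
    · simp [hG21]
  have hGsmul : ∀ (r : k) x z, G0 (r • x) z = r • G0 x z := by
    intro r x z
    refine der_ext (D := G0 (r • x)) (D' := r • G0 x) (hG _) (fun x y => ?_) (fun c => ?_) ?_ ?_ z
    · simp [hG]
    · simp [hGA]
    · simp [hG12]
    · simp [hG21]
  have hGmul : ∀ x y z, G0 (x * y) z = G0 x z * (y ⊗ₜ 1) + (1 ⊗ₜ x) * G0 y z := by
    intro x y z
    refine der_ext (D := G0 (x * y)) (D' := LinearMap.mulRight k (y ⊗ₜ 1) ∘ₗ G0 x +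
      LinearMap.mulLeft k (1 ⊗ₜ x) ∘ₗ G0 y) (hG _) (fun x y => ?_) (fun c => ?_) ?_ ?_ z
    · simp only [LinearMap.add_apply, LinearMap.comp_apply, LinearMap.mulRight_apply,
        LinearMap.mulLeft_apply, hG, add_mul, mul_add, inner_outer_left, inner_outer_right]
      simp only [mul_assoc]; abel
    · simp [hGA, hD, add_comm]
    · simp [hG12]
    · simp [hG21]
  have hGinc : ∀ a x, G0 (inc p q a) x = D0 a x := by
    intro a x
    refine der_ext (hG _) (hD _) (fun b => ?_) ?_ ?_ x
    · rw [hGA, hDA, hDA, ← hJc, ← map_neg, ← β.antisymm]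
    · rw [hG12, hD12]
    · rw [hG21, hD21]
  have hGzero : ∀ c : Ext k p q, (∀ a, D0 a c = 0) → ∀ x, G0 c x = 0 := by
    intro c hc x
    refine der_ext (D := G0 c) (D' := 0) (hG _) (by simp) (fun b => ?_) ?_ ?_ x
    · simp [hGA, hc]
    · simp [hG12]
    · simp [hG21]
  refine ⟨LinearMap.mk₂ k (fun x y => G0 x y) hGadd hGsmul (fun x y z => map_add _ _ _)
    (fun r x y => map_smul _ _ _), ?_, ?_, ?_, ?_, ?_⟩
  · intro x y
    simp only [LinearMap.mk₂_apply]
    induction y using Ext.induction with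
    | hA a => rw [hGA, hGinc]
    | h12 => rw [hG12, hGzero _ hD12]; simp
    | h21 => rw [hG21, hGzero _ hD21]; simp
    | hadd y z hy hz => rw [map_add, hGadd, hy, hz, map_add, neg_add]
    | hmul y z hy hz => rw [hG, hGmul, hy, hz]; simp [add_comm]
  · intro x y z; simp only [LinearMap.mk₂_apply]; exact hG x y z
  · intro a b
    simp only [LinearMap.mk₂_apply]; rw [hGinc, hDA]; rfl
  · intro x; exact hG12 x
  · intro x; exact hG21 x

end Ext

end Ext

/-! ### The fusion algebra -/

section Fus

variable (k : Type u) [Field k] {A : Type w} [Ring A] [Algebra k A]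

namespace Ext

variable {k} (p q : A)

/-- The element `ε = 1 - e₂` of `Ā`. -/
def eps : Ext k p q := 1 - inc p q q

variable {p q}

lemma q_mul_q : (inc p q q : Ext k p q) * inc p q q = inc p q q := by
  conv_lhs => rw [← e21_mul_e12, mul_assoc, e21_mul_e12, e12_mul_q]
  exact e21_mul_e12

lemma eps_isIdempotentElem : IsIdempotentElem (eps p q : Ext k p q) := by
  simp [IsIdempotentElem, eps, mul_sub, sub_mul, q_mul_q]

end Ext

/-- The fusion algebra `A^f = ε Ā ε` obtained by fusing `e₂ = q` onto `e₁ = p`; its unit is `ε`. -/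
def Fus (p q : A) := (Ext.eps_isIdempotentElem (k := k) (p := p) (q := q)).Corner

namespace Fus

instance (p q : A) : Ring (Fus k p q) :=
  inferInstanceAs (Ring (Ext.eps_isIdempotentElem (k := k) (p := p) (q := q)).Corner)

variable {k} {p q : A}

/-- The inclusion `A^f → Ā`. -/
def val (x : Fus k p q) : Ext k p q := Subtype.val x

lemma val_injective : Function.Injective (val : Fus k p q → Ext k p q) := Subtype.val_injective

lemma val_mul (x y : Fus k p q) : (x * y).val = x.val * y.val := rfl

lemma val_add (x y : Fus k p q) : (x + y).val = x.val + y.val := rfl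

lemma val_one : (1 : Fus k p q).val = Ext.eps p q := rfl

lemma val_zero : (0 : Fus k p q).val = 0 := rfl

lemma eps_mul_val (x : Fus k p q) : Ext.eps p q * x.val = x.val :=
  ((Subsemigroup.mem_corner_iff Ext.eps_isIdempotentElem).mp x.2).1

lemma val_mul_eps (x : Fus k p q) : x.val * Ext.eps p q = x.val :=
  ((Subsemigroup.mem_corner_iff Ext.eps_isIdempotentElem).mp x.2).2

instance : SMul k (Fus k p q) where
  smul r x := ⟨r • x.val, by
    refine (Subsemigroup.mem_corner_iff Ext.eps_isIdempotentElem).mpr ⟨?_, ?_⟩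
    · rw [mul_smul_comm, eps_mul_val]
    · rw [smul_mul_assoc, val_mul_eps]⟩

lemma val_smul (r : k) (x : Fus k p q) : (r • x).val = r • x.val := rfl

instance : Module k (Fus k p q) :=
  Function.Injective.module k
    ({ toFun := val, map_zero' := val_zero, map_add' := val_add } : Fus k p q →+ Ext k p q)
    val_injective val_smul

instance : Algebra k (Fus k p q) :=
  Algebra.ofModule
    (fun r x y => val_injective (by simp only [val_mul, val_smul, smul_mul_assoc]))
    (fun r x y => val_injective (by simp only [val_mul, val_smul, mul_smul_comm]))

/-- The compression `Ā → A^f`, `z ↦ ε z ε`. -/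
def compress : Ext k p q →ₗ[k] Fus k p q where
  toFun z := ⟨Ext.eps p q * z * Ext.eps p q, z, rfl⟩
  map_add' x y := val_injective (by
    change Ext.eps p q * (x + y) * Ext.eps p q = _ * x * _ + _ * y * _
    rw [mul_add, add_mul])
  map_smul' r x := val_injective (by
    change Ext.eps p q * (r • x) * Ext.eps p q = r • (_ * x * _)
    simp)

lemma val_compress (z : Ext k p q) : (compress z).val = Ext.eps p q * z * Ext.eps p q := rfl

lemma compress_val (x : Fus k p q) : compress x.val = x :=
  val_injective (by rw [val_compress, eps_mul_val, val_mul_eps])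

lemma compress_mul_val (z : Ext k p q) (x : Fus k p q) :
    compress (z * x.val) = compress z * x := by
  apply val_injective
  rw [val_mul, val_compress, val_compress, ← mul_assoc, mul_assoc _ _ (Ext.eps p q), val_mul_eps,
    mul_assoc _ (Ext.eps p q), eps_mul_val]

lemma compress_val_mul (z : Ext k p q) (x : Fus k p q) :
    compress (x.val * z) = x * compress z := by
  apply val_injective
  rw [val_mul, val_compress, val_compress, ← mul_assoc, eps_mul_val, ← mul_assoc, ← mul_assoc,
    val_mul_eps]

variable (p q) in
/-- The map `a ↦ a^f = ε a ε + e₁₂ a e₂₁ + e₁₂ a ε + ε a e₂₁` from `A` to `A^f`. (The right-hand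
side lies in `ε Ā ε` whenever `e₁` and `e₂` are orthogonal.) -/
def proj : A →ₗ[k] Fus k p q where
  toFun a := compress (Ext.eps p q * Ext.inc p q a * Ext.eps p q
    + Ext.e12 p q * Ext.inc p q a * Ext.e21 p q
    + Ext.e12 p q * Ext.inc p q a * Ext.eps p q
    + Ext.eps p q * Ext.inc p q a * Ext.e21 p q)
  map_add' a b := by rw [← map_add]; congr 1; simp only [map_add, mul_add, add_mul]; abel
  map_smul' r a := by rw [RingHom.id_apply, ← map_smul]; congr 1; simp

/-- The defining property of the double bracket induced by `β` on `A^f`. Since `β` is `B`-linear,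
for generators `a^f = e_a a f_a` and `b^f = e_b b f_b` with `e_a, e_b ∈ {ε, e₁₂}`,
`f_a, f_b ∈ {ε, e₂₁}` the right-hand side is `e_b {{a,b}}' f_a ⊗ e_a {{a,b}}'' f_b`. -/
def IsInduced {ι ι' : Type*} {e : ι → A} {e' : ι' → Fus k p q} (β : DoubleBracket k e)
    (γ : DoubleBracket k e') : Prop :=
  ∀ a b, γ.toFun (proj p q a) (proj p q b) = TensorProduct.map (proj p q) (proj p q) (β.toFun a b)

/-- The defining property of the fusion double bracket on `A^f`. Here `t`, `u`, `v`, `w` stand for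
elements of `ε A ε`, `e₂ A ε`, `ε A e₂`, `e₂ A e₂`, with associated generators `t^f = t`,
`u^f = e₁₂ u`, `v^f = v e₂₁`, `w^f = e₁₂ w e₂₁` of `A^f`. -/
structure IsFusionBracket {ι' : Type*} {e' : ι' → Fus k p q} (γ : DoubleBracket k e') : Prop where
  tt : ∀ t t' : A, (1 - q) * t * (1 - q) = t → (1 - q) * t' * (1 - q) = t' →
    γ.toFun (proj p q t) (proj p q t') = 0
  tu : ∀ t u : A, (1 - q) * t * (1 - q) = t → q * u * (1 - q) = u →
    γ.toFun (proj p q t) (proj p q u) = (1 / 2 : k) •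
      (proj p q p ⊗ₜ (proj p q t * proj p q u) - (proj p q p * proj p q t) ⊗ₜ proj p q u)
  tv : ∀ t v : A, (1 - q) * t * (1 - q) = t → (1 - q) * v * q = v →
    γ.toFun (proj p q t) (proj p q v) = (1 / 2 : k) •
      ((proj p q v * proj p q t) ⊗ₜ proj p q p - proj p q v ⊗ₜ (proj p q t * proj p q p))
  tw : ∀ t w : A, (1 - q) * t * (1 - q) = t → q * w * q = w →
    γ.toFun (proj p q t) (proj p q w) = (1 / 2 : k) •
      ((proj p q w * proj p q t) ⊗ₜ proj p q p + proj p q p ⊗ₜ (proj p q t * proj p q w)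
        - proj p q w ⊗ₜ (proj p q t * proj p q p) - (proj p q p * proj p q t) ⊗ₜ proj p q w)
  ut : ∀ u t : A, q * u * (1 - q) = u → (1 - q) * t * (1 - q) = t →
    γ.toFun (proj p q u) (proj p q t) = (1 / 2 : k) •
      (proj p q u ⊗ₜ (proj p q p * proj p q t) - (proj p q t * proj p q u) ⊗ₜ proj p q p)
  uu : ∀ u u' : A, q * u * (1 - q) = u → q * u' * (1 - q) = u' →
    γ.toFun (proj p q u) (proj p q u') = (1 / 2 : k) •
      (proj p q p ⊗ₜ (proj p q u * proj p q u') - (proj p q u' * proj p q u) ⊗ₜ proj p q p)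
  uv : ∀ u v : A, q * u * (1 - q) = u → (1 - q) * v * q = v →
    γ.toFun (proj p q u) (proj p q v) = (1 / 2 : k) •
      (proj p q u ⊗ₜ (proj p q p * proj p q v) - proj p q v ⊗ₜ (proj p q u * proj p q p))
  uw : ∀ u w : A, q * u * (1 - q) = u → q * w * q = w →
    γ.toFun (proj p q u) (proj p q w) = (1 / 2 : k) •
      (proj p q p ⊗ₜ (proj p q u * proj p q w) - proj p q w ⊗ₜ (proj p q u * proj p q p))
  vt : ∀ v t : A, (1 - q) * v * q = v → (1 - q) * t * (1 - q) = t →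
    γ.toFun (proj p q v) (proj p q t) = (1 / 2 : k) •
      ((proj p q t * proj p q p) ⊗ₜ proj p q v - proj p q p ⊗ₜ (proj p q v * proj p q t))
  vu : ∀ v u : A, (1 - q) * v * q = v → q * u * (1 - q) = u →
    γ.toFun (proj p q v) (proj p q u) = (1 / 2 : k) •
      ((proj p q u * proj p q p) ⊗ₜ proj p q v - (proj p q p * proj p q v) ⊗ₜ proj p q u)
  vv : ∀ v v' : A, (1 - q) * v * q = v → (1 - q) * v' * q = v' →
    γ.toFun (proj p q v) (proj p q v') = (1 / 2 : k) •
      ((proj p q v' * proj p q v) ⊗ₜ proj p q p - proj p q p ⊗ₜ (proj p q v * proj p q v'))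
  vw : ∀ v w : A, (1 - q) * v * q = v → q * w * q = w →
    γ.toFun (proj p q v) (proj p q w) = (1 / 2 : k) •
      ((proj p q w * proj p q v) ⊗ₜ proj p q p - (proj p q p * proj p q v) ⊗ₜ proj p q w)
  wt : ∀ w t : A, q * w * q = w → (1 - q) * t * (1 - q) = t →
    γ.toFun (proj p q w) (proj p q t) = (1 / 2 : k) •
      ((proj p q t * proj p q p) ⊗ₜ proj p q w + proj p q w ⊗ₜ (proj p q p * proj p q t)
        - (proj p q t * proj p q w) ⊗ₜ proj p q p - proj p q p ⊗ₜ (proj p q w * proj p q t))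
  wu : ∀ w u : A, q * w * q = w → q * u * (1 - q) = u →
    γ.toFun (proj p q w) (proj p q u) = (1 / 2 : k) •
      ((proj p q u * proj p q p) ⊗ₜ proj p q w - (proj p q u * proj p q w) ⊗ₜ proj p q p)
  wv : ∀ w v : A, q * w * q = w → (1 - q) * v * q = v →
    γ.toFun (proj p q w) (proj p q v) = (1 / 2 : k) •
      (proj p q w ⊗ₜ (proj p q p * proj p q v) - proj p q p ⊗ₜ (proj p q w * proj p q v))
  ww : ∀ w w' : A, q * w * q = w → q * w' * q = w' →
    γ.toFun (proj p q w) (proj p q w') = 0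

/-! Existence and uniqueness of the two double brackets above. -/

lemma eps_mul_e12 (hqp : q * p = 0) :
    (Ext.eps p q : Ext k p q) * Ext.e12 p q = Ext.e12 p q := by
  rw [Ext.eps, sub_mul, one_mul, ← Ext.p_mul_e12, ← mul_assoc, ← map_mul, hqp]; simp

lemma e21_mul_eps (hpq : p * q = 0) :
    (Ext.e21 p q : Ext k p q) * Ext.eps p q = Ext.e21 p q := by
  rw [Ext.eps, mul_sub, mul_one, ← Ext.e21_mul_p, mul_assoc, ← map_mul, hpq]; simp

lemma e12_mul_eps : (Ext.e12 p q : Ext k p q) * Ext.eps p q = 0 := by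
  rw [Ext.eps, mul_sub, mul_one, Ext.e12_mul_q, sub_self]

lemma eps_mul_e21 : (Ext.eps p q : Ext k p q) * Ext.e21 p q = 0 := by
  rw [Ext.eps, sub_mul, one_mul, Ext.q_mul_e21, sub_self]

lemma e12_mul_e12 (hqp : q * p = 0) : (Ext.e12 p q : Ext k p q) * Ext.e12 p q = 0 := by
  rw [← eps_mul_e12 hqp, ← mul_assoc, mul_assoc _ (Ext.e12 p q) (Ext.eps p q), e12_mul_eps]; simp

lemma e21_mul_e21 (hpq : p * q = 0) : (Ext.e21 p q : Ext k p q) * Ext.e21 p q = 0 := by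
  rw [← e21_mul_eps hpq, mul_assoc, ← mul_assoc (Ext.eps p q), eps_mul_e21]; simp

lemma q_mul_eps : (Ext.inc p q q : Ext k p q) * Ext.eps p q = 0 := by
  rw [Ext.eps, mul_sub, mul_one, Ext.q_mul_q, sub_self]

lemma eps_mul_q : (Ext.eps p q : Ext k p q) * Ext.inc p q q = 0 := by
  rw [Ext.eps, sub_mul, one_mul, Ext.q_mul_q, sub_self]

lemma inc_one_sub_q : (Ext.inc p q (1 - q) : Ext k p q) = Ext.eps p q := by
  rw [map_sub, map_one, Ext.eps]

lemma proj_eq (a : A) : (proj p q a : Fus k p q) =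
    compress ((Ext.eps p q + Ext.e12 p q) * Ext.inc p q a * (Ext.eps p q + Ext.e21 p q)) := by
  change compress _ = compress _
  congr 1
  simp only [add_mul, mul_add]; abel

lemma val_proj (hpq : p * q = 0) (hqp : q * p = 0) (a : A) : (proj p q a : Fus k p q).val =
    (Ext.eps p q + Ext.e12 p q) * Ext.inc p q a * (Ext.eps p q + Ext.e21 p q) := by
  rw [proj_eq, val_compress, ← mul_assoc, ← mul_assoc, mul_assoc _ _ (Ext.eps p q)]
  congr 1
  · rw [mul_add, eps_mul_e12 hqp, Ext.eps_isIdempotentElem.eq]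
  · rw [add_mul, e21_mul_eps hpq, Ext.eps_isIdempotentElem.eq]

lemma val_proj_tt (hpq : p * q = 0) (hqp : q * p = 0) (a : A) :
    (proj p q ((1 - q) * a * (1 - q)) : Fus k p q).val =
      Ext.eps p q * Ext.inc p q a * Ext.eps p q := by
  rw [val_proj hpq hqp, map_mul, map_mul, inc_one_sub_q, ← mul_assoc, ← mul_assoc, add_mul,
    e12_mul_eps, Ext.eps_isIdempotentElem.eq, add_zero, mul_assoc _ (Ext.eps p q) (_ + _), mul_add,
    eps_mul_e21, Ext.eps_isIdempotentElem.eq, add_zero]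

lemma val_proj_ut (hpq : p * q = 0) (hqp : q * p = 0) (a : A) :
    (proj p q (q * a * (1 - q)) : Fus k p q).val =
      Ext.e12 p q * Ext.inc p q a * Ext.eps p q := by
  rw [val_proj hpq hqp, map_mul, map_mul, inc_one_sub_q, ← mul_assoc, ← mul_assoc, add_mul,
    Ext.e12_mul_q, eps_mul_q, zero_add, mul_assoc _ (Ext.eps p q) (_ + _), mul_add,
    eps_mul_e21, Ext.eps_isIdempotentElem.eq, add_zero]

lemma val_proj_tv (hpq : p * q = 0) (hqp : q * p = 0) (a : A) :
    (proj p q ((1 - q) * a * q) : Fus k p q).val =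
      Ext.eps p q * Ext.inc p q a * Ext.e21 p q := by
  rw [val_proj hpq hqp, map_mul, map_mul, inc_one_sub_q, ← mul_assoc, ← mul_assoc, add_mul,
    e12_mul_eps, Ext.eps_isIdempotentElem.eq, add_zero, mul_assoc _ _ (_ + _), mul_add,
    q_mul_eps, Ext.q_mul_e21, zero_add]

lemma val_proj_ww (hpq : p * q = 0) (hqp : q * p = 0) (a : A) :
    (proj p q (q * a * q) : Fus k p q).val =
      Ext.e12 p q * Ext.inc p q a * Ext.e21 p q := by
  rw [val_proj hpq hqp, map_mul, map_mul, ← mul_assoc, ← mul_assoc, add_mul,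
    Ext.e12_mul_q, eps_mul_q, zero_add, mul_assoc _ _ (_ + _), mul_add,
    q_mul_eps, Ext.q_mul_e21, zero_add]

lemma compress_mul (x y : Ext k p q) (hqp : q * p = 0) : compress (x * y) =
    compress x * compress y + compress (x * Ext.e21 p q) * compress (Ext.e12 p q * y) := by
  apply val_injective
  have h1 : Ext.eps p q * (x * y) * Ext.eps p q = Ext.eps p q * x * Ext.eps p q * y * Ext.eps p q +
      Ext.eps p q * x * (Ext.e21 p q * Ext.e12 p q) * y * Ext.eps p q := by
    rw [Ext.e21_mul_e12, ← add_mul, ← add_mul, ← mul_add, Ext.eps, sub_add_cancel]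
    simp only [mul_assoc, one_mul]
  rw [val_add, val_mul, val_mul, val_compress, val_compress, val_compress, val_compress,
    val_compress, h1]
  congr 1
  · simp only [mul_assoc]
    rw [← mul_assoc (Ext.eps p q) (Ext.eps p q) (y * _), Ext.eps_isIdempotentElem.eq]
  · simp only [mul_assoc]
    rw [← mul_assoc (Ext.eps p q) (Ext.e12 p q) (y * _), eps_mul_e12 hqp,
      ← mul_assoc (Ext.eps p q) (Ext.e12 p q) (y * _), eps_mul_e12 hqp]

/-- The elements `a^f` generate `A^f`. -/
lemma induction (hpq : p * q = 0) (hqp : q * p = 0) {P : Fus k p q → Prop}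
    (hA : ∀ a, P (proj p q a)) (hadd : ∀ x y, P x → P y → P (x + y))
    (hmul : ∀ x y, P x → P y → P (x * y)) (x : Fus k p q) : P x := by
  have h0 : P 0 := by simpa using hA 0
  have hinc : ∀ a : A, P (compress (Ext.inc p q a)) ∧ P (compress (Ext.e12 p q * Ext.inc p q a)) ∧
      P (compress (Ext.inc p q a * Ext.e21 p q)) ∧
      P (compress (Ext.e12 p q * Ext.inc p q a * Ext.e21 p q)) := by
    intro a
    refine ⟨?_, ?_, ?_, ?_⟩
    · convert hA ((1 - q) * a * (1 - q))
      apply val_injective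
      rw [val_proj_tt hpq hqp, val_compress]
    · convert hA (q * a * (1 - q))
      apply val_injective
      rw [val_proj_ut hpq hqp, val_compress, ← mul_assoc, eps_mul_e12 hqp]
    · convert hA ((1 - q) * a * q)
      apply val_injective
      rw [val_proj_tv hpq hqp, val_compress, ← mul_assoc, mul_assoc, e21_mul_eps hpq]
    · convert hA (q * a * q)
      apply val_injective
      rw [val_proj_ww hpq hqp, val_compress, ← mul_assoc, ← mul_assoc, mul_assoc, e21_mul_eps hpq,
        eps_mul_e12 hqp]
  have key : ∀ z : Ext k p q, P (compress z) ∧ P (compress (Ext.e12 p q * z)) ∧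
      P (compress (z * Ext.e21 p q)) ∧ P (compress (Ext.e12 p q * z * Ext.e21 p q)) := by
    intro z
    induction z using Ext.induction with
    | hA a => exact hinc a
    | h12 =>
      refine ⟨?_, ?_, ?_, ?_⟩
      · convert h0
        apply val_injective
        rw [val_compress, mul_assoc, e12_mul_eps, mul_zero, val_zero]
      · rw [e12_mul_e12 hqp, map_zero]; exact h0
      · rw [Ext.e12_mul_e21]; exact (hinc p).1
      · rw [e12_mul_e12 hqp, zero_mul, map_zero]; exact h0
    | h21 =>
      refine ⟨?_, ?_, ?_, ?_⟩
      · convert h0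
        apply val_injective
        rw [val_compress, eps_mul_e21, zero_mul, val_zero]
      · rw [Ext.e12_mul_e21]; exact (hinc p).1
      · rw [e21_mul_e21 hpq, map_zero]; exact h0
      · rw [mul_assoc, e21_mul_e21 hpq, mul_zero, map_zero]; exact h0
    | hadd y z hy hz =>
      simp only [mul_add, add_mul, map_add]
      exact ⟨hadd _ _ hy.1 hz.1, hadd _ _ hy.2.1 hz.2.1, hadd _ _ hy.2.2.1 hz.2.2.1,
        hadd _ _ hy.2.2.2 hz.2.2.2⟩
    | hmul y z hy hz =>
      refine ⟨?_, ?_, ?_, ?_⟩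
      · rw [compress_mul y z hqp]
        exact hadd _ _ (hmul _ _ hy.1 hz.1) (hmul _ _ hy.2.2.1 hz.2.1)
      · rw [← mul_assoc, compress_mul _ z hqp]
        exact hadd _ _ (hmul _ _ hy.2.1 hz.1) (hmul _ _ hy.2.2.2 hz.2.1)
      · rw [mul_assoc, compress_mul y _ hqp, ← mul_assoc (Ext.e12 p q)]
        exact hadd _ _ (hmul _ _ hy.1 hz.2.2.1) (hmul _ _ hy.2.2.1 hz.2.2.2)
      · rw [← mul_assoc, mul_assoc _ z, compress_mul _ _ hqp, ← mul_assoc (Ext.e12 p q) z]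
        exact hadd _ _ (hmul _ _ hy.2.1 hz.2.2.1) (hmul _ _ hy.2.2.2 hz.2.2.2)
  have := (key x.val).1
  rwa [compress_val] at this

variable {ι ι' : Type*} {e : ι → A} {e' : ι' → Fus k p q}

lemma bracket_ext (hpq : p * q = 0) (hqp : q * p = 0) (γ γ' : DoubleBracket k e')
    (h : ∀ a b, γ.toFun (proj p q a) (proj p q b) = γ'.toFun (proj p q a) (proj p q b)) :
    γ = γ' := by
  have h1 : ∀ y a, γ.toFun (proj p q a) y = γ'.toFun (proj p q a) y := by
    intro y
    induction y using Fus.induction hpq hqp with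
    | hA b => exact fun a => h a b
    | hadd x y hx hy => intro a; rw [map_add, map_add, hx, hy]
    | hmul x y hx hy => intro a; rw [γ.leibniz, γ'.leibniz, hx, hy]
  have h2 : ∀ x y, γ.toFun x y = γ'.toFun x y := by
    intro x
    induction x using Fus.induction hpq hqp with
    | hA a => exact fun y => h1 y a
    | hadd x y hx hy => intro z; rw [map_add, map_add, LinearMap.add_apply, hx, hy]; rfl
    | hmul x y hx hy => intro z; rw [γ.leibniz_left, γ'.leibniz_left, hx, hy]
  cases γ; cases γ'
  congr 1
  exact LinearMap.ext₂ h2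

/-- `compress ⊗ compress`. -/
def compress₂ : Ext k p q ⊗[k] Ext k p q →ₗ[k] Fus k p q ⊗[k] Fus k p q :=
  TensorProduct.map compress compress

lemma compress₂_mul (d : Ext k p q ⊗[k] Ext k p q) (x : Fus k p q) :
    compress₂ (d * (1 ⊗ₜ x.val)) = compress₂ d * (1 ⊗ₜ x) := by
  induction d using TensorProduct.induction_on with
  | zero => simp
  | tmul a b => simp [compress₂, compress_mul_val]
  | add a b ha hb => simp only [add_mul, map_add, ha, hb]

lemma mul_compress₂ (d : Ext k p q ⊗[k] Ext k p q) (x : Fus k p q) :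
    compress₂ ((x.val ⊗ₜ 1) * d) = (x ⊗ₜ 1) * compress₂ d := by
  induction d using TensorProduct.induction_on with
  | zero => simp
  | tmul a b => simp [compress₂, compress_val_mul]
  | add a b ha hb => simp only [mul_add, map_add, ha, hb]

lemma comm_compress₂ (d : Ext k p q ⊗[k] Ext k p q) :
    Algebra.TensorProduct.comm k _ _ (compress₂ d) =
      compress₂ (Algebra.TensorProduct.comm k _ _ d) := by
  induction d using TensorProduct.induction_on with
  | zero => simp
  | tmul a b => simp [compress₂]
  | add a b ha hb => simp only [map_add, ha, hb]

/-- `B̄`-linearity of derivations. -/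
lemma der_conj {D : Ext k p q →ₗ[k] Ext k p q ⊗[k] Ext k p q}
    (hD : ∀ x y, D (x * y) = D x * (1 ⊗ₜ y) + (x ⊗ₜ 1) * D y)
    (hq : D (Ext.inc p q q) = 0) (h12 : D (Ext.e12 p q) = 0) (h21 : D (Ext.e21 p q) = 0)
    (x : Ext k p q) :
    D ((Ext.eps p q + Ext.e12 p q) * x * (Ext.eps p q + Ext.e21 p q)) =
      ((Ext.eps p q + Ext.e12 p q) ⊗ₜ 1) * D x * (1 ⊗ₜ (Ext.eps p q + Ext.e21 p q)) := by
  have h1 : D 1 = 0 := by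
    have := hD 1 1
    simpa [← Algebra.TensorProduct.one_def] using this
  have heps : D (Ext.eps p q) = 0 := by rw [Ext.eps, map_sub, h1, hq, sub_zero]
  rw [hD, hD, map_add D, map_add D, heps, h12, h21]
  simp

lemma exists_induced (hpq : p * q = 0) (hqp : q * p = 0) (β : DoubleBracket k e)
    (hp : ∀ a, β.toFun a p = 0) (hq : ∀ a, β.toFun a q = 0)
    (he : ∀ s, ∃ t, e' s = proj p q (e t)) : ∃ γ : DoubleBracket k e', IsInduced β γ := by
  obtain ⟨Γ, hanti, hleib, hA, h12, h21⟩ := Ext.exists_bracket β hp hq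
  have hq' : ∀ x, Γ x (Ext.inc p q q) = 0 := by
    intro x
    rw [← Ext.e21_mul_e12, hleib, h12, h21]; simp
  have main : ∀ a b, compress₂ (Γ (proj p q a : Fus k p q).val (proj p q b : Fus k p q).val) =
      TensorProduct.map (proj p q) (proj p q) (β.toFun a b) := by
    intro a b
    rw [val_proj hpq hqp, val_proj hpq hqp, der_conj (hleib _) (hq' _) (h12 _) (h21 _), hanti,
      der_conj (hleib _) (hq' _) (h12 _) (h21 _), hA, β.antisymm a b]
    generalize β.toFun b a = d
    induction d using TensorProduct.induction_on with
    | zero => simp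
    | tmul a b =>
      simp [compress₂, proj_eq, mul_assoc]
    | add x y hx hy =>
      simp only [map_add, mul_add, add_mul, neg_add, mul_neg, neg_mul, map_neg] at hx hy ⊢
      rw [hx, hy]
  refine ⟨⟨LinearMap.mk₂ k (fun x y => compress₂ (Γ x.val y.val)) ?_ ?_ ?_ ?_, ?_, ?_, ?_⟩, ?_⟩
  · intro x y z; simp [val_add]
  · intro r x y; simp [val_smul]
  · intro x y z; simp [val_add]
  · intro r x y; simp [val_smul]
  · intro x y
    simp only [LinearMap.mk₂_apply]
    rw [comm_compress₂, ← map_neg, ← hanti]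
  · intro x y z
    simp only [LinearMap.mk₂_apply]
    rw [val_mul, hleib, map_add, compress₂_mul, mul_compress₂]
  · intro x s
    obtain ⟨t, ht⟩ := he s
    simp only [LinearMap.mk₂_apply]
    rw [ht]
    induction x using Fus.induction hpq hqp with
    | hA a => rw [main, β.base, map_zero]
    | hadd x y hx hy => rw [val_add, map_add, LinearMap.add_apply, map_add, hx, hy, add_zero]
    | hmul x y hx hy =>
      rw [hanti, map_neg, neg_eq_zero, ← comm_compress₂, EmbeddingLike.map_eq_zero_iff] at hx hy ⊢
      rw [val_mul, hleib, map_add, compress₂_mul, mul_compress₂, hx, hy]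
      simp
  · intro a b
    exact main a b

/-- The double derivation `a^f ↦ (a e₁)^f ⊗ e₁ - e₁ ⊗ (e₁ a)^f` of `A^f`. -/
lemma exists_euler (hpq : p * q = 0) (hqp : q * p = 0) (hpp : p * p = p) :
    ∃ H : Fus k p q →ₗ[k] Fus k p q ⊗[k] Fus k p q,
      (∀ x y, H (x * y) = H x * (1 ⊗ₜ y) + (x ⊗ₜ 1) * H y) ∧
      ∀ a, H (proj p q a) = proj p q (a * p) ⊗ₜ proj p q p - proj p q p ⊗ₜ proj p q (p * a) := by
  let δ : A →ₗ[k] Ext k p q ⊗[k] Ext k p q :=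
    { toFun := fun a => Ext.inc p q (a * p) ⊗ₜ Ext.inc p q p - Ext.inc p q p ⊗ₜ Ext.inc p q (p * a)
      map_add' := fun a b => by
        simp only [add_mul, mul_add, map_add, TensorProduct.add_tmul, TensorProduct.tmul_add]; abel
      map_smul' := fun r a => by
        simp [smul_sub, TensorProduct.smul_tmul'] }
  have δdef : ∀ a, δ a =
    Ext.inc p q (a * p) ⊗ₜ Ext.inc p q p - Ext.inc p q p ⊗ₜ Ext.inc p q (p * a) := fun _ => rfl
  obtain ⟨D, hD, hDA, h12, h21⟩ := Ext.exists_der δ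
    (fun a b => by simp [δdef, sub_mul, mul_sub, mul_assoc])
    (by simp [δdef, hpp]) (by simp [δdef, hpq, hqp])
  have hq' : D (Ext.inc p q q) = 0 := by rw [hDA, δdef, hpq, hqp]; simp
  have hP : (proj p q p : Fus k p q) = compress (Ext.inc p q p) := by
    have h1 : (1 - q) * p * (1 - q) = p := by simp [sub_mul, mul_sub, hpq, hqp]
    have h2 := val_proj_tt (k := k) hpq hqp p
    rw [h1] at h2
    exact val_injective h2
  have hup : (Ext.eps p q + Ext.e12 p q) * Ext.inc p q p = (Ext.inc p q p : Ext k p q) := by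
    rw [add_mul, Ext.eps, sub_mul, ← map_mul, hqp, ← Ext.e12_mul_q, mul_assoc, ← map_mul, hqp]
    simp
  have hpv : Ext.inc p q p * (Ext.eps p q + Ext.e21 p q) = (Ext.inc p q p : Ext k p q) := by
    rw [mul_add, Ext.eps, mul_sub, ← map_mul, hpq, ← Ext.q_mul_e21, ← mul_assoc, ← map_mul, hpq]
    simp
  refine ⟨{ toFun := fun x => compress₂ (D x.val), map_add' := ?_, map_smul' := ?_ }, ?_, ?_⟩
  · intro x y; simp [val_add]
  · intro r x; simp [val_smul]
  · intro x y
    simp only [LinearMap.coe_mk, AddHom.coe_mk]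
    rw [val_mul, hD, map_add, compress₂_mul, mul_compress₂]
  · intro a
    simp only [LinearMap.coe_mk, AddHom.coe_mk]
    rw [val_proj hpq hqp, der_conj hD hq' h12 h21, hDA, δdef, mul_sub, sub_mul, map_sub, hP,
      proj_eq (a * p), proj_eq (p * a), map_mul (Ext.inc p q), map_mul (Ext.inc p q)]
    simp only [compress₂, Algebra.TensorProduct.tmul_mul_tmul, TensorProduct.map_tmul, one_mul,
      mul_one, hup, hpv, mul_assoc]
    simp only [← mul_assoc, hup]

lemma exists_decomp (q a : A) (hqq : q * q = q) : ∃ t u v w : A, (1 - q) * t * (1 - q) = t ∧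
    q * u * (1 - q) = u ∧ (1 - q) * v * q = v ∧ q * w * q = w ∧ a = t + u + v + w := by
  have h : (1 - q) * (1 - q) = 1 - q := by simp [mul_sub, sub_mul, hqq]
  refine ⟨(1 - q) * a * (1 - q), q * a * (1 - q), (1 - q) * a * q, q * a * q, ?_, ?_, ?_, ?_, ?_⟩
  · rw [mul_assoc, mul_assoc _ (1 - q) (1 - q), h, ← mul_assoc, ← mul_assoc, h]
  · rw [mul_assoc, mul_assoc _ (1 - q) (1 - q), h, ← mul_assoc, ← mul_assoc, hqq]
  · rw [mul_assoc, mul_assoc _ q q, hqq, ← mul_assoc, ← mul_assoc, h]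
  · rw [mul_assoc, mul_assoc _ q q, hqq, ← mul_assoc, ← mul_assoc, hqq]
  · noncomm_ring

lemma val_proj_p (hpq : p * q = 0) (hqp : q * p = 0) :
    (proj p q p : Fus k p q).val = Ext.inc p q p := by
  have h1 : (1 - q) * p * (1 - q) = p := by simp [sub_mul, mul_sub, hpq, hqp]
  have h2 := val_proj_tt (k := k) hpq hqp p
  rw [h1] at h2
  rw [h2, ← inc_one_sub_q, ← map_mul, ← map_mul, h1]

lemma proj_mul_p (hpq : p * q = 0) (hqp : q * p = 0) {a : A} (ha : a * (1 - q) = a) :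
    (proj p q (a * p) : Fus k p q) = proj p q a * proj p q p := by
  apply val_injective
  rw [val_mul, val_proj_p hpq hqp, val_proj hpq hqp, val_proj hpq hqp, ← ha]
  simp only [map_mul, inc_one_sub_q, mul_assoc]
  congr 2
  have h1 : Ext.eps p q * Ext.inc p q p = (Ext.inc p q p : Ext k p q) := by
    rw [← inc_one_sub_q, ← map_mul, sub_mul, one_mul, hqp, sub_zero]
  have h2 : Ext.inc p q p * Ext.eps p q = (Ext.inc p q p : Ext k p q) := by
    rw [← inc_one_sub_q, ← map_mul, mul_sub, mul_one, hpq, sub_zero]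
  have h3 : Ext.inc p q p * Ext.e21 p q = (0 : Ext k p q) := by
    rw [← Ext.q_mul_e21, ← mul_assoc, ← map_mul, hpq, map_zero, zero_mul]
  rw [← mul_assoc (Ext.eps p q) (_ + _), mul_add (Ext.eps p q), Ext.eps_isIdempotentElem.eq,
    eps_mul_e21, add_zero, mul_add, h2, h3, add_zero]

lemma p_mul_proj (hpq : p * q = 0) (hqp : q * p = 0) {a : A} (ha : (1 - q) * a = a) :
    (proj p q (p * a) : Fus k p q) = proj p q p * proj p q a := by
  apply val_injective
  rw [val_mul, val_proj_p hpq hqp, val_proj hpq hqp, val_proj hpq hqp, ← ha]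
  simp only [map_mul, inc_one_sub_q, ← mul_assoc]
  congr 2
  have h1 : Ext.eps p q * Ext.inc p q p = (Ext.inc p q p : Ext k p q) := by
    rw [← inc_one_sub_q, ← map_mul, sub_mul, one_mul, hqp, sub_zero]
  have h3 : Ext.e12 p q * Ext.inc p q p = (0 : Ext k p q) := by
    rw [← Ext.e12_mul_q, mul_assoc, ← map_mul, hqp, map_zero, mul_zero]
  rw [mul_assoc (Ext.inc p q p), add_mul _ _ (Ext.eps p q), Ext.eps_isIdempotentElem.eq,
    e12_mul_eps, add_zero, add_mul, h1, h3, add_zero]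

lemma proj_mul_p' (hpq : p * q = 0) (hqp : q * p = 0) {a : A} (ha : a * q = a) :
    (proj p q a : Fus k p q) * proj p q p = proj p q a := by
  apply val_injective
  rw [val_mul, val_proj_p hpq hqp, val_proj hpq hqp, ← ha]
  simp only [map_mul, mul_assoc]
  congr 2
  rw [← mul_assoc, mul_add, q_mul_eps, Ext.q_mul_e21, zero_add, Ext.e21_mul_p]

lemma p_mul_proj' (hpq : p * q = 0) (hqp : q * p = 0) {a : A} (ha : q * a = a) :
    (proj p q p : Fus k p q) * proj p q a = proj p q a := by
  apply val_injective
  rw [val_mul, val_proj_p hpq hqp, val_proj hpq hqp, ← ha]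
  simp only [map_mul, ← mul_assoc]
  congr 2
  rw [mul_assoc, add_mul, eps_mul_q, Ext.e12_mul_q, zero_add, Ext.p_mul_e12]

set_option linter.unusedSimpArgs false in
lemma exists_fusionBracket (hpq : p * q = 0) (hqp : q * p = 0) (hpp : p * p = p) (hqq : q * q = q)
    (he : ∀ s, ∃ c : A, e' s = proj p q c ∧ c * q = 0 ∧ q * c = 0 ∧
      (c = p ∨ (c * p = 0 ∧ p * c = 0))) :
    ∃ γ : DoubleBracket k e', IsFusionBracket γ := by
  obtain ⟨H0, hH0, hH0A⟩ := exists_euler (k := k) hpq hqp hpp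
  set E : Fus k p q := proj p q p with hE
  have hEE : E * E = E := by
    rw [hE, ← proj_mul_p hpq hqp (by rw [mul_sub, mul_one, hpq, sub_zero]), hpp]
  -- the compressed derivation
  let H : Fus k p q →ₗ[k] Fus k p q ⊗[k] Fus k p q :=
    LinearMap.mulRight k (E ⊗ₜ 1) ∘ₗ LinearMap.mulLeft k (1 ⊗ₜ E) ∘ₗ H0
  have Hdef : ∀ x, H x = (1 ⊗ₜ E) * H0 x * (E ⊗ₜ 1) := fun _ => rfl
  have hH : ∀ x y, H (x * y) = H x * (1 ⊗ₜ y) + (x ⊗ₜ 1) * H y := by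
    intro x y
    rw [Hdef, Hdef, Hdef, hH0, mul_add, add_mul, Ext.inner_outer_left, ← mul_assoc (1 ⊗ₜ E),
      Ext.inner_outer_right]
    simp only [mul_assoc]
  have hHA : ∀ a, H (proj p q a) = (proj p q (a * p) * E) ⊗ₜ E - E ⊗ₜ (E * proj p q (p * a)) := by
    intro a
    rw [Hdef, hH0A, mul_sub, sub_mul]
    simp [hEE]
  let J := Algebra.TensorProduct.comm k (Fus k p q) (Fus k p q)
  have hJ : ∀ x y, J (x ⊗ₜ y) = y ⊗ₜ x := fun x y => by simp [J]
  have hJJ : ∀ d, J (J d) = d := by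
    intro d
    induction d using TensorProduct.induction_on with
    | zero => simp
    | tmul a b => simp [hJ]
    | add x y hx hy => simp [hx, hy]
  let F : Fus k p q →ₗ[k] Fus k p q →ₗ[k] Fus k p q ⊗[k] Fus k p q :=
    LinearMap.mk₂ k (fun x y => (1 / 2 : k) • ((1 ⊗ₜ x) * H y - H y * (x ⊗ₜ 1)
        + J (H x) * (1 ⊗ₜ y) - (y ⊗ₜ 1) * J (H x)))
      (fun x y z => by
        rw [← smul_add]; congr 1
        simp only [map_add, TensorProduct.add_tmul, TensorProduct.tmul_add, mul_add, add_mul]; abel)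
      (fun r x z => by
        rw [smul_comm]; congr 1
        simp only [map_smul, TensorProduct.tmul_smul, ← TensorProduct.smul_tmul', smul_mul_assoc,
          mul_smul_comm, smul_add, smul_sub])
      (fun x y z => by
        rw [← smul_add]; congr 1
        simp only [map_add, TensorProduct.add_tmul, TensorProduct.tmul_add, mul_add, add_mul]; abel)
      (fun r x z => by
        rw [smul_comm]; congr 1
        simp only [map_smul, TensorProduct.tmul_smul, ← TensorProduct.smul_tmul', smul_mul_assoc,
          mul_smul_comm, smul_add, smul_sub])
  have Fdef : ∀ x y, F x y = (1 / 2 : k) • ((1 ⊗ₜ x) * H y - H y * (x ⊗ₜ 1)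
        + J (H x) * (1 ⊗ₜ y) - (y ⊗ₜ 1) * J (H x)) := fun _ _ => rfl
  have hFA : ∀ a b, F (proj p q a) (proj p q b) = (1 / 2 : k) •
      ((proj p q (b * p) * E) ⊗ₜ (proj p q a * E) - E ⊗ₜ (proj p q a * (E * proj p q (p * b)))
        - (proj p q (b * p) * E * proj p q a) ⊗ₜ E + (E * proj p q a) ⊗ₜ (E * proj p q (p * b))
        + E ⊗ₜ (proj p q (a * p) * E * proj p q b) - (E * proj p q (p * a)) ⊗ₜ (E * proj p q b)
        - (proj p q b * E) ⊗ₜ (proj p q (a * p) * E)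
        + (proj p q b * (E * proj p q (p * a))) ⊗ₜ E) := by
    intro a b
    rw [Fdef, hHA, hHA, map_sub, hJ, hJ]
    congr 1
    simp only [mul_sub, sub_mul, Algebra.TensorProduct.tmul_mul_tmul, one_mul, mul_one]
    abel
  have hbase : ∀ x s, F x (e' s) = 0 := by
    intro x s
    obtain ⟨c, hc, hcq, hqc, h⟩ := he s
    have hc1 : c * (1 - q) = c := by rw [mul_sub, mul_one, hcq, sub_zero]
    have hc2 : (1 - q) * c = c := by rw [sub_mul, one_mul, hqc, sub_zero]
    have hcE : e' s * E = proj p q (c * p) := by rw [hc, hE, proj_mul_p hpq hqp hc1]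
    have hEc : E * e' s = proj p q (p * c) := by rw [hc, hE, p_mul_proj hpq hqp hc2]
    have hJH : J (H x) = (E ⊗ₜ 1) * J (H0 x) * (1 ⊗ₜ E) := by
      rw [Hdef, map_mul, map_mul, hJ, hJ]
    have hH1 : H (e' s) = 0 := by
      rw [hc, hHA]
      rcases h with rfl | ⟨h1, h2⟩
      · rw [hpp]; simp [← hE, hEE]
      · simp [h1, h2]
    have h2 : J (H x) * (1 ⊗ₜ e' s) - (e' s ⊗ₜ 1) * J (H x) = 0 := by
      rw [hJH, mul_assoc, ← mul_assoc (e' s ⊗ₜ 1), ← mul_assoc (e' s ⊗ₜ 1)]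
      simp only [Algebra.TensorProduct.tmul_mul_tmul, one_mul, mul_one]
      rw [hcE, hEc]
      rcases h with rfl | ⟨h1, h2⟩
      · rw [hpp, sub_self]
      · simp [h1, h2]
    rw [Fdef, hH1, add_sub_assoc, h2]
    simp
  refine ⟨⟨F, ?_, ?_, hbase⟩, ?_⟩
  · intro x y
    change F x y = - J (F y x)
    rw [Fdef, Fdef, map_smul, ← smul_neg]
    congr 1
    simp only [map_sub, map_add, map_mul, hJ, hJJ]
    abel
  · intro x y z
    rw [Fdef, Fdef, Fdef, smul_mul_assoc, mul_smul_comm, ← smul_add]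
    congr 1
    have e1 : ((y * z) ⊗ₜ[k] (1 : Fus k p q)) = (y ⊗ₜ 1) * (z ⊗ₜ 1) := by simp
    have e2 : ((1 : Fus k p q) ⊗ₜ[k] (y * z)) = (1 ⊗ₜ y) * (1 ⊗ₜ z) := by simp
    rw [hH, e1, e2]
    simp only [mul_add, add_mul, mul_sub, sub_mul, Ext.inner_outer_left, Ext.inner_outer_right]
    simp only [mul_assoc]
    abel
  -- evaluation on generators, using the position of the arguments relative to `ε` and `e₂`
  have hεε : (1 - q) * (1 - q) = 1 - q := by simp [mul_sub, sub_mul, hqq]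
  have l1 : ∀ {a b : A}, (1 - q) * a * b = a → (1 - q) * a = a := by
    intro a b h
    conv_lhs => rw [← h]
    rw [← mul_assoc, ← mul_assoc, hεε, h]
  have l2 : ∀ {a b : A}, q * a * b = a → q * a = a := by
    intro a b h
    conv_lhs => rw [← h]
    rw [← mul_assoc, ← mul_assoc, hqq, h]
  have r1 : ∀ {a b : A}, b * a * (1 - q) = a → a * (1 - q) = a := by
    intro a b h
    conv_lhs => rw [← h]
    rw [mul_assoc, hεε, h]
  have r2 : ∀ {a b : A}, b * a * q = a → a * q = a := by
    intro a b h
    conv_lhs => rw [← h]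
    rw [mul_assoc, hqq, h]
  have L1 : ∀ {a b : A}, (1 - q) * a * b = a → proj p q (p * a) = E * proj p q a :=
    fun h => p_mul_proj hpq hqp (l1 h)
  have L2 : ∀ {a b : A}, q * a * b = a → (proj p q (p * a) : Fus k p q) = 0 := by
    intro a b h
    rw [← l2 h, ← mul_assoc, hpq, zero_mul, map_zero]
  have L2' : ∀ {a b : A}, q * a * b = a → E * proj p q a = proj p q a :=
    fun h => p_mul_proj' hpq hqp (l2 h)
  have R1 : ∀ {a b : A}, b * a * (1 - q) = a → proj p q (a * p) = proj p q a * E :=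
    fun h => proj_mul_p hpq hqp (r1 h)
  have R2 : ∀ {a b : A}, b * a * q = a → (proj p q (a * p) : Fus k p q) = 0 := by
    intro a b h
    rw [← r2 h, mul_assoc, hqp, mul_zero, map_zero]
  have R2' : ∀ {a b : A}, b * a * q = a → proj p q a * E = proj p q a :=
    fun h => proj_mul_p' hpq hqp (r2 h)
  have R2'' : ∀ {a b : A}, b * a * q = a → ∀ z, proj p q a * (E * z) = proj p q a * z :=
    fun h z => by rw [← mul_assoc, R2' h]
  have hEE' : ∀ z, E * (E * z) = E * z := fun z => by rw [← mul_assoc, hEE]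
  constructor
  · intro a b ha hb
    rw [hFA, L1 ha, R1 ha, L1 hb, R1 hb]
    convert smul_zero (1 / 2 : k)
    simp only [mul_assoc, hEE, hEE']
    abel
  · intro a b ha hb
    rw [hFA, L1 ha, R1 ha, L2 hb, R1 hb]
    congr 1
    simp only [mul_assoc, hEE, hEE', L2' hb, zero_mul, mul_zero, TensorProduct.tmul_zero,
      TensorProduct.zero_tmul]
    abel
  · intro a b ha hb
    rw [hFA, L1 ha, R1 ha, L1 hb, R2 hb]
    congr 1
    simp only [mul_assoc, hEE, hEE', R2' hb, R2'' hb, zero_mul, mul_zero, TensorProduct.tmul_zero,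
      TensorProduct.zero_tmul]
    abel
  · intro a b ha hb
    rw [hFA, L1 ha, R1 ha, L2 hb, R2 hb]
    congr 1
    simp only [mul_assoc, hEE, hEE', L2' hb, R2' hb, R2'' hb, zero_mul, mul_zero, TensorProduct.tmul_zero,
      TensorProduct.zero_tmul]
    abel
  · intro a b ha hb
    rw [hFA, L2 ha, R1 ha, L1 hb, R1 hb]
    congr 1
    simp only [mul_assoc, hEE, hEE', L2' ha, zero_mul, mul_zero, TensorProduct.tmul_zero,
      TensorProduct.zero_tmul]
    abel
  · intro a b ha hb
    rw [hFA, L2 ha, R1 ha, L2 hb, R1 hb]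
    congr 1
    simp only [mul_assoc, hEE, hEE', L2' ha, L2' hb, zero_mul, mul_zero, TensorProduct.tmul_zero,
      TensorProduct.zero_tmul]
    abel
  · intro a b ha hb
    rw [hFA, L2 ha, R1 ha, L1 hb, R2 hb]
    congr 1
    simp only [mul_assoc, hEE, hEE', L2' ha, R2' hb, R2'' hb, zero_mul, mul_zero, TensorProduct.tmul_zero,
      TensorProduct.zero_tmul]
    abel
  · intro a b ha hb
    rw [hFA, L2 ha, R1 ha, L2 hb, R2 hb]
    congr 1
    simp only [mul_assoc, hEE, hEE', L2' ha, L2' hb, R2' hb, R2'' hb, zero_mul, mul_zero, TensorProduct.tmul_zero,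
      TensorProduct.zero_tmul]
    abel
  · intro a b ha hb
    rw [hFA, L1 ha, R2 ha, L1 hb, R1 hb]
    congr 1
    simp only [mul_assoc, hEE, hEE', R2' ha, R2'' ha, zero_mul, mul_zero, TensorProduct.tmul_zero,
      TensorProduct.zero_tmul]
    abel
  · intro a b ha hb
    rw [hFA, L1 ha, R2 ha, L2 hb, R1 hb]
    congr 1
    simp only [mul_assoc, hEE, hEE', R2' ha, R2'' ha, L2' hb, zero_mul, mul_zero, TensorProduct.tmul_zero,
      TensorProduct.zero_tmul]
    abel
  · intro a b ha hb
    rw [hFA, L1 ha, R2 ha, L1 hb, R2 hb]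
    congr 1
    simp only [mul_assoc, hEE, hEE', R2' ha, R2'' ha, R2' hb, R2'' hb, zero_mul, mul_zero, TensorProduct.tmul_zero,
      TensorProduct.zero_tmul]
    abel
  · intro a b ha hb
    rw [hFA, L1 ha, R2 ha, L2 hb, R2 hb]
    congr 1
    simp only [mul_assoc, hEE, hEE', R2' ha, R2'' ha, L2' hb, R2' hb, R2'' hb, zero_mul, mul_zero, TensorProduct.tmul_zero,
      TensorProduct.zero_tmul]
    abel
  · intro a b ha hb
    rw [hFA, L2 ha, R2 ha, L1 hb, R1 hb]
    congr 1
    simp only [mul_assoc, hEE, hEE', L2' ha, R2' ha, R2'' ha, zero_mul, mul_zero, TensorProduct.tmul_zero,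
      TensorProduct.zero_tmul]
    abel
  · intro a b ha hb
    rw [hFA, L2 ha, R2 ha, L2 hb, R1 hb]
    congr 1
    simp only [mul_assoc, hEE, hEE', L2' ha, R2' ha, R2'' ha, L2' hb, zero_mul, mul_zero, TensorProduct.tmul_zero,
      TensorProduct.zero_tmul]
    abel
  · intro a b ha hb
    rw [hFA, L2 ha, R2 ha, L1 hb, R2 hb]
    congr 1
    simp only [mul_assoc, hEE, hEE', L2' ha, R2' ha, R2'' ha, R2' hb, R2'' hb, zero_mul, mul_zero, TensorProduct.tmul_zero,
      TensorProduct.zero_tmul]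
    abel
  · intro a b ha hb
    rw [hFA, L2 ha, R2 ha, L2 hb, R2 hb]
    convert smul_zero (1 / 2 : k)
    simp only [mul_assoc, hEE, hEE', L2' ha, R2' ha, R2'' ha, L2' hb, R2' hb, R2'' hb, zero_mul, mul_zero, TensorProduct.tmul_zero,
      TensorProduct.zero_tmul]
    abel

lemma existsUnique_induced (hpq : p * q = 0) (hqp : q * p = 0) (β : DoubleBracket k e)
    (hp : ∀ a, β.toFun a p = 0) (hq : ∀ a, β.toFun a q = 0)
    (he : ∀ s, ∃ t, e' s = proj p q (e t)) : ∃! γ : DoubleBracket k e', IsInduced β γ := by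
  obtain ⟨γ, hγ⟩ := exists_induced (e' := e') hpq hqp β hp hq he
  exact ⟨γ, hγ, fun γ' h => bracket_ext hpq hqp _ _ fun a b => (h a b).trans (hγ a b).symm⟩

lemma existsUnique_fusionBracket (hpq : p * q = 0) (hqp : q * p = 0) (hpp : p * p = p)
    (hqq : q * q = q) (he : ∀ s, ∃ c : A, e' s = proj p q c ∧ c * q = 0 ∧ q * c = 0 ∧
      (c = p ∨ (c * p = 0 ∧ p * c = 0))) :
    ∃! γ : DoubleBracket k e', IsFusionBracket γ := by
  obtain ⟨γ, h⟩ := exists_fusionBracket (k := k) (e' := e') hpq hqp hpp hqq he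
  refine ⟨γ, h, fun γ' h' => bracket_ext hpq hqp _ _ fun a b => ?_⟩
  obtain ⟨t, u, v, w, ht, hu, hv, hw, rfl⟩ := exists_decomp q a hqq
  obtain ⟨t', u', v', w', ht', hu', hv', hw', rfl⟩ := exists_decomp q b hqq
  simp only [map_add, LinearMap.add_apply,
    h.tt _ _ ht ht', h.tu _ _ ht hu', h.tv _ _ ht hv', h.tw _ _ ht hw',
    h.ut _ _ hu ht', h.uu _ _ hu hu', h.uv _ _ hu hv', h.uw _ _ hu hw',
    h.vt _ _ hv ht', h.vu _ _ hv hu', h.vv _ _ hv hv', h.vw _ _ hv hw',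
    h.wt _ _ hw ht', h.wu _ _ hw hu', h.wv _ _ hw hv', h.ww _ _ hw hw',
    h'.tt _ _ ht ht', h'.tu _ _ ht hu', h'.tv _ _ ht hv', h'.tw _ _ ht hw',
    h'.ut _ _ hu ht', h'.uu _ _ hu hu', h'.uv _ _ hu hv', h'.uw _ _ hu hw',
    h'.vt _ _ hv ht', h'.vu _ _ hv hu', h'.vv _ _ hv hv', h'.vw _ _ hv hw',
    h'.wt _ _ hw ht', h'.wu _ _ hw hu', h'.wv _ _ hw hv', h'.ww _ _ hw hw']

end Fus

/-! ### Fusion of double brackets -/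

variable {k} {ι : Type v} [Fintype ι] [DecidableEq ι] (e : ι → A)

/-- The idempotents `e_s`, `s ≠ j`, in the fusion algebra obtained by fusing `e_j` onto `e_i`. -/
def fusIdem (i j : ι) : {s : ι // s ≠ j} → Fus k (e i) (e j) :=
  fun s => Fus.proj (e i) (e j) (e s)

variable {e}

lemma fusIdem_complete (he : CompleteOrthogonalIdempotents e) (i j : ι) (hij : i ≠ j) :
    CompleteOrthogonalIdempotents (fusIdem (k := k) e i j) := by
  have hpq := he.ortho hij
  have hqp := he.ortho hij.symm
  have hval : ∀ s : {s : ι // s ≠ j},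
      (fusIdem (k := k) e i j s).val = Ext.inc (e i) (e j) (e s) := by
    intro s
    have h1 : (1 - e j) * e s * (1 - e j) = e s := by
      simp [sub_mul, mul_sub, he.ortho s.2, he.ortho s.2.symm]
    have h2 := Fus.val_proj_tt (k := k) hpq hqp (e s)
    rw [h1] at h2
    rw [fusIdem, h2, ← Fus.inc_one_sub_q, ← map_mul, ← map_mul, h1]
  refine ⟨⟨fun s => ?_, fun s t hst => ?_⟩, ?_⟩
  · apply Fus.val_injective
    rw [Fus.val_mul, hval, ← map_mul, (he.idem s).eq]
  · apply Fus.val_injective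
    rw [Fus.val_mul, hval, hval, ← map_mul, he.ortho (fun h => hst (Subtype.ext h)), map_zero,
      Fus.val_zero]
  · apply Fus.val_injective
    have hsum : (∑ s, fusIdem (k := k) e i j s).val = ∑ s, (fusIdem (k := k) e i j s).val :=
      map_sum ({ toFun := Fus.val, map_zero' := Fus.val_zero, map_add' := Fus.val_add } :
        Fus k (e i) (e j) →+ Ext k (e i) (e j)) _ _
    rw [hsum, Fus.val_one, ← Fus.inc_one_sub_q, ← he.complete,
      ← Finset.sum_erase_eq_sub (Finset.mem_univ j), map_sum]
    simp only [hval]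
    rw [Finset.sum_subtype (p := fun s => s ≠ j) (Finset.univ.erase j) (by simp)
      (fun s => Ext.inc (k := k) (e i) (e j) (e s))]

/-- The double bracket on `A^f` induced by a double bracket on `A`. -/
def inducedBracket (he : CompleteOrthogonalIdempotents e) (β : DoubleBracket k e) (i j : ι) (hij : i ≠ j) :
    DoubleBracket k (fusIdem (k := k) e i j) :=
  (Fus.existsUnique_induced (e' := fusIdem (k := k) e i j) (he.ortho hij) (he.ortho hij.symm) β
    (fun a => β.base a i) (fun a => β.base a j) (fun s => ⟨s, rfl⟩)).choose

/-- The fusion double bracket on `A^f`. -/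
def fusionBracket (he : CompleteOrthogonalIdempotents e) (i j : ι) (hij : i ≠ j) :
    DoubleBracket k (fusIdem (k := k) e i j) :=
  (Fus.existsUnique_fusionBracket (e' := fusIdem (k := k) e i j) (he.ortho hij)
    (he.ortho hij.symm) (he.idem i) (he.idem j) (fun s => ⟨e s, rfl, he.ortho s.2,
      he.ortho s.2.symm, (eq_or_ne (s : ι) i).imp (fun h => by rw [h])
        (fun h => ⟨he.ortho h, he.ortho h.symm⟩)⟩)).choose

end Fus

/-! ### Algebras with double brackets, and chains of fusions -/

set_option linter.checkUnivs false in
/-- An algebra over `B = ⊕_{s ∈ ι} k e_s` with a `B`-linear double bracket. -/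
structure BracketAlg (k : Type u) [Field k] where
  /-- The index set of the idempotents. -/
  ι : Type v
  [fintype : Fintype ι]
  [decidableEq : DecidableEq ι]
  /-- The underlying algebra. -/
  carrier : Type (max u w)
  [ring : Ring carrier]
  [algebra : Algebra k carrier]
  /-- The idempotents. -/
  e : ι → carrier
  complete : CompleteOrthogonalIdempotents e
  bracket : DoubleBracket k e

attribute [instance] BracketAlg.fintype BracketAlg.decidableEq BracketAlg.ring BracketAlg.algebra

namespace BracketAlg

variable {k : Type u} [Field k]

/-- The algebra obtained from `A` by fusing `e_j` onto `e_i`, over `⊕_{s ≠ j} k e_s`, with the sum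
of the induced and of the fusion double brackets. -/
def fuse (A : BracketAlg.{u, v, w} k) (i j : A.ι) (hij : i ≠ j) : BracketAlg.{u, v, w} k where
  ι := {s : A.ι // s ≠ j}
  carrier := Fus k (A.e i) (A.e j)
  e := fusIdem (k := k) A.e i j
  complete := fusIdem_complete A.complete i j hij
  bracket := (inducedBracket A.complete A.bracket i j hij).add (fusionBracket A.complete i j hij)

/-- The map `Φ = ∑ Φ_s ↦ Φ_i^f Φ_j^f + ∑_{s ≠ i, j} Φ_s^f`, where `Φ_s = e_s Φ e_s`. -/
def fuseMoment (A : BracketAlg.{u, v, w} k) (i j : A.ι) (hij : i ≠ j) (Φ : A.carrier) :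
    (A.fuse i j hij).carrier :=
  (Fus.proj (A.e i) (A.e j) (A.e i * Φ * A.e i) * Fus.proj (A.e i) (A.e j) (A.e j * Φ * A.e j)
    + ∑ s with s ≠ i ∧ s ≠ j, Fus.proj (A.e i) (A.e j) (A.e s * Φ * A.e s) :
      Fus k (A.e i) (A.e j))

end BracketAlg

/-- A finite chain of fusions starting from `A`; `cons i j _ F` first fuses `e_j` onto `e_i` and
then performs the chain `F`. -/
inductive FusionChain {k : Type u} [Field k] :
    BracketAlg.{u, v, w} k → Type (max (u + 1) (v + 1) (w + 1))
  | nil (A : BracketAlg.{u, v, w} k) : FusionChain A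
  | cons {A : BracketAlg.{u, v, w} k} (i j : A.ι) (hij : i ≠ j)
      (F : FusionChain (A.fuse i j hij)) : FusionChain A

namespace FusionChain

variable {k : Type u} [Field k]

/-- The fusion algebra at the end of a chain, with its double bracket. -/
def target : {A : BracketAlg.{u, v, w} k} → FusionChain A → BracketAlg.{u, v, w} k
  | _, nil A => A
  | _, cons _ _ _ F => F.target

/-- The index of the idempotent of the fusion algebra with which `e_s` ends up being identified. -/
def index : {A : BracketAlg.{u, v, w} k} → (F : FusionChain A) → A.ι → F.target.ι
  | _, nil _, s => s
  | _, cons i j hij F, s => F.index (if h : s = j then (⟨i, hij⟩ : {s // s ≠ j}) else ⟨s, h⟩)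

/-- The image of a multiplicative moment map along a chain of fusions. -/
def moment : {A : BracketAlg.{u, v, w} k} → (F : FusionChain A) → A.carrier → F.target.carrier
  | _, nil _, Φ => Φ
  | A, cons i j hij F, Φ => F.moment (A.fuseMoment i j hij Φ)

/-- The chain respects the partition of the index set into the fibres of `c`: two idempotents end up
being identified exactly when their indices lie in the same part. -/
def Respects {A : BracketAlg.{u, v, w} k} (F : FusionChain A) {J : Type*} (c : A.ι → J) : Prop :=
  ∀ s t, F.index s = F.index t ↔ c s = c t

end FusionChain

end DoubleBr

end

/-! Fusing idempotents identifies vertices. The fused algebra is generated by the image of a linear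
map π that is multiplicative only on products of the form a e_s b, and it is universal among such
maps (`IsVertexHom`, `IsFused`, `proj_exists_lift`). Universality composes along a chain
(`IsFused.trans`), so the final algebra depends only on which idempotents are identified. What
remains to be compared is the brackets.

On generators the whole table of the fusion bracket is −½ E_i ∧ E_j (`fusionBracket_proj`), where
E_s(a) = π(a e_s) ⊗ π(e_s) − π(e_s) ⊗ π(e_s a) is the Euler double derivation at s. The Euler
derivation of a fused idempotent is the sum of those over its fibre. Hence a chain of fusions gives
γ(πa, πb) = (π ⊗ π)β(a, b) − ½ Σ_{s<t} (E_s ∧ E_t)(a, b), for a linear order on the indices read off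
from the chain (`FusionChain.hasOrder`). The chain enters only through this order, and two orders
are connected by exchanges of neighbours.

If the neighbours x, y lie in different parts, E_x ∧ E_y is zero. If they lie in the same part, π is
replaced by the twist ρ that sends a ∈ e_s A e_t to v_s π(a) v_t⁻¹, with v_y = π(Φ_x) and v_s
trivial for s ≠ y. The multiplicative property reads {{Φ_x, −}} = ½(Φ_x E_x + E_x Φ_x) for the inner
bimodule structure, and it makes the passage from π to ρ turn E_x ∧ E_y into E_y ∧ E_x
(`IsFused.toFun_twist`, `HasOrder.exchange_of_eq`). Since ρ is again universal, finitely many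
exchanges bring both chains to the same order; then universality gives ψ
(`IsFused.exists_algEquiv`), and ψ respects the brackets because they have the same formula on
generators (`IsFused.map_bracket`).

Along a chain a moment map becomes the ordered product of the elements 1 − f_{c(s)} + π(φ_s)
(`FusionChain.moment_eq`). The exchange preserves it because φ_x φ_y = (φ_x φ_y φ_x⁻¹) φ_x. The
element used for twisting need not be the component φ_x itself, but the two are proportional
(`exists_eq_smul`).

For the quasi-Poisson property, the triple bracket of β − ½ E_i ∧ E_j has three parts: the image of
the triple bracket of β, mixed terms that cancel under cyclic summation, and ¼ times the terms
quadratic in E_i ∧ E_j. The last are exactly the amount by which the cubic right-hand side fails to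
be additive when e_i and e_j merge (`homLeft_cyclic_sum`, `triple_homogeneous`). -/

open scoped TensorProduct

noncomputable section

namespace DoubleBr

universe u v w

/-! ### Vertex homomorphisms and fused algebras -/

section VertexHom

variable {ι ι' ι'' : Type*} {k : Type u} [Field k]

/-- A linear map which is multiplicative on products composable at a vertex, where the idempotents
`e s` of the source are sent to the elements `h s`. -/
structure IsVertexHom {A D : Type*} [Ring A] [Algebra k A] [Ring D] [Algebra k D]
    (e : ι → A) (h : ι → D) (π : A →ₗ[k] D) : Prop where
  map_mul : ∀ a b s, π (a * e s * b) = π (a * e s) * π (e s * b)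
  map_idem : ∀ s, π (e s) = h s

namespace IsVertexHom

variable {A D S : Type*} [Ring A] [Algebra k A] [Ring D] [Algebra k D] [Ring S] [Algebra k S]
  {e : ι → A} {h : ι → D} {π : A →ₗ[k] D}

lemma map_right (H : IsVertexHom e h π) (a : A) (s : ι) : π (a * e s) * h s = π (a * e s) := by
  have := H.map_mul a 1 s
  rw [mul_one, mul_one, H.map_idem] at this
  exact this.symm

lemma map_left (H : IsVertexHom e h π) (a : A) (s : ι) : h s * π (e s * a) = π (e s * a) := by
  have := H.map_mul 1 a s
  rw [one_mul, H.map_idem] at this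
  exact this.symm

lemma idem (H : IsVertexHom e h π) {s : ι} (hs : e s * e s = e s) : h s * h s = h s := by
  have := H.map_right (e s) s
  rwa [hs, H.map_idem] at this

lemma comp {c : ι' → ι} {B : Type*} [Ring B] [Algebra k B] {d : ι' → B}
    {ρ : B →ₗ[k] A} (H : IsVertexHom e h π) (Hρ : IsVertexHom d (e ∘ c) ρ) :
    IsVertexHom d (h ∘ c) (π ∘ₗ ρ) where
  map_mul a b s := by
    simp only [LinearMap.comp_apply]
    have h1 := Hρ.map_right a s
    have h2 := Hρ.map_left b s
    simp only [Function.comp_apply] at h1 h2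
    rw [Hρ.map_mul, ← h1, mul_assoc, ← h2, ← mul_assoc, ← mul_assoc,
      mul_assoc (ρ _) (e _) (e _)]
    have h3 : ρ (a * d s) * (e (c s) * e (c s)) * ρ (d s * b) =
        ρ (a * d s) * e (c s) * ρ (d s * b) := by
      rw [← mul_assoc, h1, h1]
    rw [h3, H.map_mul]
  map_idem s := by
    rw [LinearMap.comp_apply, Hρ.map_idem, Function.comp_apply, Function.comp_apply, H.map_idem]

/-- A vertex homomorphism between complete families of orthogonal idempotents is an algebra
homomorphism. -/
def toAlgHom [Fintype ι] (H : IsVertexHom e h π) (he : CompleteOrthogonalIdempotents e)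
    (hh : CompleteOrthogonalIdempotents h) : A →ₐ[k] D :=
  AlgHom.ofLinearMap π
    (by rw [← he.complete, map_sum, ← hh.complete]; simp only [H.map_idem])
    (fun x y => by
      classical
      have e1 : π (x * y) = ∑ s, π (x * e s) * π (e s * y) := by
        rw [← Finset.sum_congr rfl fun s _ => H.map_mul x y s, ← map_sum, ← Finset.sum_mul,
          ← Finset.mul_sum, he.complete, mul_one]
      have e2 : π x = ∑ s, π (x * e s) := by
        rw [← map_sum, ← Finset.mul_sum, he.complete, mul_one]
      have e3 : π y = ∑ s, π (e s * y) := by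
        rw [← map_sum, ← Finset.sum_mul, he.complete, one_mul]
      rw [e1, e2, e3, Finset.sum_mul_sum]
      refine Finset.sum_congr rfl fun s _ => ?_
      rw [Finset.sum_eq_single s]
      · intro t _ ht
        rw [← H.map_right, ← H.map_left y t, mul_assoc, ← mul_assoc (h s), hh.ortho ht.symm,
          zero_mul, mul_zero]
      · simp)

/-- Split `a` by its left idempotents: the part at `s` is fixed by `f (c s)`, hence killed by `f r`
unless `c s = r`. This is how multiplication by a fused idempotent is pulled back to `A`. -/
lemma idem_mul_map [Fintype ι] [Fintype ι'] [DecidableEq ι'] {f : ι' → D} {c : ι → ι'}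
    (H : IsVertexHom e (f ∘ c) π) (he : CompleteOrthogonalIdempotents e)
    (hf : CompleteOrthogonalIdempotents f) (r : ι') (a : A) :
    f r * π a = π ((∑ s with c s = r, e s) * a) := by
  have e3 : π a = ∑ s, π (e s * a) := by
    rw [← map_sum, ← Finset.sum_mul, he.complete, one_mul]
  rw [e3, Finset.mul_sum, Finset.sum_mul, map_sum, Finset.sum_filter]
  refine Finset.sum_congr rfl fun s _ => ?_
  have h1 := H.map_left a s
  split_ifs with h
  · rwa [← h]
  · rw [← h1, ← mul_assoc, Function.comp_apply, hf.ortho (Ne.symm h), zero_mul]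

lemma map_mul_idem [Fintype ι] [Fintype ι'] [DecidableEq ι'] {f : ι' → D} {c : ι → ι'}
    (H : IsVertexHom e (f ∘ c) π) (he : CompleteOrthogonalIdempotents e)
    (hf : CompleteOrthogonalIdempotents f) (r : ι') (a : A) :
    π a * f r = π (a * ∑ s with c s = r, e s) := by
  have e3 : π a = ∑ s, π (a * e s) := by
    rw [← map_sum, ← Finset.mul_sum, he.complete, mul_one]
  rw [e3, Finset.mul_sum, Finset.sum_mul, map_sum, Finset.sum_filter]
  refine Finset.sum_congr rfl fun s _ => ?_
  have h1 := H.map_right a s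
  split_ifs with h
  · rwa [← h]
  · rw [← h1, mul_assoc, Function.comp_apply, hf.ortho h, mul_zero]

end IsVertexHom

/-- `D` is the algebra obtained from `A` by identifying the idempotents `e s` according to
`c : ι → ι'`: it is generated by the image of `π`, and universal for vertex homomorphisms. -/
structure IsFused {A D : Type w} [Ring A] [Algebra k A] [Ring D] [Algebra k D]
    (e : ι → A) (f : ι' → D) (c : ι → ι') (π : A →ₗ[k] D) : Prop where
  hom : IsVertexHom e (f ∘ c) π
  induction : ∀ P : D → Prop, (∀ a, P (π a)) → (∀ x y, P x → P y → P (x + y)) →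
    (∀ x y, P x → P y → P (x * y)) → ∀ x, P x
  lift : ∀ (S : Type w) [Ring S] [Algebra k S] (h : ι' → S) (g : A →ₗ[k] S),
    IsVertexHom e (h ∘ c) g → ∃ G : D →ₗ[k] S, IsVertexHom f h G ∧ ∀ a, G (π a) = g a

namespace IsFused

variable {A D E : Type w} [Ring A] [Algebra k A] [Ring D] [Algebra k D] [Ring E] [Algebra k E]
  {e : ι → A} {f : ι' → D} {c : ι → ι'} {π : A →ₗ[k] D}

lemma refl [Fintype ι] (he : CompleteOrthogonalIdempotents e) :
    IsFused e e id (LinearMap.id : A →ₗ[k] A) where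
  hom := ⟨fun a b s => by
    simp only [LinearMap.id_apply]
    rw [mul_assoc, mul_assoc, ← mul_assoc (e s) (e s), (he.idem s).eq], fun s => rfl⟩
  induction P hP _ _ x := hP x
  lift S _ _ h g hg := ⟨g, hg, fun _ => rfl⟩

lemma trans [Fintype ι] [Fintype ι'] [DecidableEq ι'] (he : CompleteOrthogonalIdempotents e)
    (hf : CompleteOrthogonalIdempotents f)
    {f' : ι'' → E} {c' : ι' → ι''} {π' : D →ₗ[k] E} (H : IsFused e f c π)
    (H' : IsFused f f' c' π') : IsFused e f' (c' ∘ c) (π' ∘ₗ π) where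
  hom := H'.hom.comp H.hom
  induction P hP hadd hmul := by
    -- `π'` is not multiplicative, so an induction on `P (π' x)` alone would fail at products. All
    -- corners `f r * x * f r'` are treated at once: a product is cut at the idempotents `f s`, and
    -- each piece is composable there.
    have key : ∀ x : D, (∀ r r', P (π' (f r * x * f r'))) ∧ P (π' x) := by
      have sum_mem : ∀ {κ : Type _} (s : Finset κ) (g : κ → E), (∀ i ∈ s, P (g i)) →
          P (∑ i ∈ s, g i) := by
        classical
        intro κ s g
        induction s using Finset.induction_on with
        | empty => intro _; simpa using hP 0
        | insert a s ha ih =>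
          intro h
          rw [Finset.sum_insert ha]
          exact hadd _ _ (h a (by simp)) (ih fun i hi => h i (by simp [hi]))
      have expand : ∀ x, (∀ r r', P (π' (f r * x * f r'))) → P (π' x) := by
        intro x hx
        have : x = ∑ r, ∑ r', f r * x * f r' := by
          simp only [← Finset.mul_sum, hf.complete, mul_one, ← Finset.sum_mul, one_mul]
        rw [this, map_sum]
        refine sum_mem _ _ fun r _ => ?_
        rw [map_sum]
        exact sum_mem _ _ fun r' _ => hx r r'
      suffices ∀ x : D, ∀ r r', P (π' (f r * x * f r')) from fun x => ⟨this x, expand x (this x)⟩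
      refine H.induction _ ?_ ?_ ?_
      · intro a r r'
        rw [H.hom.idem_mul_map he hf, H.hom.map_mul_idem he hf]
        exact hP _
      · intro x y hx hy r r'
        rw [mul_add, add_mul, map_add]
        exact hadd _ _ (hx r r') (hy r r')
      · intro x y hx hy r r'
        have : f r * (x * y) * f r' = ∑ s, (f r * x) * f s * (y * f r') := by
          simp only [← Finset.mul_sum, ← Finset.sum_mul, hf.complete, one_mul, mul_assoc]
        rw [this, map_sum]
        refine sum_mem _ _ fun s _ => ?_
        rw [H'.hom.map_mul, ← mul_assoc]
        exact hmul _ _ (hx r s) (hy s r')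
    exact H'.induction P (fun x => (key x).2) hadd hmul
  lift S _ _ h g hg := by
    obtain ⟨G, hG, hGg⟩ := H.lift S (h ∘ c') g hg
    obtain ⟨G', hG', hGcomp⟩ := H'.lift S h G hG
    exact ⟨G', hG', fun a => by rw [LinearMap.comp_apply, hGcomp, hGg]⟩

/-- Extension of a derivation from `A` to a fused algebra. -/
lemma exists_der [Fintype ι] [Fintype ι'] (H : IsFused e f c π)
    (hf : CompleteOrthogonalIdempotents f) {T : Type w} [Ring T] [Algebra k T] (L R : D →ₐ[k] T)
    (δ : A →ₗ[k] T)
    (hδ : ∀ a b s, δ (a * e s * b) = δ (a * e s) * R (π (e s * b)) + L (π (a * e s)) * δ (e s * b))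
    (h0 : ∀ s, δ (e s) = 0) :
    ∃ Δ : D →ₗ[k] T, (∀ x y, Δ (x * y) = Δ x * R y + L x * Δ y) ∧ ∀ a, Δ (π a) = δ a := by
  -- A derivation along `L` and `R` is the upper right entry of a homomorphism to upper triangular
  -- matrices with diagonal `L`, `R`. This homomorphism is supplied by the universal property, and
  -- the entry is read off again at the end.
  let g : A →ₗ[k] Matrix (Fin 2) (Fin 2) T :=
    { toFun := fun a => !![L (π a), δ a; 0, R (π a)]
      map_add' := fun a b => by simp
      map_smul' := fun r a => by simp }
  have gdef : ∀ a, g a = !![L (π a), δ a; 0, R (π a)] := fun _ => rfl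
  let h : ι' → Matrix (Fin 2) (Fin 2) T := fun r => !![L (f r), 0; 0, R (f r)]
  have hh : CompleteOrthogonalIdempotents h := by
    refine ⟨⟨fun r => ?_, fun r r' hr => ?_⟩, ?_⟩
    · simp [h, IsIdempotentElem, ← map_mul, (hf.idem r).eq]
    · simp only [h, Matrix.mul_fin_two, ← map_mul, hf.ortho hr]
      ext a b
      fin_cases a <;> fin_cases b <;> simp
    · ext i j
      fin_cases i <;> fin_cases j <;>
        simp [h, Matrix.sum_apply, ← map_sum, hf.complete]
  obtain ⟨G0, hG0, hG⟩ := H.lift _ h g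
    ⟨fun a b s => by simp [gdef, hδ, H.hom.map_mul, add_comm],
      fun s => by
        have := H.hom.map_idem s
        simp only [Function.comp_apply] at this
        simp [gdef, h, h0, this]⟩
  let G := hG0.toAlgHom hf hh
  have GA : ∀ a, G (π a) = g a := fun a => hG a
  have key : ∀ x, G x 0 0 = L x ∧ G x 1 0 = 0 ∧ G x 1 1 = R x := by
    refine H.induction _ ?_ ?_ ?_
    · intro a; rw [GA]; simp [gdef]
    · intro x y hx hy; rw [map_add, map_add, map_add]; simp [hx, hy]
    · intro x y hx hy
      rw [map_mul, map_mul, map_mul]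
      simp [Matrix.mul_apply, Fin.sum_univ_two, hx, hy]
  refine ⟨(Matrix.entryLinearMap k _ 0 1).comp G.toLinearMap, ?_, ?_⟩
  · intro x y
    have := key x
    have := key y
    simp only [LinearMap.comp_apply, AlgHom.toLinearMap_apply, map_mul,
      Matrix.entryLinearMap_apply, Matrix.mul_apply, Fin.sum_univ_two, key]
    exact add_comm _ _
  · intro a
    simp only [LinearMap.comp_apply, AlgHom.toLinearMap_apply, GA]
    simp [gdef]

end IsFused

end VertexHom

/-! ### Fusion of one idempotent onto another -/

section Step

variable {k : Type u} [Field k] {ι : Type v} [DecidableEq ι] {A : Type w} [Ring A]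
  [Algebra k A] {e : ι → A} {i j : ι}

/-- The map of index sets induced by the fusion of `e j` onto `e i`. -/
def fuseIndex (hij : i ≠ j) (s : ι) : {s : ι // s ≠ j} :=
  if h : s = j then ⟨i, hij⟩ else ⟨s, h⟩

lemma fuseIndex_self (hij : i ≠ j) : fuseIndex hij j = ⟨i, hij⟩ := dif_pos rfl

lemma fuseIndex_of_ne (hij : i ≠ j) {s : ι} (h : s ≠ j) : fuseIndex hij s = ⟨s, h⟩ := dif_neg h

lemma fuseIndex_coe (hij : i ≠ j) (s : {s : ι // s ≠ j}) : fuseIndex hij s = s :=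
  fuseIndex_of_ne hij s.2

variable [Fintype ι]

/-- In `Ā` one has a^f = (ε + e₁₂) a (ε + e₂₁). In a product of two such elements the inner factors
meet in (ε + e₂₁)(ε + e₁₂) = 1 + e₁₂ + e₂₁, and between two copies of `e s` the matrix units vanish
because `i ≠ j`. -/
lemma proj_isVertexHom (he : CompleteOrthogonalIdempotents e) (hij : i ≠ j) :
    IsVertexHom e (fusIdem (k := k) e i j ∘ fuseIndex hij) (Fus.proj (e i) (e j)) where
  map_mul a b s := by
    have hpq := he.ortho hij
    have hqp := he.ortho hij.symm
    apply Fus.val_injective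
    simp only [Fus.val_mul, Fus.val_proj hpq hqp, map_mul]
    have h1 : (Ext.eps (e i) (e j) + Ext.e21 (e i) (e j)) * (Ext.eps (e i) (e j) +
        Ext.e12 (e i) (e j) : Ext k (e i) (e j)) =
        1 + (Ext.e12 (e i) (e j) + Ext.e21 (e i) (e j)) := by
      rw [add_mul, mul_add, mul_add, Ext.eps_isIdempotentElem.eq, Fus.eps_mul_e12 hqp,
        Fus.e21_mul_eps hpq, Ext.e21_mul_e12, Ext.eps]
      abel
    have h2 : (Ext.inc (e i) (e j) (e s) : Ext k (e i) (e j)) * Ext.e12 (e i) (e j) *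
        Ext.inc (e i) (e j) (e s) = 0 := by
      by_cases hs : s = i
      · rw [← Ext.e12_mul_q, mul_assoc, mul_assoc, ← map_mul, hs, hqp]; simp
      · rw [← Ext.p_mul_e12, ← mul_assoc, ← map_mul, he.ortho hs]; simp
    have h3 : (Ext.inc (e i) (e j) (e s) : Ext k (e i) (e j)) * Ext.e21 (e i) (e j) *
        Ext.inc (e i) (e j) (e s) = 0 := by
      by_cases hs : s = i
      · rw [← Ext.q_mul_e21, ← mul_assoc, ← map_mul, hs, hpq]; simp
      · rw [← Ext.e21_mul_p, mul_assoc, mul_assoc, ← map_mul, he.ortho (Ne.symm hs)]; simp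
    have h4 : (Ext.inc (e i) (e j) (e s) : Ext k (e i) (e j)) * ((Ext.eps (e i) (e j) +
        Ext.e21 (e i) (e j)) * (Ext.eps (e i) (e j) + Ext.e12 (e i) (e j))) *
        Ext.inc (e i) (e j) (e s) = Ext.inc (e i) (e j) (e s) := by
      rw [h1, mul_add, mul_one, add_mul, mul_add, add_mul, h2, h3, ← map_mul, (he.idem s).eq]
      simp
    conv_lhs => rw [← h4]
    simp only [mul_assoc]
  map_idem s := by
    by_cases hs : s = j
    · subst hs
      rw [Function.comp_apply, fuseIndex_self]
      have hpq := he.ortho hij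
      have hqp := he.ortho hij.symm
      apply Fus.val_injective
      change _ = (Fus.proj (e i) (e s) (e i)).val
      rw [Fus.val_proj_p hpq hqp, Fus.val_proj hpq hqp, add_mul, Fus.eps_mul_q, Ext.e12_mul_q,
        zero_add, mul_add, Fus.e12_mul_eps, Ext.e12_mul_e21, zero_add]
    · rw [Function.comp_apply, fuseIndex_of_ne hij hs]
      rfl

/-- Since `g` is not an algebra map, the presentation of `Ā` cannot be mapped to `S` directly.
Instead `Ā` acts on the right `S`-module of columns with entries in `η s * S`, and `G` is recovered
from this action by applying it to one vector and summing the entries. -/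
lemma proj_exists_lift (he : CompleteOrthogonalIdempotents e) (hij : i ≠ j)
    {S : Type*} [Ring S] [Algebra k S] (h : {s : ι // s ≠ j} → S) (g : A →ₗ[k] S)
    (hg : IsVertexHom e (h ∘ fuseIndex hij) g) :
    ∃ G : Fus k (e i) (e j) →ₗ[k] S, IsVertexHom (fusIdem (k := k) e i j) h G ∧
      ∀ a, G (Fus.proj (e i) (e j) a) = g a := by
  have hpq := he.ortho hij
  have hqp := he.ortho hij.symm
  set η : ι → S := h ∘ fuseIndex hij with hη
  have hidem : ∀ s, η s * η s = η s := fun s => hg.idem (he.idem s)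
  have hηij : η i = η j := by
    rw [hη, Function.comp_apply, Function.comp_apply, fuseIndex_self, fuseIndex_of_ne hij hij]
  let M : Submodule k (ι → S) :=
    { carrier := {m | ∀ s, η s * m s = m s}
      add_mem' := fun {a b} ha hb s => by
        have h1 := ha s
        have h2 := hb s
        rw [Pi.add_apply, mul_add, h1, h2]
      zero_mem' := fun s => by simp
      smul_mem' := fun r m hm s => by
        have h1 := hm s
        rw [Pi.smul_apply, mul_smul_comm, h1] }
  -- the action of `A`
  let f : A →ₗ[k] Module.End k M :=
    LinearMap.mk₂ k (fun a m => (⟨fun s => ∑ t, g (e s * a * e t) * m.1 t, fun s => by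
        rw [Finset.mul_sum]
        refine Finset.sum_congr rfl fun t _ => ?_
        rw [← mul_assoc, mul_assoc (e s), hg.map_left]⟩ : M))
      (fun a b m => by
        ext s
        simp only [mul_add, add_mul, map_add, Finset.sum_add_distrib, Submodule.coe_add,
          Pi.add_apply])
      (fun r a m => by
        ext s
        simp [Finset.smul_sum])
      (fun a m n => by
        ext s
        simp only [mul_add, Finset.sum_add_distrib, Submodule.coe_add, Pi.add_apply])
      (fun r a m => by
        ext s
        simp [Finset.smul_sum])
  have fdef : ∀ a m s, (f a m).1 s = ∑ t, g (e s * a * e t) * m.1 t := fun _ _ _ => rfl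
  have fe : ∀ r m s, (f (e r) m).1 s = if s = r then m.1 r else 0 := by
    intro r m s
    rw [fdef]
    split_ifs with hs
    · subst hs
      rw [Finset.sum_eq_single s]
      · rw [(he.idem s).eq, (he.idem s).eq, hg.map_idem, m.2]
      · intro t _ ht
        rw [(he.idem s).eq, he.ortho ht.symm, map_zero, zero_mul]
      · simp
    · refine Finset.sum_eq_zero fun t _ => ?_
      rw [he.ortho hs, zero_mul, map_zero, zero_mul]
  have f1 : f 1 = 1 := by
    rw [← he.complete, map_sum]
    ext m s
    simp only [LinearMap.sum_apply, Module.End.one_apply, Submodule.coe_sum, Finset.sum_apply, fe]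
    simp
  have fm : ∀ a b, f (a * b) = f a * f b := by
    intro a b
    ext m s
    rw [Module.End.mul_apply, fdef, fdef]
    simp only [fdef, Finset.mul_sum]
    rw [Finset.sum_comm]
    refine Finset.sum_congr rfl fun t _ => ?_
    simp only [← mul_assoc]
    rw [← Finset.sum_mul]
    congr 1
    have h2 : e s * a * b * e t = ∑ r, (e s * a) * e r * (b * e t) := by
      rw [← Finset.sum_mul, ← Finset.mul_sum, he.complete, mul_one]
      simp only [mul_assoc]
    rw [h2, map_sum]
    refine Finset.sum_congr rfl fun r _ => ?_
    rw [hg.map_mul, mul_assoc (e r)]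
  -- The matrix units move an entry between the places `i` and `j`, which is possible because `η i =
  -- η j`.
  let shift : ∀ a b : ι, η a = η b → Module.End k M := fun a b hab =>
    { toFun := fun m => ⟨fun s => if s = a then m.1 b else 0, fun s => by
        dsimp only
        split_ifs with hs
        · rw [hs, hab, m.2]
        · simp⟩
      map_add' := fun m n => by
        ext s
        by_cases hs : s = a <;> simp [hs]
      map_smul' := fun r m => by
        ext s
        by_cases hs : s = a <;> simp [hs] }
  have sdef : ∀ a b hab m s, (shift a b hab m).1 s = if s = a then m.1 b else 0 :=
    fun _ _ _ _ _ => rfl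
  obtain ⟨G0, G0A, G012, G021⟩ := Ext.exists_lift (p := e i) (q := e j) f f1 fm (shift i j hηij)
    (shift j i hηij.symm)
    (by ext m s; simp only [Module.End.mul_apply, sdef, fe]; simp)
    (by ext m s; simp only [Module.End.mul_apply, sdef, fe]; simp)
    (by ext m s; simp only [Module.End.mul_apply, sdef, fe]; simp)
    (by ext m s; simp only [Module.End.mul_apply, sdef, fe]; simp)
    (by ext m s; simp only [Module.End.mul_apply, sdef, fe]; simp)
    (by ext m s; simp only [Module.End.mul_apply, sdef, fe]; simp)
  -- right multiplication
  let rmul : M → S → M := fun m x => ⟨fun s => m.1 s * x, fun s => by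
    dsimp only
    rw [← mul_assoc, m.2]⟩
  have rdef : ∀ m x s, (rmul m x).1 s = m.1 s * x := fun _ _ _ => rfl
  have hr : ∀ (z : Ext k (e i) (e j)) m x, G0 z (rmul m x) = rmul (G0 z m) x := by
    intro z
    induction z using Ext.induction with
    | hA a =>
      intro m x
      ext s
      rw [G0A, rdef, fdef, fdef, Finset.sum_mul]
      simp only [rdef, mul_assoc]
    | h12 =>
      intro m x
      ext s
      rw [G012, rdef, sdef _ _ hηij, sdef _ _ hηij]
      simp only [rdef, ite_mul, zero_mul]
    | h21 =>
      intro m x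
      ext s
      rw [G021, rdef, sdef _ _ hηij.symm, sdef _ _ hηij.symm]
      simp only [rdef, ite_mul, zero_mul]
    | hadd y z hy hz =>
      intro m x
      ext s
      rw [map_add, LinearMap.add_apply, hy, hz, LinearMap.add_apply]
      simp only [rdef, Submodule.coe_add, Pi.add_apply, add_mul]
    | hmul y z hy hz =>
      intro m x
      rw [map_mul, Module.End.mul_apply, Module.End.mul_apply, hz, hy]
  -- This vector plays the role of ε: it is the column of all `η s` with the entry at `j` removed.
  let v0 : M := ⟨fun s => if s = j then 0 else η s, fun s => by
    dsimp only
    split_ifs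
    · simp
    · exact hidem s⟩
  have v0def : ∀ s, v0.1 s = if s = j then 0 else η s := fun _ => rfl
  let σ : M →ₗ[k] S := ∑ s, LinearMap.proj s ∘ₗ M.subtype
  have σdef : ∀ m, σ m = ∑ s, m.1 s := fun m => by simp [σ]
  have hvalf : ∀ s : {s : ι // s ≠ j},
      (fusIdem (k := k) e i j s).val = Ext.inc (e i) (e j) (e s) := by
    intro s
    have h1 : (1 - e j) * e s * (1 - e j) = e s := by
      simp [sub_mul, mul_sub, he.ortho s.2, he.ortho s.2.symm]
    have h2 := Fus.val_proj_tt (k := k) hpq hqp (e s)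
    rw [h1] at h2
    rw [fusIdem, h2, ← Fus.inc_one_sub_q, ← map_mul, ← map_mul, h1]
  let G : Fus k (e i) (e j) →ₗ[k] S :=
    { toFun := fun z => σ (G0 z.val v0)
      map_add' := fun x y => by rw [Fus.val_add, map_add, LinearMap.add_apply, map_add]
      map_smul' := fun r x => by
        rw [Fus.val_smul, map_smul, LinearMap.smul_apply, map_smul, RingHom.id_apply] }
  have Gdef : ∀ z, G z = σ (G0 z.val v0) := fun _ => rfl
  have hleft : ∀ (r : {s : ι // s ≠ j}) y, G (fusIdem e i j r * y) = (G0 y.val v0).1 r := by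
    intro r y
    rw [Gdef, Fus.val_mul, hvalf, map_mul, Module.End.mul_apply, G0A, σdef]
    simp only [fe]
    simp
  refine ⟨G, ⟨fun x y r => ?_, fun r => ?_⟩, fun a => ?_⟩
  · rw [hleft, Gdef, Gdef, Fus.val_mul, Fus.val_mul, hvalf, map_mul, map_mul,
      Module.End.mul_apply, Module.End.mul_apply, Module.End.mul_apply]
    -- The idempotent `e r` keeps only the entry at `r`, so applying it to `y v0` gives the right
    -- multiple of `e r v0` by that entry. Since the action commutes with right multiplication, the
    -- product formula at `r` follows.
    have h1 : G0 (Ext.inc (e i) (e j) (e r)) (G0 y.val v0) =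
        rmul (G0 (Ext.inc (e i) (e j) (e r)) v0) ((G0 y.val v0).1 r) := by
      ext s
      rw [rdef, G0A, fe, fe, v0def, if_neg r.2]
      split_ifs
      · rw [(G0 y.val v0).2]
      · simp
    rw [h1, hr, σdef, σdef, Finset.sum_mul]
  · have := hleft r 1
    rw [mul_one] at this
    rw [this, Fus.val_one, ← Fus.inc_one_sub_q, G0A, map_sub, f1]
    simp only [LinearMap.sub_apply, Module.End.one_apply, Submodule.coe_sub, Pi.sub_apply, fe,
      v0def]
    rw [if_neg r.2, if_neg r.2, sub_zero, hη, Function.comp_apply, fuseIndex_coe]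
  · have heps : ∀ m s, (G0 (Ext.eps (e i) (e j)) m).1 s = m.1 s - if s = j then m.1 j else 0 := by
      intro m s
      rw [← Fus.inc_one_sub_q, G0A, map_sub, f1]
      simp only [LinearMap.sub_apply, Module.End.one_apply, Submodule.coe_sub, Pi.sub_apply, fe]
    -- The factor ε + e₂₁ restores the missing entry at `j` by copying the one at `i`. Dually, ε +
    -- e₁₂ moves the entry at `j` to `i` and does not change the sum of the entries. So `G` at a^f
    -- is the sum of all `g (e s * a * e t)`.
    have hv : ∀ s, (G0 (Ext.eps (e i) (e j) + Ext.e21 (e i) (e j)) v0).1 s = η s := by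
      intro s
      rw [map_add, LinearMap.add_apply, G021, Submodule.coe_add, Pi.add_apply, heps,
        sdef _ _ hηij.symm, v0def, v0def, v0def, if_neg hij, if_pos rfl, hηij]
      split_ifs with hs
      · rw [hs]; simp
      · simp
    have hu : ∀ m, σ (G0 (Ext.eps (e i) (e j) + Ext.e12 (e i) (e j)) m) = σ m := by
      intro m
      rw [map_add, LinearMap.add_apply, G012, map_add, σdef, σdef, σdef]
      simp only [heps, sdef]
      simp
    rw [Gdef, Fus.val_proj hpq hqp, map_mul, map_mul, Module.End.mul_apply, Module.End.mul_apply,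
      hu, σdef, G0A]
    simp only [fdef, hv]
    have h3 : ∀ s t, g (e s * a * e t) * η t = g (e s * a * e t) := fun s t => hg.map_right _ t
    simp only [h3]
    simp only [← map_sum, ← Finset.mul_sum, ← Finset.sum_mul, he.complete, mul_one, one_mul]

lemma fuse_isFused {k : Type u} [Field k] {A : Type (max u w)} [Ring A] [Algebra k A] {e : ι → A}
    (he : CompleteOrthogonalIdempotents e) (hij : i ≠ j) :
    IsFused e (fusIdem (k := k) e i j) (fuseIndex hij) (Fus.proj (e i) (e j)) where
  hom := proj_isVertexHom he hij
  induction _ h1 h2 h3 := Fus.induction (he.ortho hij) (he.ortho hij.symm) h1 h2 h3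
  lift _ _ _ h g hg := proj_exists_lift he hij h g hg

end Step

/-! ### Brackets defined by pairs of double derivations -/

section Wedge

variable {k : Type u} [Field k] {ι : Type*} {A D : Type*} [Ring A] [Algebra k A] [Ring D]
  [Algebra k D]

/-- The product `(a ⊗ b) * (x ⊗ y) = x b ⊗ a y` on `D ⊗ D`. -/
def starMul : D ⊗[k] D →ₗ[k] D ⊗[k] D →ₗ[k] D ⊗[k] D :=
  TensorProduct.lift (LinearMap.mk₂ k
    (fun a b => TensorProduct.map (LinearMap.mulRight k b) (LinearMap.mulLeft k a))
    (fun a a' b => by ext x y; simp [add_mul, TensorProduct.tmul_add])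
    (fun r a b => by ext x y; simp)
    (fun a b b' => by ext x y; simp [mul_add, TensorProduct.add_tmul])
    (fun r a b => by ext x y; simp [TensorProduct.smul_tmul']))

@[simp] lemma starMul_tmul (a b x y : D) :
    starMul (a ⊗ₜ[k] b) (x ⊗ₜ[k] y) = (x * b) ⊗ₜ (a * y) := by simp [starMul]

/-- `starMul` is linear for the outer bimodule structure in its second argument, so that `starMul d
∘ Δ` is a double derivation whenever `Δ` is. `comm_starMul` supplies the antisymmetry of `wedge`. -/
lemma starMul_mul_right (d d' : D ⊗[k] D) (c : D) :
    starMul d (d' * (1 ⊗ₜ c)) = starMul d d' * (1 ⊗ₜ c) := by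
  induction d using TensorProduct.induction_on with
  | zero => simp
  | add x y hx hy => simp only [map_add, LinearMap.add_apply, hx, hy, add_mul]
  | tmul a b =>
    induction d' using TensorProduct.induction_on with
    | zero => simp
    | add x y hx hy => simp only [map_add, hx, hy, add_mul]
    | tmul x y => simp [mul_assoc]

lemma starMul_mul_left (d d' : D ⊗[k] D) (b : D) :
    starMul d ((b ⊗ₜ 1) * d') = (b ⊗ₜ 1) * starMul d d' := by
  induction d using TensorProduct.induction_on with
  | zero => simp
  | add x y hx hy => simp only [map_add, LinearMap.add_apply, hx, hy, mul_add]
  | tmul a b =>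
    induction d' using TensorProduct.induction_on with
    | zero => simp
    | add x y hx hy => simp only [map_add, hx, hy, mul_add]
    | tmul x y => simp [mul_assoc]

lemma comm_starMul (d d' : D ⊗[k] D) :
    Algebra.TensorProduct.comm k D D (starMul d d') = starMul d' d := by
  induction d using TensorProduct.induction_on with
  | zero => simp
  | add x y hx hy => simp only [map_add, LinearMap.add_apply, hx, hy]
  | tmul a b =>
    induction d' using TensorProduct.induction_on with
    | zero => simp
    | add x y hx hy => simp only [map_add, LinearMap.add_apply, hx, hy]
    | tmul x y => simp

/-- The antisymmetric bilinear map associated with a pair of linear maps to `D ⊗ D`. -/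
def wedge (δ Δ : A →ₗ[k] D ⊗[k] D) : A →ₗ[k] A →ₗ[k] D ⊗[k] D :=
  starMul.compl₁₂ δ Δ - starMul.compl₁₂ Δ δ

@[simp] lemma wedge_apply (δ Δ : A →ₗ[k] D ⊗[k] D) (a b : A) :
    wedge δ Δ a b = starMul (δ a) (Δ b) - starMul (Δ a) (δ b) := rfl

/-- The map `a ↦ π (a e_s) ⊗ π e_s - π e_s ⊗ π (e_s a)`. -/
def euler (e : ι → A) (π : A →ₗ[k] D) (s : ι) : A →ₗ[k] D ⊗[k] D :=
  (TensorProduct.mk k D D).flip (π (e s)) ∘ₗ π ∘ₗ LinearMap.mulRight k (e s)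
    - TensorProduct.mk k D D (π (e s)) ∘ₗ π ∘ₗ LinearMap.mulLeft k (e s)

lemma euler_apply (e : ι → A) (π : A →ₗ[k] D) (s : ι) (a : A) :
    euler e π s a = π (a * e s) ⊗ₜ π (e s) - π (e s) ⊗ₜ π (e s * a) := rfl

end Wedge

/-! ### The bracket of one fusion on generators, in terms of Euler maps. -/

section Step

variable {k : Type u} [Field k] {ι : Type v} [Fintype ι] {A : Type w} [Ring A]
  [Algebra k A] {e : ι → A} {i j : ι}

lemma inducedBracket_isInduced (he : CompleteOrthogonalIdempotents e) (β : DoubleBracket k e)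
    (hij : i ≠ j) : Fus.IsInduced β (inducedBracket he β i j hij) :=
  (Fus.existsUnique_induced (e' := fusIdem (k := k) e i j) (he.ortho hij) (he.ortho hij.symm) β
    (fun a => β.base a i) (fun a => β.base a j) (fun s => ⟨s, rfl⟩)).choose_spec.1

lemma fusionBracket_isFusionBracket (he : CompleteOrthogonalIdempotents e) (hij : i ≠ j) :
    Fus.IsFusionBracket (fusionBracket (k := k) he i j hij) :=
  (Fus.existsUnique_fusionBracket (e' := fusIdem (k := k) e i j) (he.ortho hij)
    (he.ortho hij.symm) (he.idem i) (he.idem j) (fun s => ⟨e s, rfl, he.ortho s.2,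
      he.ortho s.2.symm, (eq_or_ne (s : ι) i).imp (fun h => by rw [h])
        (fun h => ⟨he.ortho h, he.ortho h.symm⟩)⟩)).choose_spec.1

variable [DecidableEq ι]

set_option linter.unusedSimpArgs false in
-- The sixteen cases of the table are one formula: the types t, u, v, w differ only in which of the
-- four terms of the Euler maps at `i` and `j` survive. In this form the fusion bracket can be
-- followed through further fusions.
lemma fusionBracket_proj (he : CompleteOrthogonalIdempotents e) (hij : i ≠ j) (a b : A) :
    (fusionBracket (k := k) he i j hij).toFun (Fus.proj (e i) (e j) a) (Fus.proj (e i) (e j) b) =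
      -((1 / 2 : k) • wedge (euler e (Fus.proj (e i) (e j)) i) (euler e (Fus.proj (e i) (e j)) j)
        a b) := by
  have h := fusionBracket_isFusionBracket (k := k) he hij
  have hpq := he.ortho hij
  have hqp := he.ortho hij.symm
  have hqq := (he.idem j).eq
  have hpp := (he.idem i).eq
  have hεε : (1 - e j) * (1 - e j) = 1 - e j := by simp [mul_sub, sub_mul, hqq]
  have hεq : (1 - e j) * e j = 0 := by simp [sub_mul, hqq]
  have hqε : e j * (1 - e j) = 0 := by simp [mul_sub, hqq]
  obtain ⟨E, hE⟩ : ∃ E : Fus k (e i) (e j), E = Fus.proj (e i) (e j) (e i) := ⟨_, rfl⟩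
  have hEq : Fus.proj (e i) (e j) (e j) = E := by
    have h1 := (proj_isVertexHom (k := k) he hij).map_idem j
    rw [Function.comp_apply, fuseIndex_self] at h1
    rw [hE]; exact h1
  have hEE : E * E = E := by
    rw [hE, ← Fus.proj_mul_p hpq hqp (by rw [mul_sub, mul_one, hpq, sub_zero]), hpp]
  have hEE' : ∀ z, E * (E * z) = E * z := fun z => by rw [← mul_assoc, hEE]
  have l1 : ∀ {a b : A}, (1 - e j) * a * b = a → (1 - e j) * a = a ∧ e j * a = 0 := by
    intro a b h
    rw [← h, ← mul_assoc, ← mul_assoc, hεε, ← mul_assoc, ← mul_assoc, hqε, zero_mul, zero_mul]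
    exact ⟨rfl, rfl⟩
  have l2 : ∀ {a b : A}, e j * a * b = a → e j * a = a := by
    intro a b h
    conv_lhs => rw [← h]
    rw [← mul_assoc, ← mul_assoc, hqq, h]
  have r1 : ∀ {a b : A}, b * a * (1 - e j) = a → a * (1 - e j) = a ∧ a * e j = 0 := by
    intro a b h
    rw [← h, mul_assoc _ _ (1 - e j), hεε, mul_assoc _ _ (e j), hεq, mul_zero]
    exact ⟨rfl, rfl⟩
  have r2 : ∀ {a b : A}, b * a * e j = a → a * e j = a := by
    intro a b h
    conv_lhs => rw [← h]
    rw [mul_assoc, hqq, h]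
  have L1 : ∀ {a b : A}, (1 - e j) * a * b = a →
      (Fus.proj (e i) (e j) (e i * a) : Fus k (e i) (e j)) = E * Fus.proj (e i) (e j) a ∧
      (Fus.proj (e i) (e j) (e j * a) : Fus k (e i) (e j)) = 0 :=
    fun h => ⟨hE ▸ Fus.p_mul_proj hpq hqp (l1 h).1, by rw [(l1 h).2, map_zero]⟩
  have L2 : ∀ {a b : A}, e j * a * b = a → (Fus.proj (e i) (e j) (e i * a) : Fus k (e i) (e j)) = 0 ∧
      Fus.proj (e i) (e j) (e j * a) = (Fus.proj (e i) (e j) a : Fus k (e i) (e j)) := by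
    intro a b h
    refine ⟨?_, by rw [l2 h]⟩
    rw [← l2 h, ← mul_assoc, hpq, zero_mul, map_zero]
  have L2' : ∀ {a b : A}, e j * a * b = a → E * Fus.proj (e i) (e j) a = Fus.proj (e i) (e j) a :=
    fun h => hE ▸ Fus.p_mul_proj' hpq hqp (l2 h)
  have R1 : ∀ {a b : A}, b * a * (1 - e j) = a →
      (Fus.proj (e i) (e j) (a * e i) : Fus k (e i) (e j)) = Fus.proj (e i) (e j) a * E ∧
      (Fus.proj (e i) (e j) (a * e j) : Fus k (e i) (e j)) = 0 :=
    fun h => ⟨hE ▸ Fus.proj_mul_p hpq hqp (r1 h).1, by rw [(r1 h).2, map_zero]⟩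
  have R2 : ∀ {a b : A}, b * a * e j = a → (Fus.proj (e i) (e j) (a * e i) : Fus k (e i) (e j)) = 0 ∧
      Fus.proj (e i) (e j) (a * e j) = (Fus.proj (e i) (e j) a : Fus k (e i) (e j)) := by
    intro a b h
    refine ⟨?_, by rw [r2 h]⟩
    rw [← r2 h, mul_assoc, hqp, mul_zero, map_zero]
  have R2' : ∀ {a b : A}, b * a * e j = a → Fus.proj (e i) (e j) a * E = Fus.proj (e i) (e j) a :=
    fun h => hE ▸ Fus.proj_mul_p' hpq hqp (r2 h)
  have R2'' : ∀ {a b : A}, b * a * e j = a → ∀ z, Fus.proj (e i) (e j) a * (E * z) = Fus.proj (e i) (e j) a * z :=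
    fun h z => by rw [← mul_assoc, R2' h]
  have Tt : ∀ t, (1 - e j) * t * (1 - e j) = t →
      euler e (Fus.proj (e i) (e j)) i t = (Fus.proj (e i) (e j) t * E) ⊗ₜ[k] E - E ⊗ₜ (E * Fus.proj (e i) (e j) t) ∧
      euler e (Fus.proj (e i) (e j)) j t = (0 : Fus k (e i) (e j) ⊗[k] Fus k (e i) (e j)) := by
    intro t ht
    rw [euler_apply, euler_apply, (L1 ht).1, (L1 ht).2, (R1 ht).1, (R1 ht).2]
    simp [hE]
  have Tu : ∀ t, e j * t * (1 - e j) = t →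
      euler e (Fus.proj (e i) (e j)) i t = (Fus.proj (e i) (e j) t * E) ⊗ₜ[k] E ∧
      euler e (Fus.proj (e i) (e j)) j t = - E ⊗ₜ[k] Fus.proj (e i) (e j) t := by
    intro t ht
    rw [euler_apply, euler_apply, (L2 ht).1, (L2 ht).2, (R1 ht).1, (R1 ht).2, hEq]
    simp [hE]
  have Tv : ∀ t, (1 - e j) * t * e j = t →
      euler e (Fus.proj (e i) (e j)) i t = - E ⊗ₜ[k] (E * Fus.proj (e i) (e j) t) ∧
      euler e (Fus.proj (e i) (e j)) j t = Fus.proj (e i) (e j) t ⊗ₜ[k] E := by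
    intro t ht
    rw [euler_apply, euler_apply, (L1 ht).1, (L1 ht).2, (R2 ht).1, (R2 ht).2, hEq]
    simp [hE]
  have Tw : ∀ t, e j * t * e j = t →
      euler e (Fus.proj (e i) (e j)) i t = (0 : Fus k (e i) (e j) ⊗[k] Fus k (e i) (e j)) ∧
      euler e (Fus.proj (e i) (e j)) j t = Fus.proj (e i) (e j) t ⊗ₜ[k] E - E ⊗ₜ Fus.proj (e i) (e j) t := by
    intro t ht
    rw [euler_apply, euler_apply, (L2 ht).1, (L2 ht).2, (R2 ht).1, (R2 ht).2, hEq]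
    simp [hE]
  obtain ⟨t, u, v, w, ht, hu, hv, hw, rfl⟩ := Fus.exists_decomp (e j) a hqq
  obtain ⟨t', u', v', w', ht', hu', hv', hw', rfl⟩ := Fus.exists_decomp (e j) b hqq
  simp only [wedge_apply, map_add, LinearMap.add_apply,
    h.tt _ _ ht ht', h.tu _ _ ht hu', h.tv _ _ ht hv', h.tw _ _ ht hw',
    h.ut _ _ hu ht', h.uu _ _ hu hu', h.uv _ _ hu hv', h.uw _ _ hu hw',
    h.vt _ _ hv ht', h.vu _ _ hv hu', h.vv _ _ hv hv', h.vw _ _ hv hw',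
    h.wt _ _ hw ht', h.wu _ _ hw hu', h.wv _ _ hw hv', h.ww _ _ hw hw',
    (Tt _ ht).1, (Tt _ ht).2, (Tt _ ht').1, (Tt _ ht').2,
    (Tu _ hu).1, (Tu _ hu).2, (Tu _ hu').1, (Tu _ hu').2,
    (Tv _ hv).1, (Tv _ hv).2, (Tv _ hv').1, (Tv _ hv').2,
    (Tw _ hw).1, (Tw _ hw).2, (Tw _ hw').1, (Tw _ hw').2, ← hE]
  simp only [map_add, map_sub, map_neg, map_zero, LinearMap.add_apply, LinearMap.sub_apply,
    LinearMap.neg_apply, LinearMap.zero_apply, starMul_tmul, TensorProduct.neg_tmul, mul_assoc,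
    hEE, hEE', R2' hv, R2' hv', R2'' hv, R2'' hv', R2' hw, R2' hw', R2'' hw, R2'' hw',
    L2' hu, L2' hu', L2' hw, L2' hw']
  module

lemma fuse_bracket_proj (he : CompleteOrthogonalIdempotents e) (β : DoubleBracket k e)
    (hij : i ≠ j) (a b : A) :
    ((inducedBracket he β i j hij).add (fusionBracket (k := k) he i j hij)).toFun
        (Fus.proj (e i) (e j) a) (Fus.proj (e i) (e j) b) =
      TensorProduct.map (Fus.proj (e i) (e j)) (Fus.proj (e i) (e j)) (β.toFun a b)
      - (1 / 2 : k) • wedge (euler e (Fus.proj (e i) (e j)) i)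
        (euler e (Fus.proj (e i) (e j)) j) a b := by
  rw [sub_eq_add_neg, ← fusionBracket_proj he hij, ← inducedBracket_isInduced he β hij]
  rfl

end Step

/-! ### The triple bracket -/

section Triple

variable {k : Type u} [Field k] {ι : Type*} {A : Type*} [Ring A] [Algebra k A] {e : ι → A}

@[simp] lemma tau_tmul (x y z : A) :
    tau ((x ⊗ₜ[k] y) ⊗ₜ[k] z) = (z ⊗ₜ[k] x) ⊗ₜ[k] y := by
  simp [tau]

lemma tau_tau_tau (d : (A ⊗[k] A) ⊗[k] A) : tau (tau (tau d)) = d := by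
  have : (tau ∘ₗ tau ∘ₗ tau : (A ⊗[k] A) ⊗[k] A →ₗ[k] _) = LinearMap.id := by
    ext x y z; simp
  exact LinearMap.congr_fun this d

lemma tau_mul (d d' : (A ⊗[k] A) ⊗[k] A) : tau (d * d') = tau d * tau d' := by
  have : (tau ∘ₗ LinearMap.mul' k ((A ⊗[k] A) ⊗[k] A)) =
      LinearMap.mul' k ((A ⊗[k] A) ⊗[k] A) ∘ₗ TensorProduct.map tau tau := by
    ext x y z x' y' z'; simp
  simpa using LinearMap.congr_fun this (d ⊗ₜ d')

lemma DoubleBracket.left_tmul (β : DoubleBracket k e) (a x y : A) :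
    β.left a (x ⊗ₜ y) = β.toFun a x ⊗ₜ y := by simp [DoubleBracket.left]

/-- This cyclic symmetry carries the derivation property from the last argument to the other two, so
identities for the triple bracket need only be checked on generators. -/
lemma DoubleBracket.triple_cyclic (β : DoubleBracket k e) (a b c : A) :
    β.triple a b c = tau (β.triple b c a) := by
  simp only [DoubleBracket.triple, map_add, tau_tau_tau]
  abel

lemma DoubleBracket.left_mul_right (β : DoubleBracket k e) (a c : A) (d : A ⊗[k] A) :
    β.left a (d * (1 ⊗ₜ c)) = β.left a d * (1 ⊗ₜ c) := by
  induction d using TensorProduct.induction_on with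
  | zero => simp
  | add x y hx hy => simp only [add_mul, map_add, hx, hy]
  | tmul x y => simp [β.left_tmul]

lemma DoubleBracket.left_mul_left (β : DoubleBracket k e) (a c : A) (d : A ⊗[k] A) :
    β.left a ((1 ⊗ₜ c) * d) = (1 ⊗ₜ c) * β.left a d := by
  induction d using TensorProduct.induction_on with
  | zero => simp
  | add x y hx hy => simp only [mul_add, map_add, hx, hy]
  | tmul x y => simp [β.left_tmul]

lemma DoubleBracket.left_mul_left' (β : DoubleBracket k e) (a c : A) (d : A ⊗[k] A) :
    β.left a ((c ⊗ₜ 1) * d) = ((c ⊗ₜ 1) ⊗ₜ 1) * β.left a d +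
      (β.toFun a c ⊗ₜ 1) * (TensorProduct.assoc k A A A).symm (1 ⊗ₜ d) := by
  induction d using TensorProduct.induction_on with
  | zero => simp
  | add x y hx hy =>
    simp only [mul_add, map_add, hx, hy, TensorProduct.tmul_add]; abel
  | tmul x y =>
    simp [β.left_tmul, β.leibniz, TensorProduct.add_tmul, add_comm]

/-- Here `b` may also hit the factor `c`, which gives the extra term. It is a rotation of the extra
term of `left_mul_left'`; with the signs of `triple_mul` the two cancel, as τ³ = 1. -/
lemma DoubleBracket.left_mul_right' (β : DoubleBracket k e) (b c : A) (d : A ⊗[k] A) :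
    β.left b (Algebra.TensorProduct.comm k A A d * (c ⊗ₜ 1)) =
      β.left b (Algebra.TensorProduct.comm k A A d) * ((1 ⊗ₜ c) ⊗ₜ 1) +
      tau (tau ((d ⊗ₜ 1) * (TensorProduct.assoc k A A A).symm (1 ⊗ₜ β.toFun b c))) := by
  induction d using TensorProduct.induction_on with
  | zero => simp
  | add x y hx hy =>
    simp only [add_mul, map_add, hx, hy, TensorProduct.add_tmul]; abel
  | tmul x y =>
    have : ∀ d' : A ⊗[k] A, ((y ⊗ₜ 1) * d') ⊗ₜ x = tau (tau (((x ⊗ₜ y) ⊗ₜ 1) *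
        (TensorProduct.assoc k A A A).symm (1 ⊗ₜ d'))) := by
      intro d'
      induction d' using TensorProduct.induction_on with
      | zero => simp
      | add u v hu hv =>
        simp only [mul_add, map_add, hu, hv, TensorProduct.add_tmul, TensorProduct.tmul_add]
      | tmul u v => simp
    rw [← this]
    simp [β.left_tmul, β.leibniz, TensorProduct.add_tmul]

lemma DoubleBracket.left_mul (β : DoubleBracket k e) (a b : A) (d : A ⊗[k] A) :
    β.left (a * b) d = β.left a d * ((b ⊗ₜ 1) ⊗ₜ 1) + ((1 ⊗ₜ a) ⊗ₜ 1) * β.left b d := by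
  induction d using TensorProduct.induction_on with
  | zero => simp
  | add x y hx hy => simp only [mul_add, add_mul, map_add, hx, hy]; abel
  | tmul x y => simp [β.left_tmul, β.leibniz_left, TensorProduct.add_tmul]

/-- The triple bracket is a derivation in its last argument. -/
lemma DoubleBracket.triple_mul (β : DoubleBracket k e) (a b c c' : A) :
    β.triple a b (c * c') = β.triple a b c * (1 ⊗ₜ c') + ((c ⊗ₜ 1) ⊗ₜ 1) * β.triple a b c' := by
  have h1 : β.toFun (c * c') a =
      -(Algebra.TensorProduct.comm k A A (β.toFun a c) * (c' ⊗ₜ 1)) + (1 ⊗ₜ c) * β.toFun c' a := by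
    rw [β.leibniz_left, β.antisymm c a, neg_mul]
  have h2 : β.left b (Algebra.TensorProduct.comm k A A (β.toFun a c)) =
      -β.left b (β.toFun c a) := by
    rw [β.antisymm c a, map_neg, neg_neg]
  have h3 : ∀ x y : (A ⊗[k] A) ⊗[k] A, -(-x * y) = x * y := fun x y =>
    (congrArg Neg.neg (neg_mul x y)).trans (neg_neg _)
  simp only [DoubleBracket.triple]
  rw [h1, β.leibniz b c c', map_add, map_add, map_neg, β.left_mul_right, β.left_mul_left',
    β.left_mul_left, β.left_mul_right', β.left_mul, h2, neg_add, h3]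
  simp only [map_add, map_neg, tau_mul, tau_tau_tau, tau_tmul, Algebra.TensorProduct.one_def,
    mul_add, add_mul]
  abel

/-- The summand of the quasi-Poisson property attached to an idempotent `p`. -/
def qpTerm (p a b c : A) : (A ⊗[k] A) ⊗[k] A :=
  (c * p * a) ⊗ₜ[k] (p * b) ⊗ₜ[k] p
      - (c * p * a) ⊗ₜ[k] p ⊗ₜ[k] (b * p)
      - (c * p) ⊗ₜ[k] (a * p * b) ⊗ₜ[k] p
      + (c * p) ⊗ₜ[k] (a * p) ⊗ₜ[k] (b * p)
      - (p * a) ⊗ₜ[k] (p * b) ⊗ₜ[k] (p * c)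
      + (p * a) ⊗ₜ[k] p ⊗ₜ[k] (b * p * c)
      + p ⊗ₜ[k] (a * p * b) ⊗ₜ[k] (p * c)
      - p ⊗ₜ[k] (a * p) ⊗ₜ[k] (b * p * c)

lemma qpTerm_cyclic (p a b c : A) : qpTerm (k := k) p a b c = tau (qpTerm p b c a) := by
  simp only [qpTerm, map_add, map_sub, tau_tmul]
  abel

lemma qpTerm_add (p a b c c' : A) :
    qpTerm (k := k) p a b (c + c') = qpTerm p a b c + qpTerm p a b c' := by
  simp only [qpTerm, mul_add, add_mul, TensorProduct.tmul_add, TensorProduct.add_tmul]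
  abel

lemma qpTerm_mul (p a b c c' : A) : qpTerm (k := k) p a b (c * c') =
    qpTerm p a b c * (1 ⊗ₜ c') + ((c ⊗ₜ 1) ⊗ₜ 1) * qpTerm p a b c' := by
  simp only [qpTerm, mul_add, add_mul, mul_sub, sub_mul, Algebra.TensorProduct.tmul_mul_tmul,
    one_mul, mul_one, Algebra.TensorProduct.one_def, mul_assoc]
  abel

lemma DoubleBracket.triple_add (β : DoubleBracket k e) (a b c c' : A) :
    β.triple a b (c + c') = β.triple a b c + β.triple a b c' := by
  have h : ∀ d, β.left (c + c') d = β.left c d + β.left c' d := by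
    intro d
    simp [DoubleBracket.left, LinearMap.rTensor_add]
  simp only [DoubleBracket.triple, map_add, h, LinearMap.add_apply]
  abel

/-- The quasi-Poisson property at a triple of elements. -/
def DoubleBracket.QPAt [Fintype ι] (β : DoubleBracket k e) (a b c : A) : Prop :=
  β.triple a b c = (1 / 4 : k) • ∑ s, qpTerm (e s) a b c

lemma DoubleBracket.isQuasiPoisson_iff [Fintype ι] (β : DoubleBracket k e) :
    β.IsQuasiPoisson ↔ ∀ a b c, β.QPAt a b c := Iff.rfl

namespace DoubleBracket.QPAt

variable [Fintype ι] {β : DoubleBracket k e} {a b c c' : A}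

lemma cyclic (h : β.QPAt a b c) : β.QPAt b c a := by
  have h' : β.triple a b c = (1 / 4 : k) • ∑ s, qpTerm (e s) a b c := h
  change β.triple b c a = (1 / 4 : k) • ∑ s, qpTerm (e s) b c a
  rw [β.triple_cyclic b c a, β.triple_cyclic c a b, h']
  simp only [qpTerm_cyclic _ b c a, qpTerm_cyclic _ c a b, map_smul, map_sum]

lemma add (h : β.QPAt a b c) (h' : β.QPAt a b c') : β.QPAt a b (c + c') := by
  unfold DoubleBracket.QPAt at *
  simp only [β.triple_add, h, h', qpTerm_add, Finset.sum_add_distrib, smul_add]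

lemma zero : β.QPAt a b 0 := by
  have h1 : β.triple a b 0 = 0 := by simpa using β.triple_add a b 0 0
  have h2 : ∀ p, qpTerm (k := k) p a b 0 = 0 := fun p => by simpa using qpTerm_add (k := k) p a b 0 0
  unfold DoubleBracket.QPAt
  simp [h1, h2]

lemma mul (h : β.QPAt a b c) (h' : β.QPAt a b c') : β.QPAt a b (c * c') := by
  unfold DoubleBracket.QPAt at *
  rw [β.triple_mul, h, h', smul_mul_assoc, mul_smul_comm, ← smul_add, Finset.sum_mul,
    Finset.mul_sum, ← Finset.sum_add_distrib]
  simp only [qpTerm_mul]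

end DoubleBracket.QPAt

/-- It is enough to check the quasi-Poisson property on generators. -/
lemma DoubleBracket.isQuasiPoisson_of_generators [Fintype ι] (β : DoubleBracket k e) (X : Set A)
    (ind : ∀ P : A → Prop, (∀ a ∈ X, P a) → P 0 → (∀ x y, P x → P y → P (x + y)) →
      (∀ x y, P x → P y → P (x * y)) → ∀ x, P x)
    (h : ∀ a ∈ X, ∀ b ∈ X, ∀ c ∈ X, β.QPAt a b c) : β.IsQuasiPoisson := by
  rw [β.isQuasiPoisson_iff]
  -- The arguments are rotated to the last place one after the other, and each is there extended
  -- from generators to all of `A`.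
  have h1 : ∀ a ∈ X, ∀ b ∈ X, ∀ c, β.QPAt a b c := fun a ha b hb =>
    ind _ (h a ha b hb) .zero (fun _ _ => .add) (fun _ _ => .mul)
  have h2 : ∀ b ∈ X, ∀ c a, β.QPAt b c a := fun b hb c =>
    ind _ (fun a ha => (h1 a ha b hb c).cyclic) .zero (fun _ _ => .add) (fun _ _ => .mul)
  exact fun c a => ind _ (fun b hb => (h2 b hb c a).cyclic) .zero (fun _ _ => .add) (fun _ _ => .mul)

end Triple

/-! ### Wedge and cubic terms at homogeneous elements, as polynomials in eigenvalues. -/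

section QP

variable {k : Type u} [Field k] {A D : Type*} [Ring A] [Algebra k A] [Ring D] [Algebra k D]

/-- The value of `wedge (euler i) (euler j)` at homogeneous generators `x`, `y`, where
`(p₁, p₂)` and `(p₃, p₄)` are the eigenvalues of `e_i`, `e_j` acting on `x` from the left and
from the right, and similarly for `y`. -/
def homWedge (f x y : D) (p₁ p₂ p₃ p₄ q₁ q₂ q₃ q₄ : k) : D ⊗[k] D :=
  (p₃ * q₄ - p₄ * q₃) • (y ⊗ₜ x) - (p₁ * q₄ - p₂ * q₃) • ((y * x) ⊗ₜ f)
    - (p₃ * q₂ - p₄ * q₁) • (f ⊗ₜ (x * y)) + (p₁ * q₂ - p₂ * q₁) • (x ⊗ₜ y)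

/-- The summand attached to `e_i` of the quasi-Poisson property at homogeneous generators; here
`p`, `p'` are the eigenvalues of `e_i` acting on `x` from the left and from the right. -/
def homTerm (f x y z : D) (p p' q q' r r' : k) : (D ⊗[k] D) ⊗[k] D :=
  (r' * p * q) • ((z * x) ⊗ₜ[k] y ⊗ₜ[k] f) - (r' * p * q') • ((z * x) ⊗ₜ[k] f ⊗ₜ[k] y)
    - (r' * p' * q) • (z ⊗ₜ[k] (x * y) ⊗ₜ[k] f) + (r' * p' * q') • (z ⊗ₜ[k] x ⊗ₜ[k] y)
    - (p * q * r) • (x ⊗ₜ[k] y ⊗ₜ[k] z) + (p * q' * r) • (x ⊗ₜ[k] f ⊗ₜ[k] (y * z))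
    + (p' * q * r) • (f ⊗ₜ[k] (x * y) ⊗ₜ[k] z) - (p' * q' * r) • (f ⊗ₜ[k] x ⊗ₜ[k] (y * z))

lemma qpTerm_homogeneous (f x y z : D) (p p' q q' r r' : k) (hff : f * f = f)
    (hx : f * x = p • x) (hx' : x * f = p' • x) (hy : f * y = q • y) (hy' : y * f = q' • y)
    (hz : f * z = r • z) (hz' : z * f = r' • z) :
    qpTerm f x y z = homTerm f x y z p p' q q' r r' := by
  have e1 : z * f * x = (r' * p) • (z * x) := by
    rw [← hff, ← mul_assoc, mul_assoc, hx, hz', smul_mul_smul_comm]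
  have e2 : x * f * y = (p' * q) • (x * y) := by
    rw [← hff, ← mul_assoc, mul_assoc, hx', hy, smul_mul_smul_comm]
  have e3 : y * f * z = (q' * r) • (y * z) := by
    rw [← hff, ← mul_assoc, mul_assoc, hz, hy', smul_mul_smul_comm]
  simp only [qpTerm, homTerm, e1, e2, e3]
  simp only [hx, hx', hy, hy', hz, hz', TensorProduct.tmul_smul,
    ← TensorProduct.smul_tmul', smul_smul]
  module

/-- The terms `{{x, homWedge f y z}}_L`, for given values `d = {{x, z}}` and `d₂ = {{x, y}}`. -/
def homInsert (f y z : D) (d d₂ : D ⊗[k] D) (q₁ q₂ q₃ q₄ r₁ r₂ r₃ r₄ : k) : (D ⊗[k] D) ⊗[k] D :=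
  (q₃ * r₄ - q₄ * r₃) • (d ⊗ₜ y)
    - (q₁ * r₄ - q₂ * r₃) • ((d * (1 ⊗ₜ y) + (z ⊗ₜ 1) * d₂) ⊗ₜ f)
    + (q₁ * r₂ - q₂ * r₁) • (d₂ ⊗ₜ z)

/-- `homWedge` inserted into the first factor of `homWedge`. -/
def homLeft (f x y z : D) (p₁ p₂ p₃ p₄ q₁ q₂ q₃ q₄ r₁ r₂ r₃ r₄ : k) : (D ⊗[k] D) ⊗[k] D :=
  homInsert f y z (homWedge f x z p₁ p₂ p₃ p₄ r₁ r₂ r₃ r₄)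
    (homWedge f x y p₁ p₂ p₃ p₄ q₁ q₂ q₃ q₄) q₁ q₂ q₃ q₄ r₁ r₂ r₃ r₄

/-- The fused idempotent acts with the sum of the two eigenvalues. In the expansion it meets only
`y` from the left and `z` from the right, so no other eigenvalue equations are needed. -/
lemma homLeft_expand (f x y z : D) (p₁ p₂ p₃ p₄ q₁ q₂ q₃ q₄ r₁ r₂ r₃ r₄ : k)
    (hy : f * y = (q₁ + q₂) • y) (hz' : z * f = (r₃ + r₄) • z) :
    homLeft f x y z p₁ p₂ p₃ p₄ q₁ q₂ q₃ q₄ r₁ r₂ r₃ r₄ =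
      (q₃ * r₄ - q₄ * r₃) • ((p₃ * r₄ - p₄ * r₃) • (z ⊗ₜ x ⊗ₜ y)
          - (p₁ * r₄ - p₂ * r₃) • ((z * x) ⊗ₜ f ⊗ₜ y)
          - (p₃ * r₂ - p₄ * r₁) • (f ⊗ₜ (x * z) ⊗ₜ y) + (p₁ * r₂ - p₂ * r₁) • (x ⊗ₜ z ⊗ₜ y))
      - (q₁ * r₄ - q₂ * r₃) • ((p₃ * r₄ - p₄ * r₃) • (z ⊗ₜ (x * y) ⊗ₜ f)
          - ((p₁ * r₄ - p₂ * r₃) * (q₁ + q₂)) • ((z * x) ⊗ₜ y ⊗ₜ f)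
          - (p₃ * r₂ - p₄ * r₁) • (f ⊗ₜ (x * (z * y)) ⊗ₜ f)
          + (p₁ * r₂ - p₂ * r₁) • (x ⊗ₜ (z * y) ⊗ₜ f)
          + (p₃ * q₄ - p₄ * q₃) • ((z * y) ⊗ₜ x ⊗ₜ f)
          - (p₁ * q₄ - p₂ * q₃) • ((z * (y * x)) ⊗ₜ f ⊗ₜ f)
          - ((p₃ * q₂ - p₄ * q₁) * (r₃ + r₄)) • (z ⊗ₜ (x * y) ⊗ₜ f)
          + (p₁ * q₂ - p₂ * q₁) • ((z * x) ⊗ₜ y ⊗ₜ f))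
      + (q₁ * r₂ - q₂ * r₁) • ((p₃ * q₄ - p₄ * q₃) • (y ⊗ₜ x ⊗ₜ z)
          - (p₁ * q₄ - p₂ * q₃) • ((y * x) ⊗ₜ f ⊗ₜ z)
          - (p₃ * q₂ - p₄ * q₁) • (f ⊗ₜ (x * y) ⊗ₜ z) + (p₁ * q₂ - p₂ * q₁) • (x ⊗ₜ y ⊗ₜ z)) := by
  simp only [homLeft, homInsert, homWedge, mul_add, add_mul, mul_sub, sub_mul, smul_mul_assoc, mul_smul_comm,
    Algebra.TensorProduct.tmul_mul_tmul, mul_one, one_mul, hy, hz', TensorProduct.add_tmul,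
    TensorProduct.sub_tmul, TensorProduct.tmul_smul, ← TensorProduct.smul_tmul', smul_smul,
    mul_assoc]
  module

/-- The cubic term is not additive in the idempotent, and the double wedge measures the defect
between the fused idempotent and its two constituents. Coefficients of equal tensors are compared;
the resulting polynomial identities use that the eigenvalues on each side of an element are
orthogonal idempotent scalars. -/
lemma homLeft_cyclic_sum (f x y z : D) (p₁ p₂ p₃ p₄ q₁ q₂ q₃ q₄ r₁ r₂ r₃ r₄ : k)
    (hx : f * x = (p₁ + p₂) • x) (hx' : x * f = (p₃ + p₄) • x)
    (hy : f * y = (q₁ + q₂) • y) (hy' : y * f = (q₃ + q₄) • y)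
    (hz : f * z = (r₁ + r₂) • z) (hz' : z * f = (r₃ + r₄) • z)
    (hp : p₁ * p₁ = p₁ ∧ p₂ * p₂ = p₂ ∧ p₁ * p₂ = 0) (hp' : p₃ * p₃ = p₃ ∧ p₄ * p₄ = p₄ ∧ p₃ * p₄ = 0)
    (hq : q₁ * q₁ = q₁ ∧ q₂ * q₂ = q₂ ∧ q₁ * q₂ = 0) (hq' : q₃ * q₃ = q₃ ∧ q₄ * q₄ = q₄ ∧ q₃ * q₄ = 0)
    (hr : r₁ * r₁ = r₁ ∧ r₂ * r₂ = r₂ ∧ r₁ * r₂ = 0) (hr' : r₃ * r₃ = r₃ ∧ r₄ * r₄ = r₄ ∧ r₃ * r₄ = 0) :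
    homLeft f x y z p₁ p₂ p₃ p₄ q₁ q₂ q₃ q₄ r₁ r₂ r₃ r₄
      + tau (homLeft f y z x q₁ q₂ q₃ q₄ r₁ r₂ r₃ r₄ p₁ p₂ p₃ p₄)
      + tau (tau (homLeft f z x y r₁ r₂ r₃ r₄ p₁ p₂ p₃ p₄ q₁ q₂ q₃ q₄)) =
    homTerm f x y z (p₁ + p₂) (p₃ + p₄) (q₁ + q₂) (q₃ + q₄) (r₁ + r₂) (r₃ + r₄)
      - homTerm f x y z p₁ p₃ q₁ q₃ r₁ r₃ - homTerm f x y z p₂ p₄ q₂ q₄ r₂ r₄ := by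
  obtain ⟨hp1, hp2, hp3⟩ := hp
  obtain ⟨hp4, hp5, hp6⟩ := hp'
  obtain ⟨hq1, hq2, hq3⟩ := hq
  obtain ⟨hq4, hq5, hq6⟩ := hq'
  obtain ⟨hr1, hr2, hr3⟩ := hr
  obtain ⟨hr4, hr5, hr6⟩ := hr'
  rw [homLeft_expand f x y z _ _ _ _ _ _ _ _ _ _ _ _ hy hz',
    homLeft_expand f y z x _ _ _ _ _ _ _ _ _ _ _ _ hz hx',
    homLeft_expand f z x y _ _ _ _ _ _ _ _ _ _ _ _ hx hy']
  simp only [homTerm, map_add, map_sub, map_smul, tau_tmul]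
  match_scalars
  all_goals first | ring1 | grind

/-- `homWedge` applied to the first factor of a tensor; here `d'` is minus the flip of `d`. -/
def homApply (f x : D) (d d' : D ⊗[k] D) (p₁ p₂ p₃ p₄ q₃ q₄ r₁ r₂ : k) : (D ⊗[k] D) ⊗[k] D :=
  -((p₃ * q₄ - p₄ * q₃) • tau (tau (d' ⊗ₜ x)))
    + (p₁ * q₄ - p₂ * q₃) • tau (tau ((d' * (1 ⊗ₜ x)) ⊗ₜ f))
    - (p₃ * r₂ - p₄ * r₁) • tau (((x ⊗ₜ 1) * d) ⊗ₜ f) + (p₁ * r₂ - p₂ * r₁) • tau (d ⊗ₜ x)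

/-- The mixed terms in the triple bracket of a sum cancel. -/
lemma homApply_add_homInsert_cyclic_sum (f x y z : D) (d₁₂ d₂₁ d₂₃ d₃₂ d₃₁ d₁₃ : D ⊗[k] D)
    (p₁ p₂ p₃ p₄ q₁ q₂ q₃ q₄ r₁ r₂ r₃ r₄ : k) :
    (homApply f x d₂₃ d₃₂ p₁ p₂ p₃ p₄ q₃ q₄ r₁ r₂
        + homInsert f y z d₁₃ d₁₂ q₁ q₂ q₃ q₄ r₁ r₂ r₃ r₄)
      + tau (homApply f y d₃₁ d₁₃ q₁ q₂ q₃ q₄ r₃ r₄ p₁ p₂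
        + homInsert f z x d₂₁ d₂₃ r₁ r₂ r₃ r₄ p₁ p₂ p₃ p₄)
      + tau (tau (homApply f z d₁₂ d₂₁ r₁ r₂ r₃ r₄ p₃ p₄ q₁ q₂
        + homInsert f x y d₃₂ d₃₁ p₁ p₂ p₃ p₄ q₁ q₂ q₃ q₄)) = 0 := by
  simp only [homApply, homInsert, map_add, map_sub, map_neg, map_smul, tau_tau_tau,
    TensorProduct.add_tmul]
  module

end QP

/-! ### Fusion preserves the quasi-Poisson property -/

section FusionQP

variable {k : Type u} [Field k] {ι ι' : Type*} {A D : Type*} [Ring A] [Algebra k A]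
  [Ring D] [Algebra k D] {e : ι → A} {h : ι → D} {π : A →ₗ[k] D}

lemma starMul_euler (H : IsVertexHom e h π) {i j : ι} (hij : h i = h j) (hi : h i * h i = h i)
    (a b : A) :
    starMul (euler e π i a) (euler e π j b) =
      π (b * e j) ⊗ₜ π (a * e i) - (π (b * e j) * π (e i * a)) ⊗ₜ h i
        - h i ⊗ₜ (π (a * e i) * π (e j * b)) + π (e i * a) ⊗ₜ π (e j * b) := by
  have h1 := H.map_right a i
  have h2 := H.map_left a i
  have h3 := H.map_right b j
  have h4 := H.map_left b j
  rw [← hij] at h3 h4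
  simp only [euler_apply, H.map_idem, map_sub, LinearMap.sub_apply, starMul_tmul, ← hij, h1, h2,
    h3, h4, hi]
  abel

lemma wedge_euler (H : IsVertexHom e h π) {i j : ι} (hij : h i = h j) (hi : h i * h i = h i)
    (a b : A) :
    wedge (euler e π i) (euler e π j) a b =
      (π (b * e j) ⊗ₜ π (a * e i) - (π (b * e j) * π (e i * a)) ⊗ₜ h i
        - h i ⊗ₜ (π (a * e i) * π (e j * b)) + π (e i * a) ⊗ₜ π (e j * b)) -
      (π (b * e i) ⊗ₜ π (a * e j) - (π (b * e i) * π (e j * a)) ⊗ₜ h i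
        - h i ⊗ₜ (π (a * e j) * π (e i * b)) + π (e j * a) ⊗ₜ π (e i * b)) := by
  rw [wedge_apply, starMul_euler H hij hi, starMul_euler H hij.symm (hij ▸ hi), hij]

lemma wedge_euler_homogeneous (H : IsVertexHom e h π) {i j : ι} (hij : h i = h j)
    (hi : h i * h i = h i) {a b : A} {p₁ p₂ p₃ p₄ q₁ q₂ q₃ q₄ : k}
    (ha₁ : e i * a = p₁ • a) (ha₂ : e j * a = p₂ • a) (ha₃ : a * e i = p₃ • a)
    (ha₄ : a * e j = p₄ • a) (hb₁ : e i * b = q₁ • b) (hb₂ : e j * b = q₂ • b)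
    (hb₃ : b * e i = q₃ • b) (hb₄ : b * e j = q₄ • b) :
    wedge (euler e π i) (euler e π j) a b =
      homWedge (h i) (π a) (π b) p₁ p₂ p₃ p₄ q₁ q₂ q₃ q₄ := by
  rw [wedge_euler H hij hi]
  simp only [ha₁, ha₂, ha₃, ha₄, hb₁, hb₂, hb₃, hb₄, map_smul, homWedge, smul_mul_smul_comm,
    TensorProduct.tmul_smul, ← TensorProduct.smul_tmul', smul_smul]
  module

lemma tau_map (d : (A ⊗[k] A) ⊗[k] A) :
    tau (TensorProduct.map (TensorProduct.map π π) π d) =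
      TensorProduct.map (TensorProduct.map π π) π (tau d) := by
  have : tau ∘ₗ TensorProduct.map (TensorProduct.map π π) π =
      TensorProduct.map (TensorProduct.map π π) π ∘ₗ tau := by
    ext x y z; simp
  exact LinearMap.congr_fun this d

/-- Applied with d = {{b, c}}: the first leg starts where `c` starts and ends where `b` ends. This
is `hd`, and it fixes the eigenvalues `r₁`, `r₂`, `q₃`, `q₄` of that leg. -/
lemma map_wedge_euler_homogeneous (H : IsVertexHom e h π) {i j : ι} (hij : h i = h j)
    (hi : h i * h i = h i) {a : A} {s t : ι} {p₁ p₂ p₃ p₄ q₃ q₄ r₁ r₂ : k}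
    (ha₁ : e i * a = p₁ • a) (ha₂ : e j * a = p₂ • a) (ha₃ : a * e i = p₃ • a)
    (ha₄ : a * e j = p₄ • a) (ht₃ : e t * e i = q₃ • e t) (ht₄ : e t * e j = q₄ • e t)
    (hs₁ : e i * e s = r₁ • e s) (hs₂ : e j * e s = r₂ • e s) (d : A ⊗[k] A)
    (hd : (e s ⊗ₜ 1) * d * (e t ⊗ₜ 1) = d) :
    TensorProduct.map (wedge (euler e π i) (euler e π j) a) π d =
      homApply (h i) (π a) (TensorProduct.map π π d)
        (TensorProduct.map π π (-Algebra.TensorProduct.comm k A A d)) p₁ p₂ p₃ p₄ q₃ q₄ r₁ r₂ := by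
  rw [← hd]
  generalize d = d₀
  induction d₀ using TensorProduct.induction_on with
  | zero => simp [homApply]
  | add x y hx hy =>
    simp only [mul_add, add_mul, map_add, hx, hy, neg_add]
    simp only [homApply, map_add, mul_add, add_mul, TensorProduct.add_tmul]
    module
  | tmul x y =>
    have hx₁ : e i * (e s * x * e t) = r₁ • (e s * x * e t) := by
      rw [← mul_assoc, ← mul_assoc, hs₁, smul_mul_assoc, smul_mul_assoc]
    have hx₂ : e j * (e s * x * e t) = r₂ • (e s * x * e t) := by
      rw [← mul_assoc, ← mul_assoc, hs₂, smul_mul_assoc, smul_mul_assoc]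
    have hx₃ : (e s * x * e t) * e i = q₃ • (e s * x * e t) := by
      rw [mul_assoc, ht₃, mul_smul_comm]
    have hx₄ : (e s * x * e t) * e j = q₄ • (e s * x * e t) := by
      rw [mul_assoc, ht₄, mul_smul_comm]
    simp only [Algebra.TensorProduct.tmul_mul_tmul, one_mul, mul_one, TensorProduct.map_tmul,
      Algebra.TensorProduct.comm_tmul, map_neg,
      wedge_euler_homogeneous H hij hi ha₁ ha₂ ha₃ ha₄ hx₁ hx₂ hx₃ hx₄]
    generalize π (e s * x * e t) = X
    generalize π y = Y
    generalize π a = Z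
    have h1 : (-(Y ⊗ₜ[k] X)) * ((1 : D) ⊗ₜ[k] Z) = -(Y ⊗ₜ[k] (X * Z)) := by
      rw [← TensorProduct.neg_tmul, Algebra.TensorProduct.tmul_mul_tmul, mul_one,
        TensorProduct.neg_tmul]
    simp only [homWedge, homApply, h1, Algebra.TensorProduct.tmul_mul_tmul, one_mul,
      TensorProduct.neg_tmul, TensorProduct.add_tmul, TensorProduct.sub_tmul, map_neg, tau_tmul,
      ← TensorProduct.smul_tmul']
    module

lemma left_map {β : DoubleBracket k e} {f : ι' → D} {γ : DoubleBracket k f}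
    {w : A →ₗ[k] A →ₗ[k] D ⊗[k] D}
    (hγ : ∀ a b, γ.toFun (π a) (π b) =
      TensorProduct.map π π (β.toFun a b) - (1 / 2 : k) • w a b) (a : A) (d : A ⊗[k] A) :
    γ.left (π a) (TensorProduct.map π π d) =
      TensorProduct.map (TensorProduct.map π π) π (β.left a d)
        - (1 / 2 : k) • TensorProduct.map (w a) π d := by
  induction d using TensorProduct.induction_on with
  | zero => simp
  | add x y hx hy => simp only [map_add, hx, hy, smul_add]; abel
  | tmul x y =>
    rw [TensorProduct.map_tmul, γ.left_tmul, β.left_tmul, TensorProduct.map_tmul,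
      TensorProduct.map_tmul, hγ, TensorProduct.sub_tmul, ← TensorProduct.smul_tmul']

lemma DoubleBracket.left_homWedge {f : ι' → D} (γ : DoubleBracket k f) {f₀ : D}
    (x y z : D) (hf : γ.toFun x f₀ = 0) (q₁ q₂ q₃ q₄ r₁ r₂ r₃ r₄ : k) :
    γ.left x (homWedge f₀ y z q₁ q₂ q₃ q₄ r₁ r₂ r₃ r₄) =
      homInsert f₀ y z (γ.toFun x z) (γ.toFun x y) q₁ q₂ q₃ q₄ r₁ r₂ r₃ r₄ := by
  simp only [homWedge, homInsert, map_add, map_sub, map_smul, γ.left_tmul, γ.leibniz, hf,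
    TensorProduct.zero_tmul, smul_zero, sub_zero]

/-- The idempotents lie in the kernel of the bracket, so the Leibniz rules let them be pulled out of
either argument. -/
lemma DoubleBracket.eq_conj (β : DoubleBracket k e) {a b : A} {s t : ι} (hb : e s * b = b)
    (ha : a * e t = a) : (e s ⊗ₜ 1) * β.toFun a b * (e t ⊗ₜ 1) = β.toFun a b := by
  have h1 : β.toFun a b = (e s ⊗ₜ 1) * β.toFun a b := by
    conv_lhs => rw [← hb, β.leibniz, β.base, zero_mul, zero_add]
  have h2 : ∀ t b, β.toFun (e t) b = 0 := fun t b => by rw [β.antisymm, β.base]; simp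
  have h3 : β.toFun a b = β.toFun a b * (e t ⊗ₜ 1) := by
    conv_lhs => rw [← ha, β.leibniz_left, h2, mul_zero, add_zero]
  rw [← h1, ← h3]

end FusionQP

/-! ### The triple bracket after a fusion, at homogeneous elements. -/

section FusionQP

variable {k : Type u} [Field k]

/-- Eigenvalues of idempotents on homogeneous elements. -/
def kron (k : Type*) [Field k] {ι : Type*} [DecidableEq ι] (s t : ι) : k := if s = t then 1 else 0

section Kron

variable {ι : Type*} [DecidableEq ι] {A : Type*} [Ring A] [Algebra k A] {e : ι → A}

lemma kron_relations {i j : ι} (hij : i ≠ j) (s : ι) :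
    kron k i s * kron k i s = kron k i s ∧ kron k j s * kron k j s = kron k j s ∧
      kron k i s * kron k j s = 0 := by
  unfold kron
  by_cases h1 : i = s
  · subst h1; simp [hij.symm]
  · simp [h1]

lemma idem_mul_idem (he : OrthogonalIdempotents e) (s t : ι) : e s * e t = kron k s t • e t := by
  unfold kron
  split_ifs with h
  · rw [h, (he.idem t).eq, one_smul]
  · rw [he.ortho h, zero_smul]

lemma idem_mul_idem' (he : OrthogonalIdempotents e) (s t : ι) : e t * e s = kron k s t • e t := by
  unfold kron
  split_ifs with h
  · rw [h, (he.idem t).eq, one_smul]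
  · rw [he.ortho (Ne.symm h), zero_smul]

lemma idem_mul_of_left (he : OrthogonalIdempotents e) {s : ι} {a : A} (ha : e s * a = a) (i : ι) :
    e i * a = kron k i s • a := by
  rw [← ha, ← mul_assoc, idem_mul_idem (k := k) he, smul_mul_assoc]

lemma mul_idem_of_right (he : OrthogonalIdempotents e) {s : ι} {a : A} (ha : a * e s = a) (i : ι) :
    a * e i = kron k i s • a := by
  rw [← ha, mul_assoc, idem_mul_idem' (k := k) he, mul_smul_comm]

end Kron

variable {ι ι' : Type*} [Fintype ι'] [DecidableEq ι'] [Fintype ι] [DecidableEq ι]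

/-- The triple bracket at homogeneous generators, in terms of the bracket on `A`. -/
lemma triple_homogeneous [CharZero k] {A D : Type*} [Ring A] [Algebra k A] [Ring D] [Algebra k D] {e : ι → A}
    {f : ι' → D} {c : ι → ι'} {π : A →ₗ[k] D} {β : DoubleBracket k e} {γ : DoubleBracket k f}
    (he : CompleteOrthogonalIdempotents e) (hf : CompleteOrthogonalIdempotents f)
    (H : IsVertexHom e (f ∘ c) π) {i j : ι} (hij : i ≠ j) (hc : c i = c j)
    (hc' : ∀ s, c s = c i → s = i ∨ s = j)
    (hγ : ∀ a b, γ.toFun (π a) (π b) = TensorProduct.map π π (β.toFun a b)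
      - (1 / 2 : k) • wedge (euler e π i) (euler e π j) a b)
    {a₁ a₂ a₃ : A} {s₁ t₁ s₂ t₂ s₃ t₃ : ι} (ha₁ : e s₁ * a₁ = a₁) (ha₁' : a₁ * e t₁ = a₁)
    (ha₂ : e s₂ * a₂ = a₂) (ha₂' : a₂ * e t₂ = a₂) (ha₃ : e s₃ * a₃ = a₃)
    (ha₃' : a₃ * e t₃ = a₃) :
    γ.triple (π a₁) (π a₂) (π a₃) =
      TensorProduct.map (TensorProduct.map π π) π (β.triple a₁ a₂ a₃) +
      (1 / 4 : k) • (qpTerm (f (c i)) (π a₁) (π a₂) (π a₃)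
        - homTerm (f (c i)) (π a₁) (π a₂) (π a₃) (kron k i s₁) (kron k i t₁) (kron k i s₂)
          (kron k i t₂) (kron k i s₃) (kron k i t₃)
        - homTerm (f (c i)) (π a₁) (π a₂) (π a₃) (kron k j s₁) (kron k j t₁) (kron k j s₂)
          (kron k j t₂) (kron k j s₃) (kron k j t₃)) := by
  have ho := he.toOrthogonalIdempotents
  have hii : (f ∘ c) i * (f ∘ c) i = (f ∘ c) i := (hf.idem (c i)).eq
  have hcf : (f ∘ c) i = (f ∘ c) j := congrArg f hc
  have hfilter : (Finset.univ.filter fun s => c s = c i) = {i, j} := by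
    ext s
    simp only [Finset.mem_filter, Finset.mem_univ, true_and, Finset.mem_insert,
      Finset.mem_singleton]
    exact ⟨hc' s, by rintro (rfl | rfl) <;> simp [hc]⟩
  have hL : ∀ {a : A} {s : ι}, e s * a = a →
      (f ∘ c) i * π a = (kron k i s + kron k j s) • π a := by
    intro a s ha
    rw [Function.comp_apply, H.idem_mul_map he hf, hfilter, Finset.sum_pair hij, add_mul,
      idem_mul_of_left (k := k) ho ha, idem_mul_of_left (k := k) ho ha, ← add_smul, map_smul]
  have hR : ∀ {a : A} {s : ι}, a * e s = a →
      π a * (f ∘ c) i = (kron k i s + kron k j s) • π a := by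
    intro a s ha
    rw [Function.comp_apply, H.map_mul_idem he hf, hfilter, Finset.sum_pair hij, mul_add,
      mul_idem_of_right (k := k) ho ha, mul_idem_of_right (k := k) ho ha, ← add_smul, map_smul]
  have hW : ∀ {a b : A} {s t s' t' : ι}, e s * a = a → a * e t = a → e s' * b = b → b * e t' = b →
      wedge (euler e π i) (euler e π j) a b = homWedge ((f ∘ c) i) (π a) (π b) (kron k i s)
        (kron k j s) (kron k i t) (kron k j t) (kron k i s') (kron k j s') (kron k i t')
        (kron k j t') := by
    intro a b s t s' t' h1 h2 h3 h4
    exact wedge_euler_homogeneous H hcf hii (idem_mul_of_left ho h1 i) (idem_mul_of_left ho h1 j)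
      (mul_idem_of_right ho h2 i) (mul_idem_of_right ho h2 j) (idem_mul_of_left ho h3 i)
      (idem_mul_of_left ho h3 j) (mul_idem_of_right ho h4 i) (mul_idem_of_right ho h4 j)
  -- The inner and the outer bracket each split as "induced minus ½ wedge". This gives one purely
  -- induced term, two mixed ones (wedge outside in `homApply`, wedge inside in `homInsert`), and ¼
  -- of a double wedge.
  have hleft : ∀ {a b c' : A} {s t s' t' s'' t'' : ι}, e s * a = a → a * e t = a →
      e s' * b = b → b * e t' = b → e s'' * c' = c' → c' * e t'' = c' →
      γ.left (π a) (γ.toFun (π b) (π c')) =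
        TensorProduct.map (TensorProduct.map π π) π (β.left a (β.toFun b c'))
        - (1 / 2 : k) • (homApply ((f ∘ c) i) (π a) (TensorProduct.map π π (β.toFun b c'))
            (TensorProduct.map π π (β.toFun c' b)) (kron k i s) (kron k j s) (kron k i t)
            (kron k j t) (kron k i t') (kron k j t') (kron k i s'') (kron k j s'') +
          homInsert ((f ∘ c) i) (π b) (π c') (TensorProduct.map π π (β.toFun a c'))
            (TensorProduct.map π π (β.toFun a b)) (kron k i s') (kron k j s') (kron k i t')
            (kron k j t') (kron k i s'') (kron k j s'') (kron k i t'') (kron k j t''))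
        + (1 / 4 : k) • homLeft ((f ∘ c) i) (π a) (π b) (π c') (kron k i s) (kron k j s)
            (kron k i t) (kron k j t) (kron k i s') (kron k j s') (kron k i t') (kron k j t')
            (kron k i s'') (kron k j s'') (kron k i t'') (kron k j t'') := by
    intro a b c' s t s' t' s'' t'' h1 h2 h3 h4 h5 h6
    rw [hγ b c', map_sub, map_smul, left_map hγ, hW h3 h4 h5 h6,
      γ.left_homWedge (f₀ := (f ∘ c) i) (π a) (π b) (π c') (γ.base (π a) (c i)), hγ a c', hγ a b, hW h1 h2 h5 h6,
      hW h1 h2 h3 h4,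
      map_wedge_euler_homogeneous H hcf hii (idem_mul_of_left (k := k) ho h1 i)
        (idem_mul_of_left ho h1 j) (mul_idem_of_right ho h2 i) (mul_idem_of_right ho h2 j)
        (idem_mul_idem' ho i t') (idem_mul_idem' ho j t') (idem_mul_idem ho i s'')
        (idem_mul_idem ho j s'') _ (β.eq_conj h5 h4), ← β.antisymm]
    have lin : ∀ (d d' δ δ' : D ⊗[k] D),
        homInsert ((f ∘ c) i) (π b) (π c') (d - (1 / 2 : k) • δ) (d' - (1 / 2 : k) • δ')
          (kron k i s') (kron k j s') (kron k i t')
          (kron k j t') (kron k i s'') (kron k j s'') (kron k i t'') (kron k j t'') =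
        homInsert ((f ∘ c) i) (π b) (π c') d d' (kron k i s') (kron k j s') (kron k i t')
          (kron k j t') (kron k i s'') (kron k j s'') (kron k i t'') (kron k j t'')
        - (1 / 2 : k) • homInsert ((f ∘ c) i) (π b) (π c') δ δ' (kron k i s') (kron k j s')
          (kron k i t') (kron k j t') (kron k i s'') (kron k j s'') (kron k i t'')
          (kron k j t'') := by
      intro d d' δ δ'
      simp only [homInsert, sub_mul, mul_sub, smul_mul_assoc, mul_smul_comm,
        TensorProduct.add_tmul, TensorProduct.sub_tmul, ← TensorProduct.smul_tmul']
      module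
    rw [lin, homLeft]
    module
  have hpure := homLeft_cyclic_sum ((f ∘ c) i) (π a₁) (π a₂) (π a₃) _ _ _ _ _ _ _ _ _ _ _ _
    (hL ha₁) (hR ha₁') (hL ha₂) (hR ha₂') (hL ha₃) (hR ha₃') (kron_relations hij s₁)
    (kron_relations hij t₁) (kron_relations hij s₂) (kron_relations hij t₂) (kron_relations hij s₃)
    (kron_relations hij t₃)
  rw [← qpTerm_homogeneous ((f ∘ c) i) (π a₁) (π a₂) (π a₃) _ _ _ _ _ _ hii
    (hL ha₁) (hR ha₁') (hL ha₂) (hR ha₂') (hL ha₃) (hR ha₃')] at hpure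
  have hmix := homApply_add_homInsert_cyclic_sum ((f ∘ c) i) (π a₁) (π a₂) (π a₃)
    (TensorProduct.map π π (β.toFun a₁ a₂)) (TensorProduct.map π π (β.toFun a₂ a₁))
    (TensorProduct.map π π (β.toFun a₂ a₃)) (TensorProduct.map π π (β.toFun a₃ a₂))
    (TensorProduct.map π π (β.toFun a₃ a₁)) (TensorProduct.map π π (β.toFun a₁ a₃))
    (kron k i s₁) (kron k j s₁) (kron k i t₁) (kron k j t₁) (kron k i s₂) (kron k j s₂)
    (kron k i t₂) (kron k j t₂) (kron k i s₃) (kron k j s₃) (kron k i t₃) (kron k j t₃)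
  rw [Function.comp_apply] at hpure hmix hleft
  rw [← hpure, DoubleBracket.triple, hleft ha₁ ha₁' ha₂ ha₂' ha₃ ha₃',
    hleft ha₂ ha₂' ha₃ ha₃' ha₁ ha₁', hleft ha₃ ha₃' ha₁ ha₁' ha₂ ha₂', DoubleBracket.triple]
  simp only [map_add, map_sub, map_smul, tau_map, smul_add] at hmix ⊢
  linear_combination (norm := module) (-(1 / 2) : k) • hmix

/-- Fusing two idempotents preserves the quasi-Poisson property. -/
theorem isQuasiPoisson_of_wedge [CharZero k] {A D : Type w} [Ring A] [Algebra k A] [Ring D] [Algebra k D]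
    {e : ι → A} {f : ι' → D} {c : ι → ι'} {π : A →ₗ[k] D} {β : DoubleBracket k e}
    {γ : DoubleBracket k f}
    (he : CompleteOrthogonalIdempotents e) (hf : CompleteOrthogonalIdempotents f)
    (H : IsFused e f c π) {i j : ι} (hij : i ≠ j) (hc : c i = c j)
    (hc' : ∀ s t, c s = c t → s ≠ j → t ≠ j → s = t) (hsurj : Function.Surjective c)
    (hγ : ∀ a b, γ.toFun (π a) (π b) = TensorProduct.map π π (β.toFun a b)
      - (1 / 2 : k) • wedge (euler e π i) (euler e π j) a b) (hβ : β.IsQuasiPoisson) :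
    γ.IsQuasiPoisson := by
  have ho := he.toOrthogonalIdempotents
  refine γ.isQuasiPoisson_of_generators {x | ∃ s t a, e s * a = a ∧ a * e t = a ∧ π a = x} ?_ ?_
  · intro P hP h0 hadd hmul
    refine H.induction P (fun a => ?_) hadd hmul
    have h1 : a = ∑ s, ∑ t, e s * a * e t := by
      simp only [← Finset.mul_sum, he.complete, mul_one, ← Finset.sum_mul, one_mul]
    rw [h1, map_sum]
    refine Finset.sum_induction _ P hadd h0 fun s _ => ?_
    rw [map_sum]
    refine Finset.sum_induction _ P hadd h0 fun t _ => hP _ ⟨s, t, _, ?_, ?_, rfl⟩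
    · rw [← mul_assoc, ← mul_assoc, (he.idem s).eq]
    · rw [mul_assoc, (he.idem t).eq]
  rintro _ ⟨s₁, t₁, a₁, ha₁, ha₁', rfl⟩ _ ⟨s₂, t₂, a₂, ha₂, ha₂', rfl⟩
    _ ⟨s₃, t₃, a₃, ha₃, ha₃', rfl⟩
  have hc'' : ∀ s, c s = c i → s = i ∨ s = j := fun s hs =>
    or_iff_not_imp_right.2 fun hsj => hc' s i hs hsj hij
  -- The image of the cubic term at `e s` has the eigenvalues of `e s`, whereas the cubic term at `f
  -- (c s)` has those of the fused idempotent. They agree for `s ≠ i, j` (`hoth`); at `i` and `j`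
  -- the difference is the correction in `triple_homogeneous`.
  have hπ : ∀ s, TensorProduct.map (TensorProduct.map π π) π (qpTerm (e s) a₁ a₂ a₃) =
      homTerm (f (c s)) (π a₁) (π a₂) (π a₃) (kron k s s₁) (kron k s t₁) (kron k s s₂)
          (kron k s t₂) (kron k s s₃) (kron k s t₃) := by
    intro s
    have hs : π (e s) = f (c s) := H.hom.map_idem s
    simp only [qpTerm, map_add, map_sub, TensorProduct.map_tmul, H.hom.map_mul, hs]
    simp only [
      idem_mul_of_left (k := k) ho ha₁, idem_mul_of_left (k := k) ho ha₂,
      idem_mul_of_left (k := k) ho ha₃, mul_idem_of_right (k := k) ho ha₁',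
      mul_idem_of_right (k := k) ho ha₂', mul_idem_of_right (k := k) ho ha₃', map_smul,
      smul_mul_smul_comm, homTerm, TensorProduct.tmul_smul, ← TensorProduct.smul_tmul', smul_smul]
    module
  have hoth : ∀ s, s ≠ i → s ≠ j → qpTerm (f (c s)) (π a₁) (π a₂) (π a₃) =
      homTerm (f (c s)) (π a₁) (π a₂) (π a₃) (kron k s s₁) (kron k s t₁) (kron k s s₂)
          (kron k s t₂) (kron k s s₃) (kron k s t₃) := by
    intro s hsi hsj
    have hfilter : (Finset.univ.filter fun t => c t = c s) = {s} := by
      ext t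
      simp only [Finset.mem_filter, Finset.mem_univ, true_and, Finset.mem_singleton]
      refine ⟨fun h => ?_, fun h => by rw [h]⟩
      by_cases htj : t = j
      · subst htj
        exact absurd (hc' i s (hc.trans h) hij hsj) (Ne.symm hsi)
      · exact hc' t s h htj hsj
    have hL : ∀ {a : A} {t : ι}, e t * a = a → f (c s) * π a = kron k s t • π a := by
      intro a t ha
      rw [H.hom.idem_mul_map he hf, hfilter, Finset.sum_singleton,
        idem_mul_of_left (k := k) ho ha, map_smul]
    have hR : ∀ {a : A} {t : ι}, a * e t = a → π a * f (c s) = kron k s t • π a := by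
      intro a t ha
      rw [H.hom.map_mul_idem he hf, hfilter, Finset.sum_singleton,
        mul_idem_of_right (k := k) ho ha, map_smul]
    exact qpTerm_homogeneous _ _ _ _ _ _ _ _ _ _ (hf.idem (c s)).eq (hL ha₁) (hR ha₁') (hL ha₂)
      (hR ha₂') (hL ha₃) (hR ha₃')
  -- After removal of `j`, the map `c` is a bijection onto the vertices of the fused algebra.
  have hsum : ∑ r, qpTerm (k := k) (f r) (π a₁) (π a₂) (π a₃) =
      ∑ s ∈ Finset.univ.erase j, qpTerm (f (c s)) (π a₁) (π a₂) (π a₃) := by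
    symm
    refine Finset.sum_bij (fun s _ => c s) (by simp) ?_ ?_ (by simp)
    · intro s hs t ht hst
      exact hc' s t hst (by simpa using hs) (by simpa using ht)
    · intro r _
      obtain ⟨s, rfl⟩ := hsurj r
      by_cases hs : s = j
      · exact ⟨i, by simp [hij], by rw [hs, hc]⟩
      · exact ⟨s, by simp [hs], rfl⟩
  have himem : i ∈ Finset.univ.erase j := by simp [hij]
  rw [DoubleBracket.QPAt, triple_homogeneous he hf H.hom hij hc hc'' hγ ha₁ ha₁' ha₂ ha₂' ha₃ ha₃',
    hsum, (β.isQuasiPoisson_iff.1 hβ a₁ a₂ a₃ : β.triple a₁ a₂ a₃ = _), map_smul, map_sum,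
    ← smul_add]
  congr 1
  rw [← Finset.add_sum_erase _ _ (Finset.mem_univ j), ← Finset.add_sum_erase _ _ himem,
    ← Finset.add_sum_erase _ _ himem, hπ i, hπ j, ← hc]
  have hrest : ∑ s ∈ (Finset.univ.erase j).erase i, TensorProduct.map (TensorProduct.map π π) π
      (qpTerm (e s) a₁ a₂ a₃) = ∑ s ∈ (Finset.univ.erase j).erase i,
        qpTerm (f (c s)) (π a₁) (π a₂) (π a₃) := by
    refine Finset.sum_congr rfl fun s hs => ?_
    simp only [Finset.mem_erase, Finset.mem_univ, and_true] at hs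
    rw [hπ, hoth s hs.1 hs.2]
  rw [hrest]
  abel

end FusionQP

/-! ### Multiplicative elements -/

section Multiplicative

variable {ι ι' : Type*} {k : Type u} [Field k]

/-- The multiplicative property may be checked on generators. -/
lemma isMultiplicativeAt_of_generators {A D : Type w} [Ring A] [Algebra k A] [Ring D] [Algebra k D]
    {e : ι → A} {f : ι' → D} {c : ι → ι'} {π : A →ₗ[k] D} (H : IsFused e f c π)
    (γ : DoubleBracket k f) (r : ι') (φ : D) (hφ : f r * φ * f r = φ)
    (h : ∀ b, γ.toFun φ (π b) = (1 / 2 : k) •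
      ((π b * f r) ⊗ₜ[k] φ - f r ⊗ₜ[k] (φ * π b) + (π b * φ) ⊗ₜ[k] f r
        - φ ⊗ₜ[k] (f r * π b))) :
    γ.IsMultiplicativeAt r φ := by
  refine ⟨hφ, H.induction _ h ?_ ?_⟩
  · intro x y hx hy
    rw [map_add, hx, hy, ← smul_add]
    congr 1
    simp only [add_mul, mul_add, TensorProduct.tmul_add, TensorProduct.add_tmul]
    abel
  · intro x y hx hy
    rw [γ.leibniz, hx, hy, smul_mul_assoc, mul_smul_comm, ← smul_add]
    congr 1
    simp only [mul_sub, sub_mul, add_mul, mul_add, Algebra.TensorProduct.tmul_mul_tmul, one_mul,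
      mul_one, mul_assoc]
    abel

lemma DoubleBracket.IsMultiplicativeAt.mul_idem {A : Type*} [Ring A] [Algebra k A] {e : ι → A}
    {β : DoubleBracket k e} {s : ι} {φ : A} (hφ : β.IsMultiplicativeAt s φ) (hs : e s * e s = e s) :
    φ * e s = φ := by
  conv_lhs => rw [← hφ.1]
  rw [mul_assoc, hs, hφ.1]

lemma DoubleBracket.IsMultiplicativeAt.idem_mul {A : Type*} [Ring A] [Algebra k A] {e : ι → A}
    {β : DoubleBracket k e} {s : ι} {φ : A} (hφ : β.IsMultiplicativeAt s φ) (hs : e s * e s = e s) :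
    e s * φ = φ := by
  conv_lhs => rw [← hφ.1]
  rw [← mul_assoc, ← mul_assoc, hs, hφ.1]

/-- Multiplicative elements for the same idempotent are proportional. -/
lemma DoubleBracket.IsMultiplicativeAt.exists_eq_smul [CharZero k] {A : Type*} [Ring A]
    [Algebra k A] {e : ι → A} {β : DoubleBracket k e} {s : ι} {φ ψ χ : A}
    (hφ : β.IsMultiplicativeAt s φ) (hψ : β.IsMultiplicativeAt s ψ) (hs : e s * e s = e s)
    (hχ : φ * χ = e s) :
    ∃ r : k, ψ = r • φ := by
  by_cases h0 : φ = 0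
  · have : e s = 0 := by rw [← hχ, h0, zero_mul]
    exact ⟨0, by rw [zero_smul, ← hψ.1, this]; simp⟩
  have h1 := hφ.2 ψ
  have h2 := hψ.2 φ
  rw [β.antisymm, h2] at h1
  simp only [hφ.mul_idem hs, hφ.idem_mul hs, hψ.mul_idem hs, hψ.idem_mul hs, map_smul, map_add,
    map_sub, Algebra.TensorProduct.comm_tmul] at h1
  -- Evaluating {{φ, ψ}} by the property of φ, and by that of ψ together with antisymmetry, the
  -- terms containing products of φ and ψ agree. What is left is twice the difference of the two
  -- sides, divided by 2. Symmetry of φ ⊗ ψ with φ ≠ 0 forces proportionality, as a functional not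
  -- vanishing on φ shows.
  have h3 : ψ ⊗ₜ[k] φ = φ ⊗ₜ[k] ψ := by
    linear_combination (norm := module) (-1 : k) • h1
  obtain ⟨ξ, hξ⟩ := Module.Projective.exists_dual_ne_zero k h0
  have h4 := congrArg (TensorProduct.rid k A ∘ TensorProduct.map LinearMap.id ξ) h3
  simp only [Function.comp_apply, TensorProduct.map_tmul, LinearMap.id_apply,
    TensorProduct.rid_tmul] at h4
  refine ⟨(ξ φ)⁻¹ * ξ ψ, ?_⟩
  rw [mul_smul, ← h4, smul_smul, inv_mul_cancel₀ hξ, one_smul]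

namespace IsVertexHom

variable {A D : Type*} [Ring A] [Algebra k A] [Ring D] [Algebra k D] {e : ι → A} {h : ι → D}
  {π : A →ₗ[k] D}

lemma map_mul_of_right (H : IsVertexHom e h π) {a : A} {s : ι}
    (ha : a * e s = a) (b : A) : π (a * b) = π a * π (e s * b) := by
  conv_lhs => rw [← ha, H.map_mul, ha]

lemma map_mul_of_left (H : IsVertexHom e h π) {a : A} {s : ι}
    (ha : e s * a = a) (b : A) : π (b * a) = π (b * e s) * π a := by
  conv_lhs => rw [← ha, ← mul_assoc, H.map_mul, ha]

lemma map_mul_of_idem (H : IsVertexHom e h π) {a b : A} {s : ι} (ha : a * e s = a)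
    (hb : e s * b = b) : π (a * b) = π a * π b := by
  rw [H.map_mul_of_right ha, hb]

end IsVertexHom

/-! ### Components of a moment map after one fusion. -/

section Pair

variable [Fintype ι] [DecidableEq ι] [Fintype ι'] [DecidableEq ι']
    {A D : Type w} [Ring A] [Algebra k A] [Ring D] [Algebra k D]
    {e : ι → A} {f : ι' → D} {c : ι → ι'} {π : A →ₗ[k] D} {β : DoubleBracket k e}
    {γ : DoubleBracket k f}

/-- An element of the corner at `s ≠ i, j` is annihilated by `e i` and `e j` on both sides. The
Euler maps at `i` and `j` vanish on it, and only the induced bracket contributes. -/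
lemma isMultiplicativeAt_map_of_ne (he : CompleteOrthogonalIdempotents e)
    (hf : CompleteOrthogonalIdempotents f) (H : IsFused e f c π) {i j : ι}
    (hγ : ∀ a b, γ.toFun (π a) (π b) = TensorProduct.map π π (β.toFun a b)
      - (1 / 2 : k) • wedge (euler e π i) (euler e π j) a b)
    {s : ι} (hs : ∀ t, c t = c s → t = s) (hsi : s ≠ i) (hsj : s ≠ j) {φ : A}
    (hφ : β.IsMultiplicativeAt s φ) : γ.IsMultiplicativeAt (c s) (π φ) := by
  have hfilter : (Finset.univ.filter fun t => c t = c s) = {s} := by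
    ext t
    simp only [Finset.mem_filter, Finset.mem_univ, true_and, Finset.mem_singleton]
    exact ⟨hs t, fun h => by rw [h]⟩
  have hL : ∀ a, f (c s) * π a = π (e s * a) := fun a => by
    rw [H.hom.idem_mul_map he hf, hfilter, Finset.sum_singleton]
  have hR : ∀ a, π a * f (c s) = π (a * e s) := fun a => by
    rw [H.hom.map_mul_idem he hf, hfilter, Finset.sum_singleton]
  have h1 := hφ.mul_idem (he.idem s).eq
  have h2 := hφ.idem_mul (he.idem s).eq
  have hw : ∀ t, t ≠ s → euler e π t φ = 0 := fun t ht => by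
    have h3 : φ * e t = 0 := by rw [← h1, mul_assoc, he.ortho ht.symm, mul_zero]
    have h4 : e t * φ = 0 := by rw [← h2, ← mul_assoc, he.ortho ht, zero_mul]
    simp [euler_apply, h3, h4]
  have hes : π (e s) = f (c s) := H.hom.map_idem s
  refine isMultiplicativeAt_of_generators H γ _ _ (by rw [hL, hR, h2, h1]) fun b => ?_
  rw [hγ, wedge_apply, hw i hsi.symm, hw j hsj.symm, hφ.2]
  have h5 : π (φ * b) = π φ * π b := by
    rw [H.hom.map_mul_of_right h1, ← hL, ← mul_assoc, hR, h1]
  have h6 : π (b * φ) = π b * π φ := by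
    rw [H.hom.map_mul_of_left h2, ← hR, mul_assoc, hL, h2]
  simp [hL, hR, h5, h6, hes]

/-- By the Leibniz rule the induced bracket of the product is governed by the two multiplicative
properties. The contribution of −½ E_i ∧ E_j then combines the parts at `e i` and `e j` into the
property at the fused idempotent. The order φ, ψ of the factors goes with the order `i`, `j` in the
wedge. -/
lemma isMultiplicativeAt_mul (he : CompleteOrthogonalIdempotents e)
    (hf : CompleteOrthogonalIdempotents f) (H : IsFused e f c π) {i j : ι} (hij : i ≠ j)
    (hc : c i = c j) (hc' : ∀ s, c s = c i → s = i ∨ s = j)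
    (hγ : ∀ a b, γ.toFun (π a) (π b) = TensorProduct.map π π (β.toFun a b)
      - (1 / 2 : k) • wedge (euler e π i) (euler e π j) a b)
    {φ ψ : A} (hφ : β.IsMultiplicativeAt i φ) (hψ : β.IsMultiplicativeAt j ψ) :
    γ.IsMultiplicativeAt (c i) (π φ * π ψ) := by
  have hfilter : (Finset.univ.filter fun s => c s = c i) = {i, j} := by
    ext s
    simp only [Finset.mem_filter, Finset.mem_univ, true_and, Finset.mem_insert,
      Finset.mem_singleton]
    exact ⟨hc' s, by rintro (rfl | rfl) <;> simp [hc]⟩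
  have hL : ∀ a, f (c i) * π a = π (e i * a) + π (e j * a) := fun a => by
    rw [H.hom.idem_mul_map he hf, hfilter, Finset.sum_pair hij, add_mul, map_add]
  have hR : ∀ a, π a * f (c i) = π (a * e i) + π (a * e j) := fun a => by
    rw [H.hom.map_mul_idem he hf, hfilter, Finset.sum_pair hij, mul_add, map_add]
  have hφ1 := hφ.mul_idem (he.idem i).eq
  have hφ2 := hφ.idem_mul (he.idem i).eq
  have hψ1 := hψ.mul_idem (he.idem j).eq
  have hψ2 := hψ.idem_mul (he.idem j).eq
  have hφ3 : φ * e j = 0 := by rw [← hφ1, mul_assoc, he.ortho hij, mul_zero]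
  have hφ4 : e j * φ = 0 := by rw [← hφ2, ← mul_assoc, he.ortho hij.symm, zero_mul]
  have hψ3 : ψ * e i = 0 := by rw [← hψ1, mul_assoc, he.ortho hij.symm, mul_zero]
  have hψ4 : e i * ψ = 0 := by rw [← hψ2, ← mul_assoc, he.ortho hij, zero_mul]
  have hei : π (e i) = f (c i) := H.hom.map_idem i
  have hej : π (e j) = f (c i) := by rw [hc]; exact H.hom.map_idem j
  have hff : (f ∘ c) i * (f ∘ c) i = (f ∘ c) i := (hf.idem (c i)).eq
  have e1 : f (c i) * π φ = π φ := by rw [hL, hφ2, hφ4, map_zero, add_zero]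
  have e2 : π φ * f (c i) = π φ := by rw [hR, hφ1, hφ3, map_zero, add_zero]
  have e3 : f (c i) * π ψ = π ψ := by rw [hL, hψ2, hψ4, map_zero, zero_add]
  have e4 : π ψ * f (c i) = π ψ := by rw [hR, hψ1, hψ3, map_zero, zero_add]
  refine isMultiplicativeAt_of_generators H γ _ _ (by rw [← mul_assoc, e1, mul_assoc, e4])
    fun b => ?_
  have h1 : π φ * π ψ * π b = π φ * π ψ * π (e i * b) + π φ * π ψ * π (e j * b) := by
    conv_lhs => rw [← e4, mul_assoc, mul_assoc, hL]
    simp only [mul_add, mul_assoc]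
  have h2 : π b * (π φ * π ψ) = π (b * e i) * (π φ * π ψ) + π (b * e j) * (π φ * π ψ) := by
    conv_lhs => rw [← e1, ← mul_assoc, ← mul_assoc, hR]
    rw [← add_mul, mul_assoc]
  rw [γ.leibniz_left, hγ, hγ, wedge_euler H.hom (congrArg f hc) hff,
    wedge_euler H.hom (congrArg f hc) hff, hφ.2, hψ.2, h1, h2, hL, hR]
  simp only [map_smul, map_add, map_sub, TensorProduct.map_tmul, H.hom.map_mul_of_right hφ1,
    H.hom.map_mul_of_left hφ2, H.hom.map_mul_of_right hψ1, H.hom.map_mul_of_left hψ2, hφ1, hφ2,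
    hφ3, hφ4, hψ1, hψ2, hψ3, hψ4, hei, hej, Function.comp_apply, map_zero, mul_zero, zero_mul,
    TensorProduct.tmul_zero, TensorProduct.zero_tmul]
  simp only [smul_mul_assoc, mul_smul_comm, add_mul, mul_add, sub_mul, mul_sub,
    Algebra.TensorProduct.tmul_mul_tmul, one_mul, mul_one, mul_assoc, e2, e3,
    TensorProduct.tmul_add, TensorProduct.add_tmul, smul_sub, smul_add, sub_zero, mul_zero,
    add_zero]
  module

end Pair

end Multiplicative

/-! ### Sums over the ordered pairs of entries of a list -/

section PairSum

variable {ι ι' M N : Type*} [AddCommMonoid M] [AddCommMonoid N]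

/-- The sum of `w s t` over all pairs of entries of a list in which `s` precedes `t`. -/
def pairSum (w : ι → ι → M) : List ι → M
  | [] => 0
  | s :: l => (l.map (w s)).sum + pairSum w l

@[simp] lemma pairSum_nil (w : ι → ι → M) : pairSum w [] = 0 := rfl

@[simp] lemma pairSum_cons (w : ι → ι → M) (s : ι) (l : List ι) :
    pairSum w (s :: l) = (l.map (w s)).sum + pairSum w l := rfl

lemma pairSum_append (w : ι → ι → M) (l m : List ι) :
    pairSum w (l ++ m) =
      pairSum w l + pairSum w m + (l.map fun s => (m.map (w s)).sum).sum := by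
  induction l with
  | nil => simp
  | cons s l ih =>
    simp only [List.cons_append, pairSum_cons, ih, List.map_append, List.sum_append,
      List.map_cons, List.sum_cons]
    abel

lemma sum_map_flatMap (w : ι → M) (g : ι' → List ι) (l : List ι') :
    ((l.flatMap g).map w).sum = (l.map fun r => ((g r).map w).sum).sum := by
  induction l with
  | nil => simp
  | cons r l ih => simp [ih]

/-- Pairs from different blocks are collected block by block and pairs inside a block remain. For
chains, the former come from later fusions and the latter from the first one. -/
lemma pairSum_flatMap (w : ι → ι → M) (g : ι' → List ι) (l : List ι') :
    pairSum w (l.flatMap g) =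
      pairSum (fun r r' => ((g r).map fun s => ((g r').map (w s)).sum).sum) l
        + (l.map fun r => pairSum w (g r)).sum := by
  induction l with
  | nil => simp
  | cons r l ih =>
    have h : ((g r).map fun s => ((l.flatMap g).map (w s)).sum).sum =
        (l.map fun r' => ((g r).map fun s => ((g r').map (w s)).sum).sum).sum := by
      simp only [sum_map_flatMap]
      induction g r with
      | nil => simp
      | cons s m ihm => simp only [List.map_cons, List.sum_cons, List.sum_map_add, ihm]
    simp only [List.flatMap_cons, pairSum_append, ih, pairSum_cons, List.map_cons, List.sum_cons, h]
    abel

lemma map_pairSum (φ : M →+ N) (w : ι → ι → M) (l : List ι) :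
    φ (pairSum w l) = pairSum (fun s t => φ (w s t)) l := by
  induction l with
  | nil => simp
  | cons s l ih => simp [ih, map_list_sum, Function.comp_def]

lemma pairSum_congr {w w' : ι → ι → M} (h : ∀ s t, w s t = w' s t) (l : List ι) :
    pairSum w l = pairSum w' l := by
  rw [show w = w' from funext fun s => funext (h s)]

lemma pairSum_eq_zero {w : ι → ι → M} {l : List ι} (h : l.Pairwise fun s t => w s t = 0) :
    pairSum w l = 0 := by
  induction h with
  | nil => rfl
  | @cons s l h _ ih =>
    rw [pairSum_cons, ih, add_zero]
    exact List.sum_eq_zero (by simpa using h)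

/-- Another entry stands on the same side of both neighbours, so only the sums of its weights with
`x` and `y` matter. Hence `w'` has to match `w` merely in these sums, which suits a twist that
changes the Euler derivations at `x` and `y` but not their sum. -/
lemma pairSum_swap {M : Type*} [AddCommGroup M] {w w' : ι → ι → M} {x y : ι} {m l : List ι}
    (hnd : (m ++ x :: y :: l).Nodup)
    (h : ∀ s t, s ≠ x → s ≠ y → t ≠ x → t ≠ y → w' s t = w s t)
    (hl : ∀ s, s ≠ x → s ≠ y → w' s y + w' s x = w s x + w s y)
    (hr : ∀ t, t ≠ x → t ≠ y → w' y t + w' x t = w x t + w y t) :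
    pairSum w' (m ++ y :: x :: l) = pairSum w (m ++ x :: y :: l) + w' y x - w x y := by
  have hm : ∀ s ∈ m, s ≠ x ∧ s ≠ y := by
    rw [List.nodup_append] at hnd
    exact fun s hs => ⟨hnd.2.2 s hs x (by simp), hnd.2.2 s hs y (by simp)⟩
  have hl' : ∀ s ∈ l, s ≠ x ∧ s ≠ y := by
    rw [List.nodup_append] at hnd
    have h1 := hnd.2.1
    simp only [List.nodup_cons, List.mem_cons, not_or] at h1
    exact fun s hs => ⟨fun h => h1.1.2 (h ▸ hs), fun h => h1.2.1 (h ▸ hs)⟩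
  have key : ∀ m : List ι, (∀ s ∈ m, s ≠ x ∧ s ≠ y) → pairSum w' m = pairSum w m := by
    intro m hm
    induction m with
    | nil => rfl
    | cons s m ih =>
      rw [pairSum_cons, pairSum_cons, ih fun t ht => hm t (by simp [ht])]
      congr 2
      refine List.map_congr_left fun t ht => ?_
      have h1 := hm s (by simp)
      have h2 := hm t (by simp [ht])
      exact h s t h1.1 h1.2 h2.1 h2.2
  have cross : (l.map (w' y)).sum + (l.map (w' x)).sum
      = (l.map (w x)).sum + (l.map (w y)).sum := by
    rw [← List.sum_map_add, ← List.sum_map_add]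
    congr 1
    exact List.map_congr_left fun t ht => hr t (hl' t ht).1 (hl' t ht).2
  have cross' : (m.map fun s => ((y :: x :: l).map (w' s)).sum).sum =
      (m.map fun s => ((x :: y :: l).map (w s)).sum).sum := by
    congr 1
    refine List.map_congr_left fun s hs => ?_
    simp only [List.map_cons, List.sum_cons]
    rw [← add_assoc, ← add_assoc, hl s (hm s hs).1 (hm s hs).2]
    congr 2
    exact List.map_congr_left fun t ht => h s t (hm s hs).1 (hm s hs).2 (hl' t ht).1 (hl' t ht).2
  rw [pairSum_append, pairSum_append, cross', key m hm]
  simp only [pairSum_cons, List.map_cons, List.sum_cons, key l hl']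
  rw [← sub_eq_zero] at cross ⊢
  rw [← cross]
  abel

end PairSum

/-! ### Twisting vertex homomorphisms -/

section Twist

variable {ι ι' : Type*} {k : Type u} [Field k]

/-- Elements `v s`, inverse to `w s`, in the corner of the idempotent `e (σ s)`, where `σ s` is
identified with `s` by `c`. -/
structure IsGauge {A : Type*} [Ring A] (e : ι → A) (c : ι → ι') (σ : ι → ι) (v w : ι → A) :
    Prop where
  index : ∀ s, c (σ s) = c s
  idem_mul_v : ∀ s, e (σ s) * v s = v s
  v_mul_idem : ∀ s, v s * e (σ s) = v s
  idem_mul_w : ∀ s, e (σ s) * w s = w s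
  w_mul_idem : ∀ s, w s * e (σ s) = w s
  v_mul_w : ∀ s, v s * w s = e (σ s)
  w_mul_v : ∀ s, w s * v s = e (σ s)
  v_index : ∀ s, v (σ s) = e (σ s)
  w_index : ∀ s, w (σ s) = e (σ s)

lemma IsGauge.symm {A : Type*} [Ring A] {e : ι → A} {c : ι → ι'} {σ : ι → ι} {v w : ι → A}
    (h : IsGauge e c σ v w) : IsGauge e c σ w v :=
  ⟨h.index, h.idem_mul_w, h.w_mul_idem, h.idem_mul_v, h.v_mul_idem, h.w_mul_v, h.v_mul_w,
    h.w_index, h.v_index⟩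

variable [Fintype ι] {A D S : Type*} [Ring A] [Algebra k A] [Ring D] [Algebra k D] [Ring S]
  [Algebra k S] {e : ι → A} {f : ι' → D} {c : ι → ι'} {σ : ι → ι} {v w : ι → A}

/-- The map sending `a ∈ e_s A e_t` to `π (v_s) π (a) π (w_t)`. -/
def twist (e : ι → A) (v w : ι → A) (π : A →ₗ[k] D) : A →ₗ[k] D :=
  ∑ s, ∑ t, LinearMap.mulRight k (π (w t)) ∘ₗ LinearMap.mulLeft k (π (v s)) ∘ₗ π ∘ₗ
    LinearMap.mulRight k (e t) ∘ₗ LinearMap.mulLeft k (e s)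

lemma twist_apply (π : A →ₗ[k] D) (a : A) :
    twist e v w π a = ∑ s, ∑ t, π (v s) * π (e s * a * e t) * π (w t) := by
  simp [twist, LinearMap.sum_apply]

lemma twist_mul_idem (he : CompleteOrthogonalIdempotents e) (π : A →ₗ[k] D) (a : A) (r : ι) :
    twist e v w π (a * e r) = ∑ s, π (v s) * π (e s * a * e r) * π (w r) := by
  classical
  rw [twist_apply]
  refine Finset.sum_congr rfl fun s _ => ?_
  rw [Finset.sum_eq_single r]
  · rw [mul_assoc (e s), mul_assoc a, (he.idem r).eq, mul_assoc (e s)]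
  · intro t _ ht
    rw [mul_assoc (e s), mul_assoc a, he.ortho ht.symm]
    simp
  · simp

lemma twist_idem_mul (he : CompleteOrthogonalIdempotents e) (π : A →ₗ[k] D) (a : A) (r : ι) :
    twist e v w π (e r * a) = ∑ t, π (v r) * π (e r * a * e t) * π (w t) := by
  classical
  rw [twist_apply, Finset.sum_eq_single r]
  · simp only [← mul_assoc, (he.idem r).eq]
  · intro s _ hs
    refine Finset.sum_eq_zero fun t _ => ?_
    rw [← mul_assoc (e s), he.ortho hs]
    simp
  · simp

lemma twist_of_homogeneous (he : CompleteOrthogonalIdempotents e) (π : A →ₗ[k] D) {a : A}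
    {s t : ι} (hs : e s * a = a) (ht : a * e t = a) :
    twist e v w π a = π (v s) * π a * π (w t) := by
  classical
  conv_lhs => rw [← ht]
  rw [twist_mul_idem he, Finset.sum_eq_single s]
  · rw [hs, ht]
  · intro r _ hr
    rw [← hs, ← mul_assoc (e r), he.ortho hr]
    simp
  · simp

lemma IsGauge.map_v_mul_map_w (G : IsGauge e c σ v w) {h : ι' → S} {g : A →ₗ[k] S}
    (H : IsVertexHom e (h ∘ c) g) (s : ι) : g (v s) * g (w s) = h (c s) := by
  rw [← H.map_mul_of_idem (G.v_mul_idem s) (G.idem_mul_w s), G.v_mul_w, H.map_idem,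
    Function.comp_apply, G.index]

lemma IsGauge.map_v_mul_idem (G : IsGauge e c σ v w) {h : ι' → S} {g : A →ₗ[k] S}
    (H : IsVertexHom e (h ∘ c) g) (s : ι) : g (v s) * h (c s) = g (v s) := by
  have := H.map_right (v s) (σ s)
  rwa [Function.comp_apply, G.index, G.v_mul_idem] at this

lemma IsGauge.idem_mul_map_v (G : IsGauge e c σ v w) {h : ι' → S} {g : A →ₗ[k] S}
    (H : IsVertexHom e (h ∘ c) g) (s : ι) : h (c s) * g (v s) = g (v s) := by
  have := H.map_left (v s) (σ s)
  rwa [Function.comp_apply, G.index, G.idem_mul_v] at this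

/-- The gauge is trivial at the vertices `σ s`, where all the elements `v s`, `w s` live. A twist
therefore leaves the gauge elements unchanged, and this is why twisting by the inverse gauge undoes
it. -/
lemma IsGauge.twist_of_corner (he : CompleteOrthogonalIdempotents e) (G : IsGauge e c σ v w)
    {h : ι → S} {g : A →ₗ[k] S} (H : IsVertexHom e h g) {s : ι} {a : A}
    (hl : e (σ s) * a = a) (hr : a * e (σ s) = a) : twist e v w g a = g a := by
  have h1 := H.map_left a (σ s)
  have h2 := H.map_right a (σ s)
  rw [hl] at h1
  rw [hr] at h2
  rw [twist_of_homogeneous he g hl hr, G.v_index, G.w_index, H.map_idem, h1, h2]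

/-- At the vertex `r` where two factors meet, the idempotent can be written as `g (w r) * g (v r)`,
and the two halves complete the twists of the factors. -/
lemma IsGauge.isVertexHom_twist (he : CompleteOrthogonalIdempotents e) (G : IsGauge e c σ v w)
    {h : ι' → S} {g : A →ₗ[k] S} (H : IsVertexHom e (h ∘ c) g) :
    IsVertexHom e (h ∘ c) (twist e v w g) where
  map_mul a b r := by
    rw [twist_mul_idem he, twist_idem_mul he, Finset.sum_mul_sum, twist_apply]
    refine Finset.sum_congr rfl fun s _ => Finset.sum_congr rfl fun t _ => ?_
    have h1 := H.map_right (e s * a) r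
    rw [Function.comp_apply, ← G.symm.map_v_mul_map_w H] at h1
    have h2 : e s * (a * e r * b) * e t = e s * a * e r * (b * e t) := by simp only [mul_assoc]
    rw [h2, H.map_mul]
    conv_lhs => rw [← h1]
    simp only [mul_assoc]
  map_idem s := by
    rw [twist_of_homogeneous he g (he.idem s).eq (he.idem s).eq, H.map_idem, Function.comp_apply,
      G.map_v_mul_idem H, G.map_v_mul_map_w H]

lemma IsGauge.twist_twist (he : CompleteOrthogonalIdempotents e) (G : IsGauge e c σ v w)
    {h : ι' → S} {g : A →ₗ[k] S} (H : IsVertexHom e (h ∘ c) g) (a : A) :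
    twist e v w (twist e w v g) a = g a := by
  have h0 : g a = ∑ s, ∑ t, g (e s * a * e t) := by
    simp only [← map_sum, ← Finset.mul_sum, ← Finset.sum_mul, he.complete, one_mul, mul_one]
  rw [twist_apply, h0]
  refine Finset.sum_congr rfl fun s _ => Finset.sum_congr rfl fun t _ => ?_
  have h1 : e s * (e s * a * e t) = e s * a * e t := by
    rw [mul_assoc, ← mul_assoc, (he.idem s).eq]
  have h2 : e s * a * e t * e t = e s * a * e t := by rw [mul_assoc, (he.idem t).eq]
  have h3 := H.map_left (a * e t) s
  have h4 := H.map_right (e s * a) t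
  rw [← mul_assoc] at h3
  simp only [Function.comp_apply] at h3 h4
  rw [G.symm.twist_of_corner he H (G.idem_mul_v s) (G.v_mul_idem s),
    G.symm.twist_of_corner he H (G.idem_mul_w t) (G.w_mul_idem t), twist_of_homogeneous he g h1 h2, ← mul_assoc,
    ← mul_assoc, G.map_v_mul_map_w H, h3, mul_assoc, G.map_v_mul_map_w H, h4]

lemma IsGauge.map_twist (G : IsGauge e c σ v w)
    {π : A →ₗ[k] D} (H : IsVertexHom e (f ∘ c) π) {h : ι' → S} {g : D →ₗ[k] S}
    (Hg : IsVertexHom f h g) (a : A) :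
    g (twist e v w π a) = twist e v w (g ∘ₗ π) a := by
  simp only [twist_apply, map_sum, LinearMap.comp_apply]
  refine Finset.sum_congr rfl fun s _ => Finset.sum_congr rfl fun t _ => ?_
  have h3 := H.map_left (a * e t) s
  have h4 := H.map_right (e s * a) t
  rw [← mul_assoc] at h3
  simp only [Function.comp_apply] at h3 h4
  rw [Hg.map_mul_of_idem (s := c t) (by rw [mul_assoc, h4]) (G.symm.idem_mul_map_v H t),
    Hg.map_mul_of_idem (s := c s) (G.map_v_mul_idem H s) h3]

/-- The inverse twist expresses the old generators by the new ones, which gives generation. To lift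
`g` along the twist, one lifts the inverse twist of `g` along `π`. -/
lemma IsGauge.isFused_twist {A D : Type w} [Ring A] [Algebra k A] [Ring D] [Algebra k D]
    {e : ι → A} {f : ι' → D} {v w : ι → A}
    (he : CompleteOrthogonalIdempotents e) (G : IsGauge e c σ v w)
    {π : A →ₗ[k] D} (H : IsFused e f c π) : IsFused e f c (twist e v w π) where
  hom := G.isVertexHom_twist he H.hom
  induction P hP hadd hmul := by
    refine H.induction P (fun a => ?_) hadd hmul
    rw [← G.symm.twist_twist he H.hom, twist_apply]
    have h0 : P 0 := by simpa using hP 0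
    exact Finset.sum_induction _ P hadd h0 fun s _ => Finset.sum_induction _ P hadd h0 fun t _ =>
      hmul _ _ (hmul _ _ (hP _) (hP _)) (hP _)
  lift S _ _ h g hg := by
    obtain ⟨g', hg', hgg⟩ := H.lift S h _ (G.symm.isVertexHom_twist he hg)
    refine ⟨g', hg', fun a => ?_⟩
    rw [G.map_twist H.hom hg', show g' ∘ₗ π = twist e w v g from LinearMap.ext hgg,
      G.twist_twist he hg]

end Twist

/-! ### Exchanging two neighbours by a twist -/

section Exchange

variable {k : Type u} [Field k] {ι ι' : Type*}

lemma starMul_tmul_eq {D : Type*} [Ring D] [Algebra k D] (a b : D) (h : D ⊗[k] D) :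
    starMul (a ⊗ₜ b) h = (1 ⊗ₜ a) * h * (b ⊗ₜ 1) := by
  induction h using TensorProduct.induction_on with
  | zero => simp
  | add x y hx hy => simp only [map_add, hx, hy, mul_add, add_mul]
  | tmul x y => simp

lemma starMul_conj_left {D : Type*} [Ring D] [Algebra k D] (a b : D) (h h' : D ⊗[k] D) :
    starMul ((a ⊗ₜ 1) * h * (1 ⊗ₜ b)) h' = (1 ⊗ₜ a) * starMul h h' * (b ⊗ₜ 1) := by
  induction h using TensorProduct.induction_on with
  | zero => simp
  | add x y hx hy => simp only [map_add, LinearMap.add_apply, hx, hy, mul_add, add_mul]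
  | tmul x y =>
    simp only [Algebra.TensorProduct.tmul_mul_tmul, one_mul, mul_one, starMul_tmul_eq]
    rw [← one_mul (1 : D), ← Algebra.TensorProduct.tmul_mul_tmul,
      ← Algebra.TensorProduct.tmul_mul_tmul]
    simp only [mul_assoc, one_mul]

/-- The inner factors of the two arguments meet as `b * a`, which acts trivially on `h'`. So a
conjugation in the inner structure does not change the product. -/
lemma starMul_conj {D : Type*} [Ring D] [Algebra k D] {a b : D} (h h' : D ⊗[k] D)
    (hh : (1 ⊗ₜ (b * a)) * h' = h') (hh' : h' * ((b * a) ⊗ₜ 1) = h') :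
    starMul ((1 ⊗ₜ a) * h * (b ⊗ₜ 1)) ((1 ⊗ₜ a) * h' * (b ⊗ₜ 1)) = starMul h h' := by
  induction h using TensorProduct.induction_on with
  | zero => simp
  | add x y hx hy => simp only [map_add, LinearMap.add_apply, hx, hy, mul_add, add_mul]
  | tmul x y =>
    rw [Algebra.TensorProduct.tmul_mul_tmul, Algebra.TensorProduct.tmul_mul_tmul, one_mul, mul_one,
      starMul_tmul_eq, starMul_tmul_eq]
    conv_rhs => rw [← hh, ← hh']
    have e1 : ∀ a b : D, (1 : D) ⊗ₜ[k] (a * b) = (1 ⊗ₜ a) * (1 ⊗ₜ b) := by simp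
    have e2 : ∀ a b : D, (a * b) ⊗ₜ[k] (1 : D) = (a ⊗ₜ 1) * (b ⊗ₜ 1) := by simp
    simp only [e1, e2, mul_assoc]

lemma DoubleBracket.toFun_idem_left {A : Type*} [Ring A] [Algebra k A] {e : ι → A}
    (β : DoubleBracket k e) (s : ι) (b : A) : β.toFun (e s) b = 0 := by
  rw [β.antisymm, β.base]; simp

/-- The Leibniz rule for `V * α * W`, where `V` and `W` are gauge factors with bracket ½(V h + h V),
respectively minus such an expression. The scalars `r`, `r'` switch these brackets off where the
gauge is trivial. In `toFun_twist` the two summands in `starMul` become E_y(ρ a) and the Euler map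
of ρ at `y`. -/
lemma DoubleBracket.toFun_conj {D : Type*} [Ring D] [Algebra k D] {f : ι' → D}
    (γ : DoubleBracket k f) {V α W d p : D} {h : D ⊗[k] D} {r r' : k}
    (hV : γ.toFun V d = (r / 2) • ((1 ⊗ₜ V) * h + h * (V ⊗ₜ 1)))
    (hW : γ.toFun W d = -((r' / 2) • ((1 ⊗ₜ W) * h + h * (W ⊗ₜ 1))))
    (hp : (1 ⊗ₜ p) * h = h) (hp' : h * (p ⊗ₜ 1) = h) :
    γ.toFun (V * α * W) d = (1 ⊗ₜ V) * γ.toFun α d * (W ⊗ₜ 1) - (1 / 2 : k) •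
      starMul ((r' • (V * α) ⊗ₜ W - r • V ⊗ₜ (α * W))
        + (r' • (V * α * W) ⊗ₜ p - r • p ⊗ₜ (V * α * W))) h := by
  have e1 : ∀ a b : D, (1 : D) ⊗ₜ[k] (a * b) = (1 ⊗ₜ a) * (1 ⊗ₜ b) := by simp
  have e2 : ∀ a b : D, (a * b) ⊗ₜ[k] (1 : D) = (a ⊗ₜ 1) * (b ⊗ₜ 1) := by simp
  rw [γ.leibniz_left, γ.leibniz_left, hV, hW]
  simp only [map_add, map_sub, map_smul, LinearMap.add_apply, LinearMap.sub_apply,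
    LinearMap.smul_apply, starMul_tmul_eq, mul_assoc, hp']
  rw [← mul_assoc ((1 : D) ⊗ₜ[k] p), hp, mul_neg]
  simp only [e1, e2, mul_add, add_mul, smul_mul_assoc, mul_smul_comm, mul_assoc, smul_add]
  module

lemma IsFused.der_ext {A D : Type w} [Ring A] [Algebra k A] [Ring D] [Algebra k D]
    {e : ι → A} {f : ι' → D} {c : ι → ι'} {π : A →ₗ[k] D} (H : IsFused e f c π)
    {E E' : D →ₗ[k] D ⊗[k] D} (hE : ∀ x y, E (x * y) = E x * (1 ⊗ₜ y) + (x ⊗ₜ 1) * E y)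
    (hE' : ∀ x y, E' (x * y) = E' x * (1 ⊗ₜ y) + (x ⊗ₜ 1) * E' y)
    (h : ∀ a, E (π a) = E' (π a)) (x : D) : E x = E' x :=
  H.induction (fun x => E x = E' x) h (fun x y hx hy => by rw [map_add, map_add, hx, hy])
    (fun x y hx hy => by rw [hE, hE', hx, hy]) x

variable [Fintype ι] [Fintype ι']

/-- The Euler maps of `π` have to be evaluated on twisted generators, which need not lie in the
image of `π`; hence the extension to all of the fused algebra. -/
lemma IsFused.exists_euler {A D : Type w} [Ring A] [Algebra k A] [Ring D] [Algebra k D]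
    {e : ι → A} {f : ι' → D} {c : ι → ι'} {π : A →ₗ[k] D} (H : IsFused e f c π)
    (he : CompleteOrthogonalIdempotents e) (hf : CompleteOrthogonalIdempotents f) (s : ι) :
    ∃ E : D →ₗ[k] D ⊗[k] D, (∀ x y, E (x * y) = E x * (1 ⊗ₜ y) + (x ⊗ₜ 1) * E y) ∧
      ∀ a, E (π a) = euler e π s a := by
  classical
  have h0 : ∀ r, euler e π s (e r) = 0 := by
    intro r
    rw [euler_apply]
    by_cases h : r = s
    · rw [h, (he.idem s).eq, sub_self]
    · rw [he.ortho h, he.ortho (Ne.symm h)]; simp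
  refine H.exists_der hf Algebra.TensorProduct.includeLeft Algebra.TensorProduct.includeRight
    (euler e π s) (fun a b r => ?_) h0
  simp only [euler_apply, Algebra.TensorProduct.includeLeft_apply,
    Algebra.TensorProduct.includeRight_apply, sub_mul, mul_sub,
    Algebra.TensorProduct.tmul_mul_tmul, one_mul, mul_one]
  have h1 : π (a * e r * b * e s) = π (a * e r) * π (e r * b * e s) := by
    rw [mul_assoc, H.hom.map_mul, mul_assoc]
  have h2 : π (e s * (a * e r * b)) = π (e s * (a * e r)) * π (e r * b) := by
    rw [← mul_assoc, ← mul_assoc, H.hom.map_mul, mul_assoc]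
  -- The middle terms of the Leibniz rule cancel: they vanish for `r ≠ s`, and for `r = s` the
  -- idempotents are absorbed.
  have h3 : π (a * e r * e s) ⊗ₜ[k] (π (e s) * π (e r * b)) =
      (π (a * e r) * π (e s)) ⊗ₜ π (e s * (e r * b)) := by
    by_cases h : r = s
    · subst h
      rw [mul_assoc, (he.idem r).eq, ← mul_assoc (e r), (he.idem r).eq, H.hom.map_idem,
        H.hom.map_left, H.hom.map_right]
    · rw [mul_assoc, he.ortho h, ← mul_assoc (e s), he.ortho (Ne.symm h)]
      simp
  rw [h1, h2, h3]
  abel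

end Exchange

/-! ### Euler derivations on twisted generators. -/

section Exchange

variable {k : Type u} [Field k] {ι ι' : Type*} [Fintype ι] [DecidableEq ι]

lemma linearMap_ext_homogeneous {A X : Type*} [Ring A] [Algebra k A] [AddCommGroup X] [Module k X]
    {e : ι → A} (he : CompleteOrthogonalIdempotents e) {g g' : A →ₗ[k] X}
    (h : ∀ s t a, e s * a = a → a * e t = a → g a = g' a) (a : A) : g a = g' a := by
  have h0 : a = ∑ s, ∑ t, e s * a * e t := by
    simp only [← Finset.mul_sum, ← Finset.sum_mul, he.complete, one_mul, mul_one]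
  rw [h0]
  simp only [map_sum]
  refine Finset.sum_congr rfl fun s _ => Finset.sum_congr rfl fun t _ => h s t _ ?_ ?_
  · rw [mul_assoc, ← mul_assoc, (he.idem s).eq]
  · rw [mul_assoc, (he.idem t).eq]

section Gauge

variable {A : Type*} [Ring A] {e : ι → A} {c : ι → ι'} {x y : ι} {Φ Ψ : A}

lemma isGauge_update (hxy : x ≠ y) (hc : c x = c y) (he : OrthogonalIdempotents e)
    (h1 : e x * Φ = Φ) (h2 : Φ * e x = Φ) (h3 : e x * Ψ = Ψ) (h4 : Ψ * e x = Ψ)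
    (h5 : Φ * Ψ = e x) (h6 : Ψ * Φ = e x) :
    IsGauge e c (Function.update id y x) (Function.update e y Φ) (Function.update e y Ψ) := by
  constructor <;> intro s <;> by_cases hs : s = y
  all_goals first | subst hs | skip
  all_goals simp [*, (he.idem _).eq]

end Gauge

variable [Fintype ι'] [DecidableEq ι'] {A D : Type w} [Ring A] [Algebra k A] [Ring D] [Algebra k D]
  {e : ι → A} {f : ι' → D} {c : ι → ι'} {π : A →ₗ[k] D} {x y : ι} {Φ Ψ : A}

lemma euler_of_homogeneous {h : ι → D} {ρ : A →ₗ[k] D} (hρ : IsVertexHom e h ρ)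
    (he : OrthogonalIdempotents e) {s t : ι} {a : A} (hs : e s * a = a) (ht : a * e t = a) (r : ι) :
    euler e ρ r a = kron k r t • ρ a ⊗ₜ h r - kron k r s • h r ⊗ₜ ρ a := by
  rw [euler_apply, idem_mul_of_left (k := k) he hs, mul_idem_of_right (k := k) he ht, map_smul,
    map_smul, hρ.map_idem, TensorProduct.smul_tmul', TensorProduct.tmul_smul]

/-- The values of the extended Euler derivations on the image of a twist. -/
lemma euler_twist (hxy : x ≠ y) (hc : c x = c y) (he : CompleteOrthogonalIdempotents e)
    (hf : CompleteOrthogonalIdempotents f) (H : IsFused e f c π)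
    (G : IsGauge e c (Function.update id y x) (Function.update e y Φ) (Function.update e y Ψ))
    (h1 : e x * Φ = Φ) (h2 : Φ * e x = Φ) (h3 : e x * Ψ = Ψ) (h4 : Ψ * e x = Ψ)
    {E : ι → D →ₗ[k] D ⊗[k] D}
    (hE : ∀ s x y, E s (x * y) = E s x * (1 ⊗ₜ y) + (x ⊗ₜ 1) * E s y)
    (hEπ : ∀ s a, E s (π a) = euler e π s a) {s t : ι} {a : A} (hs : e s * a = a)
    (ht : a * e t = a) {V W : D} (hV : V = π (Function.update e y Φ s))
    (hW : W = π (Function.update e y Ψ t)) {ρ : A →ₗ[k] D}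
    (hρ : ρ = twist e (Function.update e y Φ) (Function.update e y Ψ) π) :
    (∀ r, r ≠ x → r ≠ y → E r (ρ a) = euler e ρ r a) ∧
    E x (ρ a) + E y (ρ a) = euler e ρ x a + euler e ρ y a ∧
    E y (ρ a) = kron k y t • (V * π a) ⊗ₜ W - kron k y s • V ⊗ₜ (π a * W) ∧
    (V ⊗ₜ 1) * euler e π x a * (1 ⊗ₜ W) = euler e ρ x a ∧
    euler e ρ y a = kron k y t • (V * π a * W) ⊗ₜ f (c x) - kron k y s • f (c x) ⊗ₜ (V * π a * W) ∧
    euler e ρ y a = (1 ⊗ₜ π Φ) * E y (ρ a) * (π Ψ ⊗ₜ 1) ∧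
    E y (ρ a) * (f (c x) ⊗ₜ 1) = E y (ρ a) ∧ (1 ⊗ₜ f (c x)) * E y (ρ a) = E y (ρ a) := by
  have ho := he.toOrthogonalIdempotents
  have hpy : f (c y) = f (c x) := by rw [hc]
  have hpp := (hf.idem (c x)).eq
  have hρv := G.isVertexHom_twist he H.hom
  rw [← hρ] at hρv
  have hρa : ρ a = V * π a * W := by rw [hρ, twist_of_homogeneous he π hs ht, hV, hW]
  have hl := H.hom.map_left a s
  have hr := H.hom.map_right a t
  rw [hs, Function.comp_apply] at hl
  rw [ht, Function.comp_apply] at hr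
  have hVne : s ≠ y → V = f (c s) := fun h => by
    rw [hV, Function.update_of_ne h, H.hom.map_idem, Function.comp_apply]
  have hWne : t ≠ y → W = f (c t) := fun h => by
    rw [hW, Function.update_of_ne h, H.hom.map_idem, Function.comp_apply]
  have hVy : s = y → V = π Φ := fun h => by rw [hV, h, Function.update_self]
  have hWy : t = y → W = π Ψ := fun h => by rw [hW, h, Function.update_self]
  have hΦl : f (c x) * π Φ = π Φ := by
    have := H.hom.map_left Φ x
    rwa [h1] at this
  have hΦr : π Φ * f (c x) = π Φ := by
    have := H.hom.map_right Φ x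
    rwa [h2] at this
  have hΨl : f (c x) * π Ψ = π Ψ := by
    have := H.hom.map_left Ψ x
    rwa [h3] at this
  have hΨr : π Ψ * f (c x) = π Ψ := by
    have := H.hom.map_right Ψ x
    rwa [h4] at this
  have hUU : π Φ * π Ψ = f (c x) := by
    have := G.map_v_mul_map_w H.hom y
    rwa [Function.update_self, Function.update_self, hpy] at this
  have hEV : ∀ r, E r V = kron k y s • kron k r x • (V ⊗ₜ f (c x) - f (c x) ⊗ₜ V) := by
    intro r
    rw [hV, hEπ]
    by_cases h : s = y
    · rw [h, Function.update_self, euler_of_homogeneous H.hom ho h1 h2, ← smul_sub]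
      unfold kron
      by_cases hrx : r = x
      · simp [hrx]
      · simp [hrx]
    · rw [Function.update_of_ne h, euler_of_homogeneous H.hom ho (ho.idem s).eq (ho.idem s).eq,
        H.hom.map_idem]
      unfold kron
      by_cases hrs : r = s
      · simp [hrs, Ne.symm h]
      · simp [hrs, Ne.symm h]
  -- As for `V`: the gauge factor is either an idempotent, killed by every Euler derivation, or
  -- comes from the corner at `x`, where only the derivation at `x` sees it.
  have hEW : ∀ r, E r W = kron k y t • kron k r x • (W ⊗ₜ f (c x) - f (c x) ⊗ₜ W) := by
    intro r
    rw [hW, hEπ]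
    by_cases h : t = y
    · rw [h, Function.update_self, euler_of_homogeneous H.hom ho h3 h4, ← smul_sub]
      unfold kron
      by_cases hrx : r = x
      · simp [hrx]
      · simp [hrx]
    · rw [Function.update_of_ne h, euler_of_homogeneous H.hom ho (ho.idem t).eq (ho.idem t).eq,
        H.hom.map_idem]
      unfold kron
      by_cases hrs : r = t
      · simp [hrs, Ne.symm h]
      · simp [hrs, Ne.symm h]
  have hEρ : ∀ r, E r (ρ a) = E r V * (1 ⊗ₜ (π a * W))
      + (V ⊗ₜ 1) * euler e π r a * (1 ⊗ₜ W) + ((V * π a) ⊗ₜ 1) * E r W := by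
    intro r
    rw [hρa, hE, hE, hEπ, add_mul, mul_assoc (E r V), Algebra.TensorProduct.tmul_mul_tmul, one_mul]
  have hG : ∀ r, r ≠ y → (V ⊗ₜ 1) * euler e π r a * (1 ⊗ₜ W) = euler e ρ r a := by
    intro r hry
    rw [euler_of_homogeneous H.hom ho hs ht, euler_of_homogeneous hρv ho hs ht, hρa]
    simp only [mul_sub, sub_mul, mul_smul_comm, smul_mul_assoc,
      Algebra.TensorProduct.tmul_mul_tmul, one_mul, mul_one, Function.comp_apply]
    congr 1
    · unfold kron
      split_ifs with h
      · subst h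
        rw [hWne hry, (hf.idem _).eq, mul_assoc, hr]
      · simp
    · unfold kron
      split_ifs with h
      · subst h
        rw [hVne hry, (hf.idem _).eq, hl]
      · simp
  have hy : E y (ρ a) = kron k y t • (V * π a) ⊗ₜ W - kron k y s • V ⊗ₜ (π a * W) := by
    have h0 : kron k y x = 0 := if_neg (Ne.symm hxy)
    rw [hEρ, hEV, hEW, h0, euler_of_homogeneous H.hom ho hs ht]
    simp only [mul_sub, sub_mul, mul_smul_comm, smul_mul_assoc, zero_smul, smul_zero, zero_mul,
      mul_zero, zero_add, add_zero, Algebra.TensorProduct.tmul_mul_tmul, one_mul, mul_one,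
      Function.comp_apply]
    congr 1
    · unfold kron
      split_ifs with h
      · rw [hWy h.symm, hpy, hΨl]
      · simp
    · unfold kron
      split_ifs with h
      · rw [hVy h.symm, hpy, hΦr]
      · simp
  -- From here on only the question whether `s` and `t` equal `y` matters, so the remaining claims
  -- reduce to at most four cases.
  have hty : kron k y t = 0 ∨ kron k y t = 1 ∧ W = π Ψ ∧ π a * f (c x) = π a := by
    unfold kron
    split_ifs with h
    · exact .inr ⟨rfl, hWy h.symm, by rw [← h, hpy] at hr; exact hr⟩
    · exact .inl rfl
  have hsy : kron k y s = 0 ∨ kron k y s = 1 ∧ V = π Φ ∧ f (c x) * π a = π a := by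
    unfold kron
    split_ifs with h
    · exact .inr ⟨rfl, hVy h.symm, by rw [← h, hpy] at hl; exact hl⟩
    · exact .inl rfl
  have hρy : euler e ρ y a = kron k y t • (V * π a * W) ⊗ₜ f (c x)
      - kron k y s • f (c x) ⊗ₜ (V * π a * W) := by
    rw [euler_of_homogeneous hρv ho hs ht, hρa, Function.comp_apply, hpy]
  refine ⟨fun r hrx hry => ?_, ?_, hy, hG x hxy, hρy, ?_, ?_, ?_⟩
  · have h0 : kron k r x = 0 := if_neg hrx
    rw [hEρ, hEV, hEW, hG r hry, h0]
    simp only [zero_smul, smul_zero, zero_mul, mul_zero, zero_add, add_zero]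
  · have h0 : kron k x x = 1 := if_pos rfl
    rw [hEρ x, hEV, hEW, hG x hxy, h0, hy, hρy]
    rcases hty with h | ⟨h, hW', hr'⟩ <;> rcases hsy with h' | ⟨h', hV', hl'⟩
    all_goals
      simp only [h, h', zero_smul, one_smul, mul_sub, sub_mul, zero_mul, mul_zero,
        Algebra.TensorProduct.tmul_mul_tmul, one_mul, mul_one, mul_assoc]
      first | rw [← mul_assoc (f (c x)), hl'] | skip
      first | rw [hr'] | skip
      abel
  · rw [hy, hρy]
    rcases hty with h | ⟨h, hW', hr'⟩ <;> rcases hsy with h' | ⟨h', hV', hl'⟩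
    all_goals
      simp only [h, h', zero_smul, one_smul, mul_sub, sub_mul, zero_mul, mul_zero,
        Algebra.TensorProduct.tmul_mul_tmul, one_mul, mul_one, mul_assoc]
    · rw [hV', hUU]
    · rw [hW', hUU]
    · rw [hV', hW', hUU]
  · rw [hy]
    rcases hty with h | ⟨h, hW', hr'⟩ <;> rcases hsy with h' | ⟨h', hV', hl'⟩
    all_goals
      simp only [h, h', zero_smul, one_smul, sub_mul, zero_mul,
        Algebra.TensorProduct.tmul_mul_tmul, mul_one, mul_assoc]
    · rw [hV', hΦr]
    · rw [hr']
    · rw [hr', hV', hΦr]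
  · rw [hy]
    rcases hty with h | ⟨h, hW', hr'⟩ <;> rcases hsy with h' | ⟨h', hV', hl'⟩
    all_goals
      simp only [h, h', zero_smul, one_smul, mul_sub, mul_zero,
        Algebra.TensorProduct.tmul_mul_tmul, one_mul]
    · rw [← mul_assoc, hl']
    · rw [hW', hΨl]
    · rw [← mul_assoc, hl', hW', hΨl]

end Exchange

/-! ### The bracket on twisted generators. -/

section Exchange

variable {k : Type u} [Field k] {ι ι' : Type*}

lemma DoubleBracket.eq_idem_mul_mul_idem {A : Type*} [Ring A] [Algebra k A] {e : ι → A}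
    (β : DoubleBracket k e) {a b : A} {s t s' t' : ι} (hs : e s * a = a) (ht : a * e t = a)
    (hs' : e s' * b = b) (ht' : b * e t' = b) :
    (e s' ⊗ₜ e s) * β.toFun a b * (e t ⊗ₜ e t') = β.toFun a b := by
  have h1 : (1 ⊗ₜ e s) * β.toFun a b = β.toFun a b := by
    conv_rhs => rw [← hs, β.leibniz_left, β.toFun_idem_left, zero_mul, zero_add]
  have h2 : β.toFun a b * (1 ⊗ₜ e t') = β.toFun a b := by
    conv_rhs => rw [← ht', β.leibniz, β.base, mul_zero, add_zero]
  have h3 : (e s' : A) ⊗ₜ[k] e s = (e s' ⊗ₜ 1) * (1 ⊗ₜ e s) := by simp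
  have h4 : (e t : A) ⊗ₜ[k] e t' = (1 ⊗ₜ e t') * (e t ⊗ₜ 1) := by simp
  rw [h3, h4, mul_assoc _ _ (β.toFun a b), h1, ← mul_assoc, mul_assoc _ (β.toFun a b), h2,
    β.eq_conj hs' ht]

variable [Fintype ι]

lemma map_twist_homogeneous {A D : Type*} [Ring A] [Algebra k A] [Ring D] [Algebra k D]
    {e v w : ι → A} (he : CompleteOrthogonalIdempotents e) (π : A →ₗ[k] D) (s t s' t' : ι)
    (d : A ⊗[k] A) (hd : (e s' ⊗ₜ e s) * d * (e t ⊗ₜ e t') = d) :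
    TensorProduct.map (twist e v w π) (twist e v w π) d =
      (π (v s') ⊗ₜ π (v s)) * TensorProduct.map π π d * (π (w t) ⊗ₜ π (w t')) := by
  rw [← hd]
  clear hd
  have h : ∀ a s t, twist e v w π (e s * a * e t) = π (v s) * π (e s * a * e t) * π (w t) :=
    fun a s t => twist_of_homogeneous he π (by rw [mul_assoc, ← mul_assoc, (he.idem s).eq])
      (by rw [mul_assoc, (he.idem t).eq])
  induction d using TensorProduct.induction_on with
  | zero => simp
  | add x y hx hy => simp only [mul_add, add_mul, map_add, hx, hy]
  | tmul a b => simp only [Algebra.TensorProduct.tmul_mul_tmul, TensorProduct.map_tmul, h]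

variable [DecidableEq ι] [Fintype ι'] [DecidableEq ι'] {A D : Type w} [Ring A] [Algebra k A]
  [Ring D] [Algebra k D] {e : ι → A} {f : ι' → D} {c : ι → ι'} {π : A →ₗ[k] D} {x y : ι} {Φ Ψ : A}
  {β : DoubleBracket k e}

/-- The four terms of the multiplicative property are the inner products of Φ with the Euler
derivation at `x`, from the left and from the right. Both sides are double derivations in `d`, so
the formula extends from generators. -/
lemma IsFused.toFun_multiplicative (H : IsFused e f c π)
    (he : CompleteOrthogonalIdempotents e)
    (hΦ : β.IsMultiplicativeAt x Φ) {γ : DoubleBracket k f}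
    (hγ : ∀ a b, γ.toFun (π a) (π b) = TensorProduct.map π π (β.toFun a b))
    {E : D →ₗ[k] D ⊗[k] D} (hE : ∀ x y, E (x * y) = E x * (1 ⊗ₜ y) + (x ⊗ₜ 1) * E y)
    (hEπ : ∀ a, E (π a) = euler e π x a) (d : D) :
    γ.toFun (π Φ) d = (1 / 2 : k) • ((1 ⊗ₜ π Φ) * E d + E d * (π Φ ⊗ₜ 1)) := by
  have h2 := hΦ.mul_idem (he.idem x).eq
  have h1 := hΦ.idem_mul (he.idem x).eq
  refine H.der_ext (E := γ.toFun (π Φ)) (E' := (1 / 2 : k) • (LinearMap.mulLeft k (1 ⊗ₜ π Φ) ∘ₗ E +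
    LinearMap.mulRight k (π Φ ⊗ₜ 1) ∘ₗ E)) (γ.leibniz _) (fun y z => ?_) (fun b => ?_) d
  · simp only [LinearMap.smul_apply, LinearMap.add_apply, LinearMap.comp_apply,
      LinearMap.mulLeft_apply, LinearMap.mulRight_apply, hE, mul_add, add_mul,
      Ext.inner_outer_left, Ext.inner_outer_right, smul_mul_assoc, mul_smul_comm]
    simp only [mul_assoc]
    module
  · have h3 : π (Φ * b) = π Φ * π (e x * b) := H.hom.map_mul_of_right h2 b
    have h4 : π (b * Φ) = π (b * e x) * π Φ := H.hom.map_mul_of_left h1 b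
    have h5 : π Φ * π (e x) = π Φ := by rw [← H.hom.map_mul_of_idem h2 (he.idem x).eq, h2]
    have h6 : π (e x) * π Φ = π Φ := by rw [← H.hom.map_mul_of_idem (he.idem x).eq h1, h1]
    rw [hγ, hΦ.2]
    simp only [LinearMap.smul_apply, LinearMap.add_apply, LinearMap.comp_apply,
      LinearMap.mulLeft_apply, LinearMap.mulRight_apply, hEπ, euler_apply, map_smul, map_add,
      map_sub, TensorProduct.map_tmul, mul_sub, sub_mul, Algebra.TensorProduct.tmul_mul_tmul,
      one_mul, mul_one, h3, h4, h5, h6]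
    module

/-- The product ΦΨ is an idempotent of the base and has zero bracket; the Leibniz rule can then be
solved for the bracket of Ψ. -/
lemma IsFused.toFun_multiplicative_inv (H : IsFused e f c π)
    (he : CompleteOrthogonalIdempotents e)
    (hΦ : β.IsMultiplicativeAt x Φ) (hΨ : e x * Ψ * e x = Ψ) (hΦΨ : Φ * Ψ = e x)
    (hΨΦ : Ψ * Φ = e x) {γ : DoubleBracket k f}
    (hγ : ∀ a b, γ.toFun (π a) (π b) = TensorProduct.map π π (β.toFun a b))
    {E : D →ₗ[k] D ⊗[k] D} (hE : ∀ x y, E (x * y) = E x * (1 ⊗ₜ y) + (x ⊗ₜ 1) * E y)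
    (hEπ : ∀ a, E (π a) = euler e π x a)
    (hpE : ∀ d, (1 ⊗ₜ f (c x)) * E d = E d) (hEp : ∀ d, E d * (f (c x) ⊗ₜ 1) = E d) (d : D) :
    γ.toFun (π Ψ) d = -((1 / 2 : k) • ((1 ⊗ₜ π Ψ) * E d + E d * (π Ψ ⊗ₜ 1))) := by
  have h2 := hΦ.mul_idem (he.idem x).eq
  have h1 := hΦ.idem_mul (he.idem x).eq
  have h3 : e x * Ψ = Ψ := by rw [← hΨ, ← mul_assoc, ← mul_assoc, (he.idem x).eq]
  have h4 : Ψ * e x = Ψ := by rw [← hΨ, mul_assoc, (he.idem x).eq]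
  have hx : π (e x) = f (c x) := H.hom.map_idem x
  have hU : π Φ * π Ψ = f (c x) := by rw [← H.hom.map_mul_of_idem h2 h3, hΦΨ, hx]
  have hU' : π Ψ * π Φ = f (c x) := by rw [← H.hom.map_mul_of_idem h4 h1, hΨΦ, hx]
  have hpΨ : f (c x) * π Ψ = π Ψ := by rw [← hx, ← H.hom.map_mul_of_idem (he.idem x).eq h3, h3]
  have e1 : γ.toFun (π Φ) d * (π Ψ ⊗ₜ 1) + (1 ⊗ₜ π Φ) * γ.toFun (π Ψ) d = 0 := by
    rw [← γ.leibniz_left, hU, γ.toFun_idem_left]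
  have e2 : γ.toFun (π Ψ) d = (1 ⊗ₜ f (c x)) * γ.toFun (π Ψ) d := by
    conv_lhs => rw [← hpΨ, γ.leibniz_left, γ.toFun_idem_left, zero_mul, zero_add]
  have e3 : (1 : D) ⊗ₜ[k] f (c x) = (1 ⊗ₜ π Ψ) * (1 ⊗ₜ π Φ) := by simp [hU']
  have e4 : ((1 : D) ⊗ₜ[k] π Ψ) * (1 ⊗ₜ π Φ) = 1 ⊗ₜ f (c x) := by simp [hU']
  have e5 : (π Φ ⊗ₜ[k] (1 : D)) * (π Ψ ⊗ₜ 1) = f (c x) ⊗ₜ 1 := by simp [hU]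
  rw [e2, e3, mul_assoc, eq_neg_of_add_eq_zero_right e1,
    H.toFun_multiplicative he hΦ hγ hE hEπ, mul_neg]
  congr 1
  simp only [smul_mul_assoc, mul_smul_comm, add_mul, mul_add, mul_assoc, e5, hEp]
  rw [← mul_assoc ((1 : D) ⊗ₜ[k] π Ψ) (1 ⊗ₜ π Φ), e4, ← mul_assoc _ (E d), hpE, add_comm]

end Exchange

section Exchange

variable {k : Type u} [Field k] {ι ι' : Type*} [Fintype ι]
  [DecidableEq ι] [Fintype ι'] [DecidableEq ι'] {A D : Type w} [Ring A] [Algebra k A]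
  [Ring D] [Algebra k D] {e : ι → A} {f : ι' → D} {c : ι → ι'} {π : A →ₗ[k] D} {x y : ι} {Φ Ψ : A}
  {β : DoubleBracket k e}

lemma IsFused.idem_mul_der (H : IsFused e f c π) (he : CompleteOrthogonalIdempotents e)
    {E : D →ₗ[k] D ⊗[k] D} (hE : ∀ x y, E (x * y) = E x * (1 ⊗ₜ y) + (x ⊗ₜ 1) * E y)
    (hEπ : ∀ a, E (π a) = euler e π x a) (d : D) :
    (1 ⊗ₜ f (c x)) * E d = E d ∧ E d * (f (c x) ⊗ₜ 1) = E d := by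
  have hx : π (e x) = f (c x) := H.hom.map_idem x
  have hp : f (c x) * f (c x) = f (c x) := H.hom.idem (he.idem x).eq
  have hl : ∀ a, f (c x) * π (e x * a) = π (e x * a) := fun a => H.hom.map_left a x
  have hr : ∀ a, π (a * e x) * f (c x) = π (a * e x) := fun a => H.hom.map_right a x
  constructor
  · refine H.der_ext (E := LinearMap.mulLeft k (1 ⊗ₜ f (c x)) ∘ₗ E) (fun y z => ?_) hE
      (fun a => ?_) d
    · simp only [LinearMap.comp_apply, LinearMap.mulLeft_apply, hE, mul_add, Ext.inner_outer_left]
      simp only [mul_assoc]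
    · simp [hEπ, euler_apply, mul_sub, hx, hp, hl]
  · refine H.der_ext (E := LinearMap.mulRight k (f (c x) ⊗ₜ 1) ∘ₗ E) (fun y z => ?_) hE
      (fun a => ?_) d
    · simp only [LinearMap.comp_apply, LinearMap.mulRight_apply, hE, add_mul,
        Ext.inner_outer_right]
      simp only [mul_assoc]
    · simp [hEπ, euler_apply, sub_mul, hx, hp, hr]

/-- A bracket induced along `π` is induced along a twist of `π` up to Euler terms. -/
theorem IsFused.toFun_twist (hxy : x ≠ y) (hc : c x = c y) (he : CompleteOrthogonalIdempotents e)
    (hf : CompleteOrthogonalIdempotents f) (H : IsFused e f c π)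
    (hΦ : β.IsMultiplicativeAt x Φ) (hΨ : e x * Ψ * e x = Ψ) (hΦΨ : Φ * Ψ = e x)
    (hΨΦ : Ψ * Φ = e x) {γ : DoubleBracket k f}
    (hγ : ∀ a b, γ.toFun (π a) (π b) = TensorProduct.map π π (β.toFun a b))
    {E : ι → D →ₗ[k] D ⊗[k] D}
    (hE : ∀ s x y, E s (x * y) = E s x * (1 ⊗ₜ y) + (x ⊗ₜ 1) * E s y)
    (hEπ : ∀ s a, E s (π a) = euler e π s a) {ρ : A →ₗ[k] D}
    (hρ : ρ = twist e (Function.update e y Φ) (Function.update e y Ψ) π) (a b : A) :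
    γ.toFun (ρ a) (ρ b) = TensorProduct.map ρ ρ (β.toFun a b) - (1 / 2 : k) •
      (wedge (euler e ρ y) (euler e ρ x) a b - wedge (E x ∘ₗ ρ) (E y ∘ₗ ρ) a b) := by
  have h2 := hΦ.mul_idem (he.idem x).eq
  have h1 := hΦ.idem_mul (he.idem x).eq
  have h3 : e x * Ψ = Ψ := by rw [← hΨ, ← mul_assoc, ← mul_assoc, (he.idem x).eq]
  have h4 : Ψ * e x = Ψ := by rw [← hΨ, mul_assoc, (he.idem x).eq]
  have G := isGauge_update hxy hc he.toOrthogonalIdempotents h1 h2 h3 h4 hΦΨ hΨΦ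
  have habs := fun d => H.idem_mul_der he (hE x) (hEπ x) d
  set v := Function.update e y Φ with hv
  set w := Function.update e y Ψ with hw
  have hV : ∀ s d, γ.toFun (π (v s)) d =
      (kron k y s / 2) • ((1 ⊗ₜ π (v s)) * E x d + E x d * (π (v s) ⊗ₜ 1)) := by
    intro s d
    by_cases h : s = y
    · rw [h, hv, Function.update_self, H.toFun_multiplicative he hΦ hγ (hE x) (hEπ x),
        show kron k y y = 1 from if_pos rfl]
    · rw [hv, Function.update_of_ne h, H.hom.map_idem, Function.comp_apply, γ.toFun_idem_left,
        show kron k y s = 0 from if_neg (Ne.symm h), zero_div, zero_smul]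
  have hW : ∀ s d, γ.toFun (π (w s)) d =
      -((kron k y s / 2) • ((1 ⊗ₜ π (w s)) * E x d + E x d * (π (w s) ⊗ₜ 1))) := by
    intro s d
    by_cases h : s = y
    · rw [h, hw, Function.update_self, H.toFun_multiplicative_inv he hΦ hΨ hΦΨ hΨΦ hγ (hE x)
        (hEπ x) (fun d => (habs d).1) (fun d => (habs d).2),
        show kron k y y = 1 from if_pos rfl]
    · rw [hw, Function.update_of_ne h, H.hom.map_idem, Function.comp_apply, γ.toFun_idem_left,
        show kron k y s = 0 from if_neg (Ne.symm h), zero_div, zero_smul, neg_zero]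
  have hom : ∀ s t a, e s * a = a → a * e t = a → ρ a = π (v s) * π a * π (w t) :=
    fun s t a hs ht => by rw [hρ, twist_of_homogeneous he π hs ht]
  -- The second argument is arbitrary here, so that the formula can be used twice, the second time
  -- with the arguments flipped by antisymmetry (`hab`).
  have key : ∀ s t a, e s * a = a → a * e t = a → ∀ d, γ.toFun (ρ a) d =
      (1 ⊗ₜ π (v s)) * γ.toFun (π a) d * (π (w t) ⊗ₜ 1)
        - (1 / 2 : k) • starMul (E y (ρ a) + euler e ρ y a) (E x d) := by
    intro s t a hs ht d
    obtain ⟨-, -, e3, -, e5, -⟩ := euler_twist hxy hc he hf H G h1 h2 h3 h4 hE hEπ hs ht rfl rfl hρ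
    rw [e3, e5, hom s t a hs ht]
    exact γ.toFun_conj (hV s d) (hW t d) (habs d).1 (habs d).2
  have main : ∀ s t a, e s * a = a → a * e t = a → ∀ s' t' b, e s' * b = b → b * e t' = b →
      γ.toFun (ρ a) (ρ b) = TensorProduct.map ρ ρ (β.toFun a b) - (1 / 2 : k) •
      (wedge (euler e ρ y) (euler e ρ x) a b - wedge (E x ∘ₗ ρ) (E y ∘ₗ ρ) a b) := by
    intro s t a hs ht s' t' b hs' ht'
    obtain ⟨-, p2, -, p4, -, p6, -, -⟩ :=
      euler_twist hxy hc he hf H G h1 h2 h3 h4 hE hEπ hs ht rfl rfl hρ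
    obtain ⟨-, q2, -, -, -, q6, q7, q8⟩ :=
      euler_twist hxy hc he hf H G h1 h2 h3 h4 hE hEπ hs' ht' rfl rfl hρ
    have hUU : π Ψ * π Φ = f (c x) := by
      rw [← H.hom.map_mul_of_idem h4 h1, hΨΦ, H.hom.map_idem, Function.comp_apply]
    -- The Euler map of ρ at `y` is the derivation E_y conjugated by Φ in the inner structure. With
    -- E_x + E_y unchanged by the twist, this eliminates E_x and makes the remaining terms assemble
    -- into the two wedges.
    have hstar : starMul (euler e ρ y a) (euler e ρ y b) = starMul (E y (ρ a)) (E y (ρ b)) := by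
      rw [p6, q6, starMul_conj _ _ (by rw [hUU, q8]) (by rw [hUU, q7])]
    have hab : γ.toFun (π a) (ρ b) =
        (π (v s') ⊗ₜ 1) * TensorProduct.map π π (β.toFun a b) * (1 ⊗ₜ π (w t'))
          + (1 / 2 : k) • starMul (euler e π x a) (E y (ρ b) + euler e ρ y b) := by
      rw [γ.antisymm, key s' t' b hs' ht', map_sub, map_smul, comm_starMul, map_mul, map_mul,
        Algebra.TensorProduct.comm_tmul, Algebra.TensorProduct.comm_tmul, ← hγ, γ.antisymm (π a),
        hEπ]
      simp only [mul_neg, neg_mul, sub_eq_add_neg]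
      abel
    have hx := eq_sub_of_add_eq q2
    have hx' := eq_sub_of_add_eq p2
    rw [key s t a hs ht, hab, mul_add, add_mul, mul_smul_comm, smul_mul_assoc,
      ← starMul_conj_left, p4]
    have hβ := map_twist_homogeneous (v := v) (w := w) he π s t s' t' (β.toFun a b)
      (β.eq_idem_mul_mul_idem hs ht hs' ht')
    rw [← hρ] at hβ
    have hmain : (1 ⊗ₜ π (v s)) * ((π (v s') ⊗ₜ 1) * TensorProduct.map π π (β.toFun a b)
        * (1 ⊗ₜ π (w t'))) * (π (w t) ⊗ₜ 1) = TensorProduct.map ρ ρ (β.toFun a b) := by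
      rw [hβ, ← mul_assoc, ← mul_assoc, Algebra.TensorProduct.tmul_mul_tmul, mul_assoc,
        Algebra.TensorProduct.tmul_mul_tmul, one_mul, mul_one, one_mul, mul_one]
    rw [hmain]
    simp only [wedge_apply, LinearMap.comp_apply, hx, hx', map_add, map_sub, LinearMap.add_apply,
      LinearMap.sub_apply, hstar]
    module
  have step : ∀ s t a, e s * a = a → a * e t = a → ∀ b,
      γ.toFun (ρ a) (ρ b) = TensorProduct.map ρ ρ (β.toFun a b) - (1 / 2 : k) •
      (wedge (euler e ρ y) (euler e ρ x) a b - wedge (E x ∘ₗ ρ) (E y ∘ₗ ρ) a b) :=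
    fun s t a hs ht b => linearMap_ext_homogeneous he (g := γ.toFun (ρ a) ∘ₗ ρ)
      (g' := TensorProduct.map ρ ρ ∘ₗ β.toFun a - (1 / 2 : k) •
        (wedge (euler e ρ y) (euler e ρ x) a - wedge (E x ∘ₗ ρ) (E y ∘ₗ ρ) a))
      (main s t a hs ht) b
  exact linearMap_ext_homogeneous he (g := (γ.toFun.flip (ρ b)) ∘ₗ ρ)
      (g' := TensorProduct.map ρ ρ ∘ₗ β.toFun.flip b - (1 / 2 : k) •
        ((wedge (euler e ρ y) (euler e ρ x)).flip b - (wedge (E x ∘ₗ ρ) (E y ∘ₗ ρ)).flip b))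
      (fun s t a hs ht => step s t a hs ht b) a

end Exchange

/-! ### Reordering the Euler terms. -/

section Order

variable {ι ι' : Type*} {k : Type u} [Field k]

/-- The bilinear maps underlying double brackets. -/
def bracketSubmodule {D : Type*} [Ring D] [Algebra k D] (f : ι' → D) :
    Submodule k (D →ₗ[k] D →ₗ[k] D ⊗[k] D) where
  carrier := {B | (∀ a b, B a b = - Algebra.TensorProduct.comm k D D (B b a)) ∧
    (∀ a b c, B a (b * c) = B a b * (1 ⊗ₜ c) + (b ⊗ₜ 1) * B a c) ∧ ∀ a s, B a (f s) = 0}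
  zero_mem' := by simp
  add_mem' := by
    rintro B B' ⟨h1, h2, h3⟩ ⟨h1', h2', h3'⟩
    refine ⟨fun a b => ?_, fun a b c => ?_, fun a s => ?_⟩
    · simp only [LinearMap.add_apply, map_add, neg_add]
      rw [h1 a b, h1' a b]
    · simp only [LinearMap.add_apply, h2, h2', add_mul, mul_add]; abel
    · simp [h3, h3']
  smul_mem' := by
    rintro r B ⟨h1, h2, h3⟩
    refine ⟨fun a b => ?_, fun a b c => ?_, fun a s => ?_⟩
    · simp only [LinearMap.smul_apply, map_smul]
      rw [h1 a b, smul_neg]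
    · simp [h2]
    · simp [h3]

lemma wedge_mem_bracketSubmodule {D : Type*} [Ring D] [Algebra k D] {f : ι' → D}
    {E E' : D →ₗ[k] D ⊗[k] D} (hE : ∀ x y, E (x * y) = E x * (1 ⊗ₜ y) + (x ⊗ₜ 1) * E y)
    (hE' : ∀ x y, E' (x * y) = E' x * (1 ⊗ₜ y) + (x ⊗ₜ 1) * E' y) (hf : ∀ r, E (f r) = 0)
    (hf' : ∀ r, E' (f r) = 0) : wedge E E' ∈ bracketSubmodule (k := k) f := by
  refine ⟨fun a b => ?_, fun a b c => ?_, fun a s => ?_⟩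
  · simp only [wedge_apply, map_sub, comm_starMul, neg_sub]
  · simp only [wedge_apply, hE, hE', map_add, starMul_mul_left, starMul_mul_right, sub_mul,
      mul_sub]
    abel
  · simp [hf, hf']

lemma pairSum_mem {M : Type*} [AddCommGroup M] [Module k M] (S : Submodule k M) {w : ι → ι → M}
    (h : ∀ s t, w s t ∈ S) (l : List ι) : pairSum w l ∈ S := by
  induction l with
  | nil => exact S.zero_mem
  | cons s l ih =>
    refine S.add_mem (list_sum_mem fun x hx => ?_) ih
    obtain ⟨t, -, rfl⟩ := List.mem_map.1 hx
    exact h s t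

lemma pairSum_apply {A X : Type*} [AddCommGroup A] [Module k A] [AddCommGroup X] [Module k X]
    (w : ι → ι → A →ₗ[k] A →ₗ[k] X) (l : List ι) (a b : A) :
    pairSum w l a b = pairSum (fun s t => w s t a b) l :=
  map_pairSum ((LinearMap.applyₗ b ∘ₗ LinearMap.applyₗ a :
    (A →ₗ[k] A →ₗ[k] X) →ₗ[k] X) : _ →+ X) w l

lemma starMul_euler_eq_zero {A D : Type*} [Ring A] [Algebra k A] [Ring D] [Algebra k D] {e : ι → A}
    {h : ι → D} {π : A →ₗ[k] D} (H : IsVertexHom e h π) {i j : ι} (hij : h i * h j = 0)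
    (hji : h j * h i = 0) (a b : A) : starMul (euler e π i a) (euler e π j b) = 0 := by
  have h1 : π (b * e j) * h i = 0 := by rw [← H.map_right, mul_assoc, hji, mul_zero]
  have h2 : h j * π (e i * a) = 0 := by rw [← H.map_left, ← mul_assoc, hji, zero_mul]
  simp [euler_apply, H.map_idem, h1, h2, hij, hji]

/-- The double bracket `γ` is obtained from `β` by subtracting the Euler terms for all pairs of
indices in the order given by the list `l`. -/
def HasOrder {A D : Type*} [Ring A] [Algebra k A] [Ring D] [Algebra k D] {e : ι → A} {f : ι' → D}
    (β : DoubleBracket k e) (γ : DoubleBracket k f) (π : A →ₗ[k] D) (l : List ι) : Prop :=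
  ∀ a b, γ.toFun (π a) (π b) = TensorProduct.map π π (β.toFun a b) -
    (1 / 2 : k) • pairSum (fun s t => wedge (euler e π s) (euler e π t) a b) l

/-- The product over `l` of the images of elements `φ s` of the corners of `e s`, completed to
elements of the whole algebra. -/
def momentProd {A D : Type*} [Ring A] [Algebra k A] [Ring D] [Algebra k D] (f : ι' → D)
    (c : ι → ι') (π : A →ₗ[k] D) (φ : ι → A) (l : List ι) : D :=
  (l.map fun s => 1 - f (c s) + π (φ s)).prod

variable [Fintype ι] [DecidableEq ι] [Fintype ι'] [DecidableEq ι'] {A D : Type w} [Ring A]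
  [Algebra k A] [Ring D] [Algebra k D] {e : ι → A} {f : ι' → D} {c : ι → ι'} {π : A →ₗ[k] D}
  {x y : ι} {β : DoubleBracket k e} {γ : DoubleBracket k f}

/-- The fused idempotents of `x` and `y` are orthogonal, so their wedge vanishes and the
corresponding factors of the moment map commute. No twist is needed. -/
lemma HasOrder.exchange_of_ne {m l : List ι} (hnd : (m ++ x :: y :: l).Nodup) (hc : c x ≠ c y)
    (he : CompleteOrthogonalIdempotents e)
    (hf : CompleteOrthogonalIdempotents f) (H : IsFused e f c π)
    (hl : HasOrder β γ π (m ++ x :: y :: l)) :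
    HasOrder β γ π (m ++ y :: x :: l) ∧
      ∀ φ : ι → A, (∀ s, β.IsMultiplicativeAt s (φ s)) →
        momentProd f c π φ (m ++ x :: y :: l) = momentProd f c π φ (m ++ y :: x :: l) := by
  have h1 := hf.ortho hc
  have h2 := hf.ortho hc.symm
  constructor
  · intro a b
    rw [hl, pairSum_swap (w := fun s t => wedge (euler e π s) (euler e π t) a b) hnd
      (fun _ _ _ _ _ _ => rfl) (fun _ _ _ => add_comm _ _) (fun _ _ _ => add_comm _ _)]
    simp only [wedge_apply, starMul_euler_eq_zero H.hom (i := x) (j := y) h1 h2,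
      starMul_euler_eq_zero H.hom (i := y) (j := x) h2 h1, sub_zero, add_zero]
  · intro φ hφ
    have h3 : ∀ s, f (c s) * π (φ s) = π (φ s) := fun s => by
      have := H.hom.map_left (φ s) s
      rwa [(hφ s).idem_mul (he.idem s).eq] at this
    have h4 : ∀ s, π (φ s) * f (c s) = π (φ s) := fun s => by
      have := H.hom.map_right (φ s) s
      rwa [(hφ s).mul_idem (he.idem s).eq] at this
    have key : ∀ s t, f (c s) * f (c t) = 0 → (1 - f (c s) + π (φ s)) * (1 - f (c t) + π (φ t)) =
        1 - f (c s) - f (c t) + π (φ s) + π (φ t) := by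
      intro s t hst
      have h5 : f (c s) * π (φ t) = 0 := by rw [← h3, ← mul_assoc, hst, zero_mul]
      have h6 : π (φ s) * f (c t) = 0 := by rw [← h4, mul_assoc, hst, mul_zero]
      have h7 : π (φ s) * π (φ t) = 0 := by rw [← h4, mul_assoc, h5, mul_zero]
      simp only [mul_add, add_mul, mul_sub, sub_mul, one_mul, mul_one, hst, h5, h6, h7]
      abel
    simp only [momentProd, List.map_append, List.prod_append, List.map_cons, List.prod_cons]
    rw [← mul_assoc (1 - f (c x) + π (φ x)), ← mul_assoc (1 - f (c y) + π (φ y)), key x y h1,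
      key y x h2]
    congr 2
    abel

/-- Adding all Euler terms back to γ gives a bracket `I` that is simply induced by β along `π`, and
`toFun_twist` applies to it. Subtracting the Euler terms again, now seen through the twist ρ, leaves
those of ρ in the exchanged order. -/
lemma HasOrder.exchange_of_eq [CharZero k] {m l : List ι} (hnd : (m ++ x :: y :: l).Nodup)
    (hc : c x = c y) (he : CompleteOrthogonalIdempotents e)
    (hf : CompleteOrthogonalIdempotents f) (hsurj : Function.Surjective c) (H : IsFused e f c π)
    (hl : HasOrder β γ π (m ++ x :: y :: l)) {Φ Ψ : A}
    (hΦ : β.IsMultiplicativeAt x Φ) (hΨ : e x * Ψ * e x = Ψ) (hΦΨ : Φ * Ψ = e x)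
    (hΨΦ : Ψ * Φ = e x) :
    ∃ ρ : A →ₗ[k] D, IsFused e f c ρ ∧ HasOrder β γ ρ (m ++ y :: x :: l) ∧
      ∀ φ : ι → A, (∀ s, β.IsMultiplicativeAt s (φ s)) →
        momentProd f c π φ (m ++ x :: y :: l) = momentProd f c ρ φ (m ++ y :: x :: l) := by
  have hmem : ∀ s, s ∈ m ∨ s ∈ l → s ≠ x ∧ s ≠ y := by
    rw [List.nodup_append] at hnd
    have h1 := hnd.2.1
    simp only [List.nodup_cons, List.mem_cons, not_or] at h1
    rintro s (hs | hs)
    · exact ⟨hnd.2.2 s hs x (by simp), hnd.2.2 s hs y (by simp)⟩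
    · exact ⟨fun h => h1.1.2 (h ▸ hs), fun h => h1.2.1 (h ▸ hs)⟩
  have hxy : x ≠ y := by
    rw [List.nodup_append] at hnd
    have h1 := hnd.2.1
    simp only [List.nodup_cons, List.mem_cons, not_or] at h1
    exact h1.1.1
  have h2 := hΦ.mul_idem (he.idem x).eq
  have h1 := hΦ.idem_mul (he.idem x).eq
  have h3 : e x * Ψ = Ψ := by rw [← hΨ, ← mul_assoc, ← mul_assoc, (he.idem x).eq]
  have h4 : Ψ * e x = Ψ := by rw [← hΨ, mul_assoc, (he.idem x).eq]
  have G := isGauge_update hxy hc he.toOrthogonalIdempotents h1 h2 h3 h4 hΦΨ hΨΦ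
  choose E hE hEπ using fun s => H.exists_euler he hf s
  have hE0 : ∀ s r, E s (f r) = 0 := by
    intro s r
    obtain ⟨t, rfl⟩ := hsurj r
    have h5 : f (c t) = π (e t) := (H.hom.map_idem t).symm
    rw [h5, hEπ, euler_of_homogeneous H.hom he.toOrthogonalIdempotents (he.idem t).eq
      (he.idem t).eq]
    unfold kron
    split_ifs with h
    · rw [h, H.hom.map_idem, sub_self]
    · simp
  -- Wedges of double derivations that kill the base are double brackets. This is where the extended
  -- derivations `E s`, rather than the Euler maps on `A`, are required.
  have hB := (bracketSubmodule (k := k) f).add_mem (x := γ.toFun) ⟨γ.antisymm, γ.leibniz, γ.base⟩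
    ((bracketSubmodule f).smul_mem (1 / 2 : k) (pairSum_mem _ (w := fun s t => wedge (E s) (E t))
      (fun s t => wedge_mem_bracketSubmodule (hE s) (hE t) (hE0 s) (hE0 t)) (m ++ x :: y :: l)))
  let I : DoubleBracket k f := ⟨_, hB.1, hB.2.1, hB.2.2⟩
  have hI : ∀ d d', I.toFun d d' = γ.toFun d d' +
      (1 / 2 : k) • pairSum (fun s t => wedge (E s) (E t) d d') (m ++ x :: y :: l) := fun d d' => by
    change γ.toFun d d' + (1 / 2 : k) • pairSum (fun s t => wedge (E s) (E t)) _ d d' = _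
    rw [pairSum_apply]
  obtain ⟨ρ, hρ⟩ : ∃ ρ, ρ = twist e (Function.update e y Φ) (Function.update e y Ψ) π := ⟨_, rfl⟩
  have hEρ := fun a b => H.toFun_twist hxy hc he hf hΦ hΨ hΦΨ hΨΦ (γ := I)
    (fun a b => by rw [hI, hl]; simp [wedge_apply, hEπ]) hE hEπ hρ a b
  -- `k1` and `k2` are the hypotheses of `pairSum_swap`: the twist changes nothing away from `x` and
  -- `y`, and preserves the sum of the two derivations there.
  have k1 : ∀ r, r ≠ x → r ≠ y → ∀ a, E r (ρ a) = euler e ρ r a := fun r hrx hry =>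
    linearMap_ext_homogeneous he (g := E r ∘ₗ ρ) fun s t a hs ht =>
      (euler_twist hxy hc he hf H G h1 h2 h3 h4 hE hEπ hs ht rfl rfl hρ).1 r hrx hry
  have k2 : ∀ a, E x (ρ a) + E y (ρ a) = euler e ρ x a + euler e ρ y a :=
    linearMap_ext_homogeneous he (g := E x ∘ₗ ρ + E y ∘ₗ ρ) (g' := euler e ρ x + euler e ρ y)
      fun s t a hs ht =>
        (euler_twist hxy hc he hf H G h1 h2 h3 h4 hE hEπ hs ht rfl rfl hρ).2.1
  refine ⟨ρ, hρ ▸ G.isFused_twist he H, fun a b => ?_, fun φ hφ => ?_⟩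
  · have h5 := hI (ρ a) (ρ b)
    rw [hEρ] at h5
    rw [pairSum_swap (w := fun s t => wedge (E s) (E t) (ρ a) (ρ b)) hnd]
    · simp only [wedge_apply, LinearMap.comp_apply] at h5 ⊢
      linear_combination (norm := module) (-1 : k) • h5
    · intro s t hsx hsy htx hty
      simp only [wedge_apply, k1 s hsx hsy, k1 t htx hty]
    · intro s hsx hsy
      have ka := k2 a
      have kb := k2 b
      simp only [wedge_apply, k1 s hsx hsy]
      have e1 := congrArg (starMul (euler e ρ s a)) kb
      have e2 := congrArg (fun d => starMul d (euler e ρ s b)) ka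
      simp only [map_add, LinearMap.add_apply] at e1 e2
      linear_combination (norm := module) (-1 : k) • e1 + (1 : k) • e2
    · intro s hsx hsy
      have ka := k2 a
      have kb := k2 b
      simp only [wedge_apply, k1 s hsx hsy]
      have e1 := congrArg (starMul (euler e ρ s a)) kb
      have e2 := congrArg (fun d => starMul d (euler e ρ s b)) ka
      simp only [map_add, LinearMap.add_apply] at e1 e2
      linear_combination (norm := module) (1 : k) • e1 - (1 : k) • e2
  · have hl' : ∀ s, e s * φ s = φ s := fun s => (hφ s).idem_mul (he.idem s).eq
    have hr' : ∀ s, φ s * e s = φ s := fun s => (hφ s).mul_idem (he.idem s).eq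
    have l1 : ∀ s, f (c s) * π (φ s) = π (φ s) := fun s => by
      have := H.hom.map_left (φ s) s
      rwa [hl' s] at this
    have l2 : ∀ s, π (φ s) * f (c s) = π (φ s) := fun s => by
      have := H.hom.map_right (φ s) s
      rwa [hr' s] at this
    have hne : ∀ s, s ≠ y → ρ (φ s) = π (φ s) := by
      intro s hs
      rw [hρ, twist_of_homogeneous he π (hl' s) (hr' s), Function.update_of_ne hs,
        Function.update_of_ne hs, H.hom.map_idem, Function.comp_apply, l1, l2]
    have hy : ρ (φ y) = π Φ * π (φ y) * π Ψ := by
      rw [hρ, twist_of_homogeneous he π (hl' y) (hr' y), Function.update_self,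
        Function.update_self]
    have hpp := (hf.idem (c y)).eq
    have l3 : f (c y) * π Φ = π Φ := by
      have := H.hom.map_left Φ x
      rwa [h1, Function.comp_apply, hc] at this
    have l4 : π Ψ * f (c y) = π Ψ := by
      have := H.hom.map_right Ψ x
      rwa [h4, Function.comp_apply, hc] at this
    have l5 : π Ψ * π Φ = f (c y) := by
      rw [← H.hom.map_mul_of_idem h4 h1, hΨΦ, H.hom.map_idem, Function.comp_apply, hc]
    -- The component φ_x is a multiple of the twisting element Φ. Hence ρ(φ_y) ρ(φ_x) = Φ φ_y Ψ · rΦ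
    -- = rΦ · φ_y, which is π(φ_x) π(φ_y).
    obtain ⟨r, hr⟩ := hΦ.exists_eq_smul (hφ x) (he.idem x).eq hΦΨ
    have pair : ∀ X Y : D, f (c y) * X = X → f (c y) * Y = Y → X * f (c y) = X →
        (1 - f (c y) + X) * (1 - f (c y) + Y) = 1 - f (c y) + X * Y := by
      intro X Y hX hY hX'
      simp only [mul_add, add_mul, mul_sub, sub_mul, one_mul, mul_one, hpp, hY, hX']
      abel
    have lx := l1 x
    have lx' := l2 x
    rw [hc] at lx lx'
    have hpair : (1 - f (c x) + π (φ x)) * (1 - f (c y) + π (φ y)) =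
        (1 - f (c y) + ρ (φ y)) * (1 - f (c x) + ρ (φ x)) := by
      rw [hne x hxy, hy, hc, pair _ _ lx (l1 y) lx',
        pair _ _ (by rw [← mul_assoc, ← mul_assoc, l3]) lx (by rw [mul_assoc, l4]), hr, map_smul]
      rw [smul_mul_assoc, mul_smul_comm, mul_assoc (π Φ * π (φ y)), l5, mul_assoc, l2]
    have hcongr : ∀ l' : List ι, (∀ s ∈ l', s ≠ y) →
        (l'.map fun s => 1 - f (c s) + π (φ s)) = l'.map fun s => 1 - f (c s) + ρ (φ s) :=
      fun l' hl' => List.map_congr_left fun s hs => by rw [hne s (hl' s hs)]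
    simp only [momentProd, List.map_append, List.prod_append, List.map_cons, List.prod_cons]
    rw [← mul_assoc (1 - f (c x) + π (φ x)), hpair, hcongr m fun s hs => (hmem s (.inl hs)).2,
      hcongr l fun s hs => (hmem s (.inr hs)).2, mul_assoc (1 - f (c y) + ρ (φ y))]

/-- The order of the Euler terms may be changed arbitrarily by twisting. -/
theorem HasOrder.exists_perm [CharZero k] (he : CompleteOrthogonalIdempotents e)
    (hf : CompleteOrthogonalIdempotents f) (hsurj : Function.Surjective c)
    (hΦ : ∀ s, (∃ t, t ≠ s ∧ c t = c s) → ∃ Φ Ψ : A, β.IsMultiplicativeAt s Φ ∧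
      e s * Ψ * e s = Ψ ∧ Φ * Ψ = e s ∧ Ψ * Φ = e s) {l l' : List ι} (hperm : l.Perm l') :
    ∀ (m : List ι) (π : A →ₗ[k] D), (m ++ l).Nodup → IsFused e f c π → HasOrder β γ π (m ++ l) →
    ∃ ρ : A →ₗ[k] D, IsFused e f c ρ ∧ HasOrder β γ ρ (m ++ l') ∧
      ∀ φ : ι → A, (∀ s, β.IsMultiplicativeAt s (φ s)) →
        momentProd f c π φ (m ++ l) = momentProd f c ρ φ (m ++ l') := by
  -- The list `m` of entries already passed is kept general, because a permutation of a tail is a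
  -- sequence of exchanges inside the whole list. The map `π` must vary as well, since every
  -- exchange replaces it.
  induction hperm with
  | nil => exact fun m π _ H h => ⟨π, H, h, fun _ _ => rfl⟩
  | cons s _ ih =>
    intro m π hnd H h
    rw [List.append_cons] at hnd h
    obtain ⟨ρ, h1, h2, h3⟩ := ih (m ++ [s]) π hnd H h
    simp only [List.append_assoc, List.singleton_append] at h2 h3
    exact ⟨ρ, h1, h2, h3⟩
  | swap y x l =>
    intro m π hnd H h
    by_cases hc : c x = c y
    · have hxy : y ≠ x := by
        rw [List.nodup_append] at hnd
        have h1 := hnd.2.1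
        simp only [List.nodup_cons, List.mem_cons, not_or] at h1
        exact Ne.symm h1.1.1
      obtain ⟨Φ, Ψ, h1, h2, h3, h4⟩ := hΦ x ⟨y, hxy, hc.symm⟩
      exact h.exchange_of_eq hnd hc he hf hsurj H h1 h2 h3 h4
    · exact ⟨π, H, h.exchange_of_ne hnd hc he hf H⟩
  | trans h1 _ ih1 ih2 =>
    intro m π hnd H h
    obtain ⟨ρ, p1, p2, p3⟩ := ih1 m π hnd H h
    obtain ⟨ρ', q1, q2, q3⟩ := ih2 m ρ ((h1.append_left m).nodup_iff.1 hnd) p1 p2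
    exact ⟨ρ', q1, q2, fun φ hφ => (p3 φ hφ).trans (q3 φ hφ)⟩

end Order

/-! ### Chains of fusions -/

section Split

variable {k : Type u} [Field k] {ι ι' : Type*} [Fintype ι] [DecidableEq ι] {i j : ι}

/-- The indices identified with `r` when `j` is fused onto `i`, in their fusion order. -/
def splitIndex (i j : ι) (r : {s : ι // s ≠ j}) : List ι :=
  if (r : ι) = i then [i, j] else [(r : ι)]

lemma mem_splitIndex (hij : i ≠ j) {s : ι} {r : {s : ι // s ≠ j}} :
    s ∈ splitIndex i j r ↔ fuseIndex hij s = r := by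
  obtain ⟨r, hr⟩ := r
  unfold splitIndex
  by_cases hs : s = j
  · subst hs
    rw [fuseIndex_self]
    by_cases h : r = i
    · simp [h]
    · simp [h, Ne.symm hr, Ne.symm h]
  · rw [fuseIndex_of_ne hij hs]
    by_cases h : r = i
    · simp [h, hs]
    · simp [h]

lemma splitIndex_nodup (hij : i ≠ j) (r : {s : ι // s ≠ j}) : (splitIndex i j r).Nodup := by
  unfold splitIndex
  split_ifs <;> simp [hij]

lemma sum_splitIndex {M : Type*} [AddCommMonoid M] (hij : i ≠ j) (r : {s : ι // s ≠ j})
    (w : ι → M) : ((splitIndex i j r).map w).sum = ∑ s with fuseIndex hij s = r, w s := by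
  rw [← List.sum_toFinset _ (splitIndex_nodup hij r)]
  congr 1
  ext s
  simp [mem_splitIndex hij]

lemma pairSum_splitIndex {M : Type*} [AddCommMonoid M] (r : {s : ι // s ≠ j})
    (w : ι → ι → M) : pairSum w (splitIndex i j r) = if (r : ι) = i then w i j else 0 := by
  unfold splitIndex
  split_ifs <;> simp

lemma nodup_flatMap_splitIndex (hij : i ≠ j) {l : List {s : ι // s ≠ j}} (hl : l.Nodup) :
    (l.flatMap (splitIndex i j)).Nodup := by
  rw [List.nodup_flatMap]
  refine ⟨fun r _ => splitIndex_nodup hij r, hl.imp fun {r r'} hrr s hs hs' => hrr ?_⟩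
  rw [mem_splitIndex hij] at hs hs'
  rw [← hs, hs']

lemma mem_flatMap_splitIndex (hij : i ≠ j) {l : List {s : ι // s ≠ j}} (hl : ∀ r, r ∈ l) (s : ι) :
    s ∈ l.flatMap (splitIndex i j) :=
  List.mem_flatMap.2 ⟨fuseIndex hij s, hl _, (mem_splitIndex hij).2 rfl⟩

lemma fuseIndex_surjective (hij : i ≠ j) : Function.Surjective (fuseIndex hij) :=
  fun r => ⟨r, fuseIndex_coe hij r⟩

/-- Multiplication of `π a` by the fused idempotent `f r` amounts to multiplication of `a` by the
sum of the idempotents in the fibre of `r`, and these all have the same image under `π' ∘ₗ π`. -/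
lemma euler_comp [Fintype ι'] [DecidableEq ι'] {A D S : Type*} [Ring A] [Algebra k A] [Ring D]
    [Algebra k D] [Ring S] [Algebra k S] {e : ι → A} {f : ι' → D} {c : ι → ι'} {h : ι' → S}
    {π : A →ₗ[k] D} {π' : D →ₗ[k] S} (he : CompleteOrthogonalIdempotents e)
    (hf : CompleteOrthogonalIdempotents f) (H : IsVertexHom e (f ∘ c) π) (H' : IsVertexHom f h π')
    (r : ι') (a : A) :
    euler f π' r (π a) = ∑ s with c s = r, euler e (π' ∘ₗ π) s a := by
  have h1 : ∀ s ∈ Finset.univ.filter (fun s => c s = r), euler e (π' ∘ₗ π) s a =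
      π' (π (a * e s)) ⊗ₜ h r - h r ⊗ₜ π' (π (e s * a)) := by
    intro s hs
    rw [euler_apply, (H'.comp H).map_idem, Function.comp_apply, (Finset.mem_filter.1 hs).2]
    rfl
  rw [Finset.sum_congr rfl h1, Finset.sum_sub_distrib, ← TensorProduct.sum_tmul,
    ← TensorProduct.tmul_sum, ← map_sum, ← map_sum, ← map_sum, ← map_sum, ← Finset.mul_sum,
    ← Finset.sum_mul, ← H.idem_mul_map he hf, ← H.map_mul_idem he hf, euler_apply, H'.map_idem]

lemma wedge_euler_comp [Fintype ι'] [DecidableEq ι'] {A D S : Type*} [Ring A] [Algebra k A]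
    [Ring D] [Algebra k D] [Ring S] [Algebra k S] {e : ι → A} {f : ι' → D} {c : ι → ι'} {h : ι' → S}
    {π : A →ₗ[k] D} {π' : D →ₗ[k] S} (he : CompleteOrthogonalIdempotents e)
    (hf : CompleteOrthogonalIdempotents f) (H : IsVertexHom e (f ∘ c) π) (H' : IsVertexHom f h π')
    (r r' : ι') (a b : A) :
    wedge (euler f π' r) (euler f π' r') (π a) (π b) = ∑ s with c s = r, ∑ t with c t = r',
      wedge (euler e (π' ∘ₗ π) s) (euler e (π' ∘ₗ π) t) a b := by
  rw [wedge_apply, euler_comp he hf H H', euler_comp he hf H H', euler_comp he hf H H',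
    euler_comp he hf H H']
  simp only [wedge_apply, Finset.sum_sub_distrib, map_sum, LinearMap.sum_apply]
  rw [Finset.sum_comm, sub_right_inj, Finset.sum_comm]

end Split

/-! ### The order of the Euler terms under composition. -/

section Step

variable {k : Type u} [Field k] {ι ι' : Type*} [Fintype ι] [DecidableEq ι] [Fintype ι']
  [DecidableEq ι'] {i j : ι} {A D S : Type*} [Ring A] [Algebra k A] {e : ι → A}
  [Ring D] [Algebra k D] {f : {s : ι // s ≠ j} → D} [Ring S] [Algebra k S] {h : ι' → S}
  {π : A →ₗ[k] D} {π' : D →ₗ[k] S}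

/-- All products occurring in the wedge meet at the vertex into which `i` and `j` are fused, and
there `π'` is multiplicative. -/
lemma map_wedge_euler (he : CompleteOrthogonalIdempotents e) (hij : i ≠ j)
    (H : IsVertexHom e (f ∘ fuseIndex hij) π) {h' : {s : ι // s ≠ j} → S}
    (H' : IsVertexHom f h' π') (a b : A) :
    TensorProduct.map π' π' (wedge (euler e π i) (euler e π j) a b) =
      wedge (euler e (π' ∘ₗ π) i) (euler e (π' ∘ₗ π) j) a b := by
  have hij' : fuseIndex hij i = fuseIndex hij j := by
    rw [fuseIndex_self, fuseIndex_of_ne hij hij]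
  have key : ∀ s t, fuseIndex hij s = fuseIndex hij t → ∀ a b,
      π' (π (a * e s) * π (e t * b)) = π' (π (a * e s)) * π' (π (e t * b)) := by
    intro s t hst a b
    have h1 := H.map_left b t
    rw [Function.comp_apply, ← hst] at h1
    exact H'.map_mul_of_idem (H.map_right a s) h1
  rw [wedge_euler H (by rw [Function.comp_apply, Function.comp_apply, hij'])
      (H.idem (he.idem i).eq),
    wedge_euler (H'.comp H) (by rw [Function.comp_apply, Function.comp_apply, hij'])
      ((H'.comp H).idem (he.idem i).eq)]
  simp only [map_add, map_sub, TensorProduct.map_tmul, key i j hij', key j i hij'.symm,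
    Function.comp_apply, H'.map_idem, LinearMap.comp_apply]

/-- Each index of the intermediate algebra is replaced by its block of one or two original indices.
By additivity of Euler maps the later terms become the pairs between blocks, while the first fusion
contributes the only pair inside a block, with `i` before `j`. -/
lemma HasOrder.comp (he : CompleteOrthogonalIdempotents e)
    (hf : CompleteOrthogonalIdempotents f) (hij : i ≠ j)
    (H : IsVertexHom e (f ∘ fuseIndex hij) π) {c : {s : ι // s ≠ j} → ι'}
    (H' : IsVertexHom f (h ∘ c) π') {β : DoubleBracket k e} {β' : DoubleBracket k f}
    {γ : DoubleBracket k h}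
    (hβ : ∀ a b, β'.toFun (π a) (π b) = TensorProduct.map π π (β.toFun a b)
      - (1 / 2 : k) • wedge (euler e π i) (euler e π j) a b) {l : List {s : ι // s ≠ j}}
    (hl : l.Nodup) (hl' : ∀ r, r ∈ l) (ho : HasOrder β' γ π' l) :
    HasOrder β γ (π' ∘ₗ π) (l.flatMap (splitIndex i j)) := by
  intro a b
  have h1 : (l.map fun r => pairSum (fun s t => wedge (euler e (π' ∘ₗ π) s)
      (euler e (π' ∘ₗ π) t) a b) (splitIndex i j r)).sum =
      wedge (euler e (π' ∘ₗ π) i) (euler e (π' ∘ₗ π) j) a b := by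
    rw [← List.sum_toFinset _ hl, Finset.sum_eq_single (⟨i, hij⟩ : {s : ι // s ≠ j})]
    · rw [pairSum_splitIndex, if_pos rfl]
    · intro r _ hr
      rw [pairSum_splitIndex, if_neg fun h => hr (Subtype.ext h)]
    · intro h
      exact absurd (List.mem_toFinset.2 (hl' _)) h
  have h2 : ∀ r r', ((splitIndex i j r).map fun s => ((splitIndex i j r').map fun t =>
        wedge (euler e (π' ∘ₗ π) s) (euler e (π' ∘ₗ π) t) a b).sum).sum =
      wedge (euler f π' r) (euler f π' r') (π a) (π b) := by
    intro r r'
    rw [wedge_euler_comp he hf H H', sum_splitIndex hij]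
    exact Finset.sum_congr rfl fun s _ => sum_splitIndex hij r' _
  rw [LinearMap.comp_apply, LinearMap.comp_apply, ho, hβ, map_sub, map_smul,
    map_wedge_euler he hij H H', pairSum_flatMap, h1, pairSum_congr h2, TensorProduct.map_comp,
    LinearMap.comp_apply]
  module

end Step

/-! ### Moment maps as ordered products. -/

section Moment

variable {k : Type u} [Field k] {ι ι' : Type*} [Fintype ι] [DecidableEq ι] [Fintype ι']
  [DecidableEq ι'] {i j : ι} {A D S : Type*} [Ring A] [Algebra k A] {e : ι → A}
  [Ring D] [Algebra k D] {f : {s : ι // s ≠ j} → D} [Ring S] [Algebra k S] {h : ι' → S}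
  {π : A →ₗ[k] D} {π' : D →ₗ[k] S} {φ : ι → A}

/-- Each factor is 1 + (φ s − e s), and the deviations from 1 at different indices multiply to zero.
Before any fusion the ordered product is thus the ordinary sum of the components. -/
lemma prod_one_sub_add (he : OrthogonalIdempotents e) (hl : ∀ s, e s * φ s = φ s)
    (hr : ∀ s, φ s * e s = φ s) {l : List ι} (hnd : l.Nodup) :
    (l.map fun s => 1 - e s + φ s).prod = 1 + (l.map fun s => φ s - e s).sum := by
  induction l with
  | nil => simp
  | cons s l ih =>
    rw [List.nodup_cons] at hnd
    have h0 : (φ s - e s) * (l.map fun s => φ s - e s).sum = 0 := by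
      rw [← List.sum_map_mul_left]
      refine List.sum_eq_zero fun x hx => ?_
      obtain ⟨t, ht, rfl⟩ := List.mem_map.1 hx
      have hst : s ≠ t := fun h => hnd.1 (h ▸ ht)
      have h1 : e s * φ t = 0 := by rw [← hl t, ← mul_assoc, he.ortho hst, zero_mul]
      have h2 : φ s * e t = 0 := by rw [← hr s, mul_assoc, he.ortho hst, mul_zero]
      have h3 : φ s * φ t = 0 := by rw [← hr s, mul_assoc, h1, mul_zero]
      simp [mul_sub, sub_mul, h1, h2, h3, he.ortho hst]
    rw [List.map_cons, List.prod_cons, ih hnd.2, List.map_cons, List.sum_cons,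
      show 1 - e s + φ s = 1 + (φ s - e s) by abel, add_mul, mul_add, mul_add, h0]
    simp only [one_mul, mul_one]
    abel

lemma momentProd_id (he : CompleteOrthogonalIdempotents e) (hl : ∀ s, e s * φ s = φ s)
    (hr : ∀ s, φ s * e s = φ s) :
    momentProd e id (LinearMap.id : A →ₗ[k] A) φ Finset.univ.toList = ∑ s, φ s := by
  have := prod_one_sub_add he.toOrthogonalIdempotents hl hr (Finset.nodup_toList Finset.univ)
  rw [Finset.sum_map_toList, Finset.sum_sub_distrib, he.complete, add_sub_cancel] at this
  exact this

/-- The components of the image of a moment map under fusing `e j` onto `e i`. -/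
def fuseComponent (i : ι) (π : A →ₗ[k] D) (φ : ι → A) (r : {s : ι // s ≠ j}) : D :=
  if (r : ι) = i then π (φ i) * π (φ j) else π (φ r)

/-- In the block of `i` and `j` both factors are completed by the same idempotent, so their product
is the completion of the product of the two components; all other blocks are single. -/
lemma momentProd_comp
    (hh : OrthogonalIdempotents h) (hij : i ≠ j)
    (H : IsVertexHom e (f ∘ fuseIndex hij) π) {c : {s : ι // s ≠ j} → ι'}
    (H' : IsVertexHom f (h ∘ c) π') (hl : ∀ s, e s * φ s = φ s)
    (hr : ∀ s, φ s * e s = φ s) (l : List {s : ι // s ≠ j}) :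
    momentProd h c π' (fuseComponent i π φ) l =
      momentProd h (c ∘ fuseIndex hij) (π' ∘ₗ π) φ (l.flatMap (splitIndex i j)) := by
  have hl' : ∀ s, h (c (fuseIndex hij s)) * π' (π (φ s)) = π' (π (φ s)) := fun s => by
    have := (H'.comp H).map_left (φ s) s
    rwa [hl] at this
  have hr' : ∀ s, π' (π (φ s)) * h (c (fuseIndex hij s)) = π' (π (φ s)) := fun s => by
    have := (H'.comp H).map_right (φ s) s
    rwa [hr] at this
  have key : ∀ r, 1 - h (c r) + π' (fuseComponent i π φ r) =
      ((splitIndex i j r).map fun s =>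
        1 - h (c (fuseIndex hij s)) + π' (π (φ s))).prod := by
    intro r
    unfold fuseComponent splitIndex
    split_ifs with hri
    · obtain rfl : r = ⟨i, hij⟩ := Subtype.ext hri
      have h1 := hl' j
      have h2 := hr' i
      have h3 : π' (π (φ i) * π (φ j)) = π' (π (φ i)) * π' (π (φ j)) := by
        have h4 := H.map_right (φ i) i
        have h5 := H.map_left (φ j) j
        rw [hr, Function.comp_apply, fuseIndex_of_ne hij hij] at h4
        rw [hl, Function.comp_apply, fuseIndex_self] at h5
        exact H'.map_mul_of_idem h4 h5
      rw [fuseIndex_self] at h1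
      rw [fuseIndex_of_ne hij hij] at h2
      simp only [List.map_cons, List.map_nil, List.prod_cons, List.prod_nil, mul_one,
        fuseIndex_self, fuseIndex_of_ne hij hij, h3, mul_add, add_mul, mul_sub, sub_mul, one_mul,
        h1, h2, (hh.idem _).eq]
      abel
    · simp [fuseIndex_coe]
  unfold momentProd
  induction l with
  | nil => simp
  | cons r l ih =>
    rw [List.map_cons, List.prod_cons, key, ih, List.flatMap_cons, List.map_append,
      List.prod_append]
    rfl

/-- The inverse of the sum, cut down to the corner at `s`, is an inverse of `φ s` there. Its image,
completed by 1 − f (c s), inverts the factor at `s`. -/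
lemma isUnit_momentProd {A D : Type*} [Ring A] [Algebra k A] [Ring D] [Algebra k D] {e : ι → A}
    {f : ι' → D} {c : ι → ι'} {π : A →ₗ[k] D} {φ : ι → A} (he : CompleteOrthogonalIdempotents e)
    (hf : OrthogonalIdempotents f) (H : IsVertexHom e (f ∘ c) π)
    (hl : ∀ s, e s * φ s = φ s) (hr : ∀ s, φ s * e s = φ s) (hu : IsUnit (∑ s, φ s))
    (l : List ι) : IsUnit (momentProd f c π φ l) := by
  refine List.prod_isUnit fun x hx => ?_
  obtain ⟨s, -, rfl⟩ := List.mem_map.1 hx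
  obtain ⟨Φ, hΦ⟩ := hu
  have h1 : e s * (Φ : A) = φ s := by
    rw [hΦ, Finset.mul_sum, Finset.sum_eq_single s]
    · exact hl s
    · intro t _ ht
      rw [← hl t, ← mul_assoc, he.ortho (Ne.symm ht), zero_mul]
    · simp
  have h2 : (Φ : A) * e s = φ s := by
    rw [hΦ, Finset.sum_mul, Finset.sum_eq_single s]
    · exact hr s
    · intro t _ ht
      rw [← hr t, mul_assoc, he.ortho ht, mul_zero]
    · simp
  set ψ := e s * (↑Φ⁻¹ : A) * e s with hψ
  have h3 : φ s * ψ = e s := by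
    rw [hψ, ← mul_assoc, ← mul_assoc, hr, ← h1, mul_assoc (e s), Units.mul_inv, mul_one,
      (he.idem s).eq]
  have h4 : ψ * φ s = e s := by
    rw [hψ, mul_assoc, hl, ← h2, mul_assoc, Units.inv_mul_cancel_left, (he.idem s).eq]
  have h5 : e s * ψ = ψ := by rw [hψ, ← mul_assoc, ← mul_assoc, (he.idem s).eq]
  have h6 : ψ * e s = ψ := by rw [hψ, mul_assoc, (he.idem s).eq]
  have m1 : π (φ s) * π ψ = f (c s) := by
    rw [← H.map_mul_of_idem (hr s) h5, h3, H.map_idem, Function.comp_apply]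
  have m2 : π ψ * π (φ s) = f (c s) := by
    rw [← H.map_mul_of_idem h6 (hl s), h4, H.map_idem, Function.comp_apply]
  have m3 : f (c s) * π (φ s) = π (φ s) := by
    have := H.map_left (φ s) s
    rwa [hl] at this
  have m4 : π (φ s) * f (c s) = π (φ s) := by
    have := H.map_right (φ s) s
    rwa [hr] at this
  have m5 : f (c s) * π ψ = π ψ := by
    have := H.map_left ψ s
    rwa [h5] at this
  have m6 : π ψ * f (c s) = π ψ := by
    have := H.map_right ψ s
    rwa [h6] at this
  refine ⟨⟨_, 1 - f (c s) + π ψ, ?_, ?_⟩, rfl⟩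
  · simp only [mul_add, add_mul, mul_sub, sub_mul, one_mul, mul_one, m1, m4, m5, (hf.idem _).eq]
    abel
  · simp only [mul_add, add_mul, mul_sub, sub_mul, one_mul, mul_one, m2, m6, m3, (hf.idem _).eq]
    abel

end Moment

/-! ### One fusion of an algebra with double bracket. -/

namespace BracketAlg

variable {k : Type u} [Field k] (A : BracketAlg.{u, v, w} k) {i j : A.ι} (hij : i ≠ j)

lemma fuse_isFused : IsFused A.e (A.fuse i j hij).e (fuseIndex hij)
    (Fus.proj (k := k) (A.e i) (A.e j)) :=
  DoubleBr.fuse_isFused.{u, v, w} A.complete hij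

lemma fuse_bracket (a b : A.carrier) :
    (A.fuse i j hij).bracket.toFun (Fus.proj (A.e i) (A.e j) a) (Fus.proj (A.e i) (A.e j) b) =
      TensorProduct.map (Fus.proj (A.e i) (A.e j)) (Fus.proj (A.e i) (A.e j))
        (A.bracket.toFun a b) - (1 / 2 : k) • wedge (euler A.e (Fus.proj (A.e i) (A.e j)) i)
        (euler A.e (Fus.proj (A.e i) (A.e j)) j) a b :=
  fuse_bracket_proj A.complete A.bracket hij a b

lemma fuseIndex_injOn {s t : A.ι} (h : fuseIndex hij s = fuseIndex hij t) (hs : s ≠ j)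
    (ht : t ≠ j) : s = t := by
  rw [fuseIndex_of_ne hij hs, fuseIndex_of_ne hij ht] at h
  exact congrArg Subtype.val h

lemma fuse_isQuasiPoisson [CharZero k] (hA : A.bracket.IsQuasiPoisson) :
    (A.fuse i j hij).bracket.IsQuasiPoisson := by
  have hsurj : Function.Surjective (fuseIndex hij) := fuseIndex_surjective hij
  exact isQuasiPoisson_of_wedge A.complete (A.fuse i j hij).complete (A.fuse_isFused hij) hij
    (by rw [fuseIndex_self, fuseIndex_of_ne hij hij])
    (fun s t h hs ht => A.fuseIndex_injOn hij h hs ht) hsurj (A.fuse_bracket hij) hA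

variable {φ : A.ι → A.carrier}

lemma fuseMoment_sum (hφ : ∀ s, A.bracket.IsMultiplicativeAt s (φ s)) :
    A.fuseMoment i j hij (∑ s, φ s) =
      ∑ r : (A.fuse i j hij).ι, fuseComponent (k := k) i (Fus.proj (A.e i) (A.e j)) φ r := by
  have hcomp : ∀ s, A.e s * (∑ t, φ t) * A.e s = φ s := by
    intro s
    have hl : ∀ t, A.e t * φ t = φ t := fun t => (hφ t).idem_mul (A.complete.idem t).eq
    rw [Finset.mul_sum, Finset.sum_eq_single s, (hφ s).idem_mul (A.complete.idem s).eq,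
      (hφ s).mul_idem (A.complete.idem s).eq]
    · intro t _ ht
      rw [← hl t, ← mul_assoc, A.complete.ortho (Ne.symm ht), zero_mul]
    · simp
  have h1 : ∑ r : {s : A.ι // s ≠ j}, fuseComponent (k := k) i (Fus.proj (A.e i) (A.e j)) φ r =
      ∑ s with s ≠ j, if s = i then Fus.proj (k := k) (A.e i) (A.e j) (φ i) *
        Fus.proj (A.e i) (A.e j) (φ j) else Fus.proj (A.e i) (A.e j) (φ s) :=
    (Finset.sum_subtype (p := fun s => s ≠ j) (Finset.univ.filter fun s => s ≠ j) (by simp)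
      (fun s => if s = i then Fus.proj (k := k) (A.e i) (A.e j) (φ i) *
        Fus.proj (A.e i) (A.e j) (φ j) else Fus.proj (A.e i) (A.e j) (φ s))).symm
  have h2 : (Finset.univ.filter fun s : A.ι => s ≠ j).erase i =
      Finset.univ.filter fun s => s ≠ i ∧ s ≠ j := by
    ext s
    simp
  refine Eq.trans ?_ h1.symm
  rw [← Finset.add_sum_erase _ _ (show i ∈ Finset.univ.filter fun s : A.ι => s ≠ j by simp [hij]),
    if_pos rfl, h2]
  unfold fuseMoment
  simp only [hcomp]
  congr 1
  refine Finset.sum_congr rfl fun s hs => ?_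
  rw [if_neg (Finset.mem_filter.1 hs).2.1]

lemma fuseComponent_isMultiplicativeAt (hφ : ∀ s, A.bracket.IsMultiplicativeAt s (φ s))
    (r : (A.fuse i j hij).ι) : (A.fuse i j hij).bracket.IsMultiplicativeAt r
      (fuseComponent (k := k) i (Fus.proj (A.e i) (A.e j)) φ r) := by
  unfold fuseComponent
  split_ifs with hr
  · obtain rfl : r = ⟨i, hij⟩ := Subtype.ext hr
    have h1 : fuseIndex hij i = ⟨i, hij⟩ := fuseIndex_of_ne hij hij
    have := isMultiplicativeAt_mul A.complete (A.fuse i j hij).complete (A.fuse_isFused hij) hij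
      (by rw [fuseIndex_self, h1]) (fun s hs => ?_) (A.fuse_bracket hij) (hφ i) (hφ j)
    · rwa [h1] at this
    · by_cases hsj : s = j
      · exact .inr hsj
      · exact .inl (A.fuseIndex_injOn hij hs hsj hij)
  · have h1 : fuseIndex hij r.1 = r := fuseIndex_coe hij r
    have := isMultiplicativeAt_map_of_ne A.complete (A.fuse i j hij).complete (A.fuse_isFused hij)
      (A.fuse_bracket hij) (s := r.1) (fun t ht => ?_) hr r.2 (hφ r.1)
    · rwa [h1] at this
    · by_cases htj : t = j
      · rw [htj, fuseIndex_self, h1] at ht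
        exact absurd (congrArg Subtype.val ht).symm hr
      · exact A.fuseIndex_injOn hij ht htj r.2

end BracketAlg

/-- With no fusion all idempotents are orthogonal and every wedge vanishes. Any order is therefore
admissible at the end of a chain, in particular the arbitrary enumeration chosen in
`FusionChain.order`. -/
lemma hasOrder_id {k : Type u} [Field k] {ι : Type*} [Fintype ι] {A : Type w} [Ring A]
    [Algebra k A] {e : ι → A} (he : CompleteOrthogonalIdempotents e) (β : DoubleBracket k e)
    {l : List ι} (hl : l.Nodup) : HasOrder β β LinearMap.id l := by
  intro a b
  have H := (IsFused.refl (k := k) he).hom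
  rw [pairSum_eq_zero (hl.imp fun {s t} hst => ?_), TensorProduct.map_id, LinearMap.id_apply,
    LinearMap.id_apply, LinearMap.id_apply, smul_zero, sub_zero]
  rw [wedge_apply, starMul_euler_eq_zero H (he.ortho hst) (he.ortho hst.symm),
    starMul_euler_eq_zero H (he.ortho hst.symm) (he.ortho hst), sub_zero]

/-! ### Universality, order and moment map of a whole chain. -/

namespace FusionChain

variable {k : Type u} [Field k]

/-- The composition of the maps `a ↦ a^f` along a chain of fusions. -/
def proj : {A : BracketAlg.{u, v, w} k} → (F : FusionChain A) → A.carrier →ₗ[k] F.target.carrier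
  | _, nil _ => LinearMap.id
  | A, cons i j _ F => F.proj ∘ₗ Fus.proj (A.e i) (A.e j)

/-- The order in which a chain of fusions arranges the idempotents. -/
def order : {A : BracketAlg.{u, v, w} k} → FusionChain A → List A.ι
  | A, nil _ => (Finset.univ : Finset A.ι).toList
  | _, cons i j _ F => F.order.flatMap (splitIndex i j)

variable {A : BracketAlg.{u, v, w} k} (F : FusionChain A)

lemma order_nodup : F.order.Nodup := by
  induction F with
  | nil A => exact Finset.nodup_toList _
  | cons i j hij F ih => exact nodup_flatMap_splitIndex hij ih

lemma mem_order (s : A.ι) : s ∈ F.order := by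
  induction F with
  | nil A => exact Finset.mem_toList.2 (Finset.mem_univ s)
  | cons i j hij F ih => exact mem_flatMap_splitIndex hij ih s

lemma index_surjective : Function.Surjective F.index := by
  induction F with
  | nil A => exact Function.surjective_id
  | cons i j hij F ih => exact ih.comp (fuseIndex_surjective hij)

lemma isFused : IsFused A.e F.target.e F.index F.proj := by
  induction F with
  | nil A => exact IsFused.refl A.complete
  | @cons A i j hij F ih =>
    exact IsFused.trans A.complete (A.fuse i j hij).complete (A.fuse_isFused hij) ih

lemma hasOrder : HasOrder A.bracket F.target.bracket F.proj F.order := by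
  induction F with
  | nil A => exact hasOrder_id A.complete A.bracket (Finset.nodup_toList _)
  | @cons A i j hij F ih =>
    exact ih.comp A.complete (A.fuse i j hij).complete hij (A.fuse_isFused hij).hom F.isFused.hom
      (A.fuse_bracket hij) F.order_nodup F.mem_order

lemma isQuasiPoisson [CharZero k] (hA : A.bracket.IsQuasiPoisson) :
    F.target.bracket.IsQuasiPoisson := by
  induction F with
  | nil A => exact hA
  | @cons A i j hij F ih => exact ih (A.fuse_isQuasiPoisson hij hA)

lemma exists_moment_components {φ : A.ι → A.carrier}
    (hφ : ∀ s, A.bracket.IsMultiplicativeAt s (φ s)) :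
    ∃ χ : F.target.ι → F.target.carrier, F.moment (∑ s, φ s) = ∑ r, χ r ∧
      ∀ r, F.target.bracket.IsMultiplicativeAt r (χ r) := by
  induction F with
  | nil A => exact ⟨φ, rfl, hφ⟩
  | @cons A i j hij F ih =>
    obtain ⟨χ, h1, h2⟩ := ih (A.fuseComponent_isMultiplicativeAt hij hφ)
    exact ⟨χ, (congrArg F.moment (A.fuseMoment_sum hij hφ)).trans h1, h2⟩

/-- The same list that orders the Euler terms orders the factors of the moment map. This is why one
sequence of exchanges serves both. -/
lemma moment_eq {φ : A.ι → A.carrier} (hφ : ∀ s, A.bracket.IsMultiplicativeAt s (φ s)) :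
    F.moment (∑ s, φ s) = momentProd F.target.e F.index F.proj φ F.order := by
  have hl : ∀ s, A.e s * φ s = φ s := fun s => (hφ s).idem_mul (A.complete.idem s).eq
  have hr : ∀ s, φ s * A.e s = φ s := fun s => (hφ s).mul_idem (A.complete.idem s).eq
  induction F with
  | nil A => exact (momentProd_id (k := k) A.complete hl hr).symm
  | @cons A i j hij F ih =>
    have hφ' := A.fuseComponent_isMultiplicativeAt hij hφ
    have h1 := ih hφ' (fun s => (hφ' s).idem_mul ((A.fuse i j hij).complete.idem s).eq)
      (fun s => (hφ' s).mul_idem ((A.fuse i j hij).complete.idem s).eq)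
    refine (congrArg F.moment (A.fuseMoment_sum hij hφ)).trans (h1.trans ?_)
    exact momentProd_comp F.target.complete.toOrthogonalIdempotents hij
      (A.fuse_isFused hij).hom F.isFused.hom hl hr F.order

lemma isMomentMap {Φ : A.carrier} (hΦ : A.bracket.IsMomentMap Φ) :
    F.target.bracket.IsMomentMap (F.moment Φ) := by
  obtain ⟨hu, φ, rfl, hφ⟩ := hΦ
  refine ⟨?_, F.exists_moment_components hφ⟩
  rw [F.moment_eq hφ]
  exact isUnit_momentProd A.complete F.target.complete.toOrthogonalIdempotents F.isFused.hom
    (fun s => (hφ s).idem_mul (A.complete.idem s).eq)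
    (fun s => (hφ s).mul_idem (A.complete.idem s).eq) hu _

end FusionChain

/-! ### Uniqueness of fused algebras -/

section Unique

variable {k : Type u} [Field k] {ι ι₁ ι₂ : Type*}

lemma map_starMul {D S : Type*} [Ring D] [Algebra k D] [Ring S] [Algebra k S] (ψ : D →ₐ[k] S)
    (d d' : D ⊗[k] D) :
    TensorProduct.map ψ.toLinearMap ψ.toLinearMap (starMul d d') =
      starMul (TensorProduct.map ψ.toLinearMap ψ.toLinearMap d)
        (TensorProduct.map ψ.toLinearMap ψ.toLinearMap d') := by
  induction d using TensorProduct.induction_on with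
  | zero => simp
  | add x y hx hy => simp only [map_add, LinearMap.add_apply, hx, hy]
  | tmul a b =>
    induction d' using TensorProduct.induction_on with
    | zero => simp
    | add x y hx hy => simp only [map_add, hx, hy]
    | tmul x y => simp

/-- With equal lists, both brackets are given on generators by the same expression in β and the
Euler maps, and an algebra map commutes with `starMul`. The Leibniz rules do the rest. -/
lemma IsFused.map_bracket {A D S : Type w} [Ring A] [Algebra k A] [Ring D] [Algebra k D] [Ring S]
    [Algebra k S] {e : ι → A} {f₁ : ι₁ → D} {f₂ : ι₂ → S} {c : ι → ι₁} {π : A →ₗ[k] D}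
    (H : IsFused e f₁ c π) {β : DoubleBracket k e} {γ₁ : DoubleBracket k f₁}
    {γ₂ : DoubleBracket k f₂} (ψ : D →ₐ[k] S) {l : List ι} (h₁ : HasOrder β γ₁ π l)
    (h₂ : HasOrder β γ₂ (ψ.toLinearMap ∘ₗ π) l) (x y : D) :
    γ₂.toFun (ψ x) (ψ y) =
      TensorProduct.map ψ.toLinearMap ψ.toLinearMap (γ₁.toFun x y) := by
  have hmul : ∀ d d', TensorProduct.map ψ.toLinearMap ψ.toLinearMap (d * d') =
      TensorProduct.map ψ.toLinearMap ψ.toLinearMap d *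
        TensorProduct.map ψ.toLinearMap ψ.toLinearMap d' :=
    map_mul (Algebra.TensorProduct.map ψ ψ)
  have hEuler : ∀ s a, TensorProduct.map ψ.toLinearMap ψ.toLinearMap (euler e π s a) =
      euler e (ψ.toLinearMap ∘ₗ π) s a := fun s a => by simp [euler_apply]
  have hgen : ∀ a b, γ₂.toFun (ψ (π a)) (ψ (π b)) =
      TensorProduct.map ψ.toLinearMap ψ.toLinearMap (γ₁.toFun (π a) (π b)) := by
    intro a b
    have h3 := h₂ a b
    simp only [LinearMap.comp_apply, AlgHom.toLinearMap_apply] at h3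
    rw [h3, h₁, map_sub, map_smul, TensorProduct.map_comp, LinearMap.comp_apply]
    congr 2
    refine Eq.trans (pairSum_congr (fun s t => ?_) l) (map_pairSum
      (TensorProduct.map ψ.toLinearMap ψ.toLinearMap : D ⊗[k] D →+ S ⊗[k] S) _ l).symm
    simp only [AddMonoidHom.coe_coe, wedge_apply, map_sub, map_starMul, hEuler]
  have hleft : ∀ a y, γ₂.toFun (ψ (π a)) (ψ y) =
      TensorProduct.map ψ.toLinearMap ψ.toLinearMap (γ₁.toFun (π a) y) := by
    intro a
    refine H.induction _ (hgen a) (fun y z hy hz => ?_) (fun y z hy hz => ?_)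
    · simp only [map_add, hy, hz]
    · rw [map_mul, γ₂.leibniz, γ₁.leibniz, hy, hz, map_add, hmul, hmul]
      simp
  revert y
  refine H.induction (fun x => ∀ y, γ₂.toFun (ψ x) (ψ y) =
    TensorProduct.map ψ.toLinearMap ψ.toLinearMap (γ₁.toFun x y)) hleft (fun x z hx hz y => ?_) (fun x z hx hz y => ?_) x
  · simp only [map_add, LinearMap.add_apply, hx, hz]
  · rw [map_mul, γ₂.leibniz_left, γ₁.leibniz_left, hx, hz, map_add, hmul, hmul]
    simp

/-- Equal fibres match the two index sets, after which each algebra satisfies the universal property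
for the other's map. The two resulting homomorphisms are inverse to each other on generators. -/
lemma IsFused.exists_algEquiv [Fintype ι] [Fintype ι₁] [Fintype ι₂] {A D S : Type w} [Ring A]
    [Algebra k A] [Ring D] [Algebra k D] [Ring S] [Algebra k S] {e : ι → A} {f₁ : ι₁ → D}
    {f₂ : ι₂ → S} {c₁ : ι → ι₁} {c₂ : ι → ι₂} {π₁ : A →ₗ[k] D} {π₂ : A →ₗ[k] S}
    (hf₁ : CompleteOrthogonalIdempotents f₁) (hf₂ : CompleteOrthogonalIdempotents f₂)
    (hs₁ : Function.Surjective c₁) (hs₂ : Function.Surjective c₂)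
    (hc : ∀ s t, c₁ s = c₁ t ↔ c₂ s = c₂ t) (H₁ : IsFused e f₁ c₁ π₁) (H₂ : IsFused e f₂ c₂ π₂) :
    ∃ ψ : D ≃ₐ[k] S, ∀ a, ψ (π₁ a) = π₂ a := by
  choose r₁ hr₁ using hs₁
  choose r₂ hr₂ using hs₂
  let σ : ι₁ ≃ ι₂ :=
    { toFun := fun r => c₂ (r₁ r)
      invFun := fun r => c₁ (r₂ r)
      left_inv := fun r => by rw [← hr₁ r, hc, hr₂, hr₁]
      right_inv := fun r => by rw [← hr₂ r, ← hc, hr₁, hr₂] }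
  have hσ : σ ∘ c₁ = c₂ := funext fun s => (hc _ _).1 (hr₁ (c₁ s))
  have hσ' : σ.symm ∘ c₂ = c₁ := funext fun s => (hc _ _).2 (hr₂ (c₂ s))
  obtain ⟨G₁, hG₁, hG₁π⟩ := H₁.lift S (f₂ ∘ σ) π₂ (by
    rw [Function.comp_assoc, hσ]; exact H₂.hom)
  obtain ⟨G₂, hG₂, hG₂π⟩ := H₂.lift D (f₁ ∘ σ.symm) π₁ (by
    rw [Function.comp_assoc, hσ']; exact H₁.hom)
  let g₁ := hG₁.toAlgHom hf₁ ((CompleteOrthogonalIdempotents.equiv σ).2 hf₂)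
  let g₂ := hG₂.toAlgHom hf₂ ((CompleteOrthogonalIdempotents.equiv σ.symm).2 hf₁)
  have e₁ : ∀ a, g₁ (π₁ a) = π₂ a := hG₁π
  have e₂ : ∀ a, g₂ (π₂ a) = π₁ a := hG₂π
  refine ⟨AlgEquiv.ofAlgHom g₁ g₂ (AlgHom.ext ?_) (AlgHom.ext ?_), e₁⟩
  · exact H₂.induction _ (fun a => by simp [e₁, e₂]) (fun x y hx hy => by rw [map_add, map_add, hx, hy])
      (fun x y hx hy => by rw [map_mul, map_mul, hx, hy])
  · exact H₁.induction _ (fun a => by simp [e₁, e₂]) (fun x y hx hy => by rw [map_add, map_add, hx, hy])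
      (fun x y hx hy => by rw [map_mul, map_mul, hx, hy])

end Unique

end DoubleBr

end

universe u v w x

open DoubleBr in
theorem mainTheorem4 {k : Type u} [Field k] [CharZero k]
    (A : BracketAlg.{u, v, w} k) (hA : A.bracket.IsQuasiPoisson)
    {J : Type x} (c : A.ι → J) (F₁ F₂ : FusionChain A)
    (hF₁ : F₁.Respects c) (hF₂ : F₂.Respects c)
    (hΦ : ∀ s : A.ι, (∃ t, t ≠ s ∧ c t = c s) →
      ∃ Φ Ψ : A.carrier, A.bracket.IsMultiplicativeAt s Φ ∧
        A.e s * Ψ * A.e s = Ψ ∧ Φ * Ψ = A.e s ∧ Ψ * Φ = A.e s) :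
    F₁.target.bracket.IsQuasiPoisson ∧ F₂.target.bracket.IsQuasiPoisson ∧
    ∃ ψ : F₁.target.carrier ≃ₐ[k] F₂.target.carrier,
      (∀ s, ψ (F₁.target.e (F₁.index s)) = F₂.target.e (F₂.index s)) ∧
      (∀ a b, F₂.target.bracket.toFun (ψ a) (ψ b) =
        TensorProduct.map ψ.toLinearMap ψ.toLinearMap (F₁.target.bracket.toFun a b)) ∧
      ∀ Φ : A.carrier, A.bracket.IsMomentMap Φ →
        F₁.target.bracket.IsMomentMap (F₁.moment Φ) ∧
        F₂.target.bracket.IsMomentMap (F₂.moment Φ) ∧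
        ψ (F₁.moment Φ) = F₂.moment Φ := by
  refine ⟨F₁.isQuasiPoisson hA, F₂.isQuasiPoisson hA, ?_⟩
  have hperm : F₁.order.Perm F₂.order :=
    (List.perm_ext_iff_of_nodup F₁.order_nodup F₂.order_nodup).2 fun s =>
      ⟨fun _ => F₂.mem_order s, fun _ => F₁.mem_order s⟩
  -- All exchanges take place inside the first fusion algebra: its bracket stays the same, and only
  -- the generating map changes until its order is that of the second chain.
  obtain ⟨ρ, hρ, hord, hmom⟩ := HasOrder.exists_perm A.complete F₁.target.complete
    F₁.index_surjective (fun s ⟨t, hts, ht⟩ => hΦ s ⟨t, hts, (hF₁ t s).1 ht⟩) hperm [] F₁.proj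
    F₁.order_nodup F₁.isFused F₁.hasOrder
  -- It is the twisted map ρ, not `F₁.proj`, that ψ carries to `F₂.proj`; the twist is what makes ψ
  -- compatible with the brackets.
  obtain ⟨ψ, hψ⟩ := hρ.exists_algEquiv F₁.target.complete F₂.target.complete F₁.index_surjective
    F₂.index_surjective (fun s t => (hF₁ s t).trans (hF₂ s t).symm) F₂.isFused
  have hψρ : (ψ : F₁.target.carrier →ₐ[k] F₂.target.carrier).toLinearMap ∘ₗ ρ = F₂.proj :=
    LinearMap.ext hψ
  have hidem : ∀ s, ψ (F₁.target.e (F₁.index s)) = F₂.target.e (F₂.index s) := fun s => by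
    have h1 := hρ.hom.map_idem s
    have h2 := F₂.isFused.hom.map_idem s
    rw [Function.comp_apply] at h1 h2
    rw [← h1, hψ, h2]
  refine ⟨ψ, hidem, ?_, fun Φ hM => ⟨F₁.isMomentMap hM, F₂.isMomentMap hM, ?_⟩⟩
  · exact hρ.map_bracket (ψ : F₁.target.carrier →ₐ[k] F₂.target.carrier) hord
      (by rw [hψρ]; exact F₂.hasOrder)
  · obtain ⟨-, φ, rfl, hφ⟩ := hM
    rw [F₁.moment_eq hφ, F₂.moment_eq hφ]
    refine (congrArg ψ (hmom φ hφ)).trans ?_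
    simp only [momentProd, List.nil_append, map_list_prod, List.map_map, Function.comp_def,
      map_add, map_sub, map_one, hidem, hψ]
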